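/- Let $E$ be a finite-dimensional real vector space, $Q\subset E$ a connected open set with tangent bundle $TQ=Q\times E$, $\vartheta$ a smooth ($C^\infty$) one-form on $Q$ such that $\omega=-\mathbf{d}\vartheta$ is symplectic, $\mathbb{J}$ a smooth almost complex structure on $Q$ compatible with $\omega$, so that $g_q(v,w)=\omega_q(v,\mathbb{J}_qw)$ is a Riemannian metric, $|v|_q=\sqrt{g_q(v,v)}$, $H:Q\to\mathbb{R}$ a smooth function, and $X_H$ its Hamiltonian vector field, $\omega(X_H,\cdot)=\mathbf{d}H$. Let $\theta_0\in\mathbb{R}$ be non-resonant: $\theta_0/2\pi\notin\mathbb{Q}$. For $\hbar\in\mathbb{R}$ put $$S_\hbar(q,\overline q)=\int_q^{\overline q}\vartheta+\Sigma_\hbar\Big(\tfrac{q+\overline q}{2},\,\overline q-q\Big),$$ where the integral is along the straight line from $q$ to $\overline q$ and $$\Sigma_\hbar(x,\xi)=-\hbar H(x)+\hbar^2 g_x(X_H(x),\xi)-\tfrac1{12}\hbar^2\,\partial_k\omega_{j\ell}(x)X_H^k(x)X_H^j(x)\xi^\ell-\tfrac14\,\frac{\sin\theta_0}{1-\cos\theta_0}\,g_x\big(\xi-\hbar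 X_H(x),\xi-\hbar X_H(x)\big).$$ A symplectic Lorentz map is a family $\Psi_\hbar:(q,v)\mapsto(\overline q,\overline v)$ of maps into $TQ$, defined and jointly continuous for $(\hbar,(q,v))$ in an open neighbourhood $U$ of $\{0\}\times TQ$ in $\mathbb{R}\times TQ$, such that $\Psi_0$ fixes base points ($\overline q=q$ when $\hbar=0$) and, for all $(\hbar,(q,v))\in U$, the segment from $q$ to $\overline q$ lies in $Q$ and $$\vartheta_{\overline q}+\hbar^2 g_{\overline q}(\overline v,\cdot)=\partial_{\overline q}S_\hbar(q,\overline q),\qquad \vartheta_q+\hbar^2 g_q(v,\cdot)=-\partial_qS_\hbar(q,\overline q).$$ For a compact set $C\subset TQ$, a point $(q,v)$ is positively-contained in $C$ (for the parameter value $\hbar$) if all iterates $\Psi_\hbar^k(q,v)$, $k\ge 0$, are defined and lie in $C$. Then a symplectic Lorentz map exists. Moreover, for every symplectic Lorentz map $\Psi_\hbar$, every compact $C\subset TQ$, every $N>0$ and every $V_0>0$ there is a constant $V_1>0$, independent of $\hbar$ and of the initial point, such that for every $\hbar>0$ and every $(q,v)$ that is positively-contained in $C$ and satisfies $$|v-X_H(q)|_q<V_0\sqrt\hbar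 ,$$ the iterates $(q^k,v^k)=\Psi_\hbar^k(q,v)$ satisfy $$|v^k-X_H(q^k)|_{q^k}\le V_1\sqrt\hbar\qquad\text{for all integers } 0\le k\le \hbar^{-N}.$$ This is long-term normal stability of the graph of $X_H$. -/

import Mathlib

open Set Topology
open scoped ContDiff

/-!
Geometry on an open subset `Q` of a finite-dimensional real vector space `E`.
A one-form is a function `E → E →L[ℝ] ℝ`, of which only the values on `Q` matter;
the tangent bundle `TQ` is `Q ×ˢ univ ⊆ E × E`, a tangent vector being a pair `(q, v)`.
-/

namespace SymplecticLorentz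

noncomputable section

/-- The two-form `ω = -dϑ`, that is `ω_q(u, w) = (Dϑ_q w) u - (Dϑ_q u) w`, as a bilinear map. -/
def omega {E : Type*} [NormedAddCommGroup E] [NormedSpace ℝ E]
    (ϑ : E → E →L[ℝ] ℝ) (q : E) : E →L[ℝ] E →L[ℝ] ℝ :=
  (fderiv ℝ ϑ q).flip - fderiv ℝ ϑ q

/-- `omega` is minus the exterior derivative of the one-form `ϑ`. -/
theorem omega_eq_neg_extDeriv {E : Type*} [NormedAddCommGroup E] [NormedSpace ℝ E]
    (ϑ : E → E →L[ℝ] ℝ) (q u w : E) (hϑ : DifferentiableAt ℝ ϑ q) :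
    omega ϑ q u w =
      -extDeriv (fun x => ContinuousAlternatingMap.ofSubsingleton ℝ E ℝ (0 : Fin 1) (ϑ x))
        q ![u, w] := by
  have hd : HasFDerivAt
      (fun x => ContinuousAlternatingMap.ofSubsingleton ℝ E ℝ (0 : Fin 1) (ϑ x))
      (((ContinuousAlternatingMap.ofSubsingletonLIE (𝕜 := ℝ) (E := E) (F := ℝ)
        (0 : Fin 1)).toContinuousLinearEquiv.toContinuousLinearMap).comp (fderiv ℝ ϑ q)) q :=
    (ContinuousAlternatingMap.ofSubsingletonLIE (𝕜 := ℝ) (E := E) (F := ℝ)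
      (0 : Fin 1)).toContinuousLinearEquiv.toContinuousLinearMap.hasFDerivAt.comp q
      hϑ.hasFDerivAt
  have he : ∀ a : E, fderiv ℝ (fun x => ϑ x a) q = (fderiv ℝ ϑ q).flip a := fun a => by
    ext z
    simp [fderiv_clm_apply hϑ (differentiableAt_const a)]
  rw [extDeriv_apply hd.differentiableAt]
  simp [Fin.sum_univ_two, omega, Fin.removeNth, he]
  ring

/-- The bilinear form `g_q(v, w) = ω_q(v, J_q w)`. -/
def metric {E : Type*} [NormedAddCommGroup E] [NormedSpace ℝ E]
    (ϑ : E → E →L[ℝ] ℝ) (J : E → E →L[ℝ] E) (q v w : E) : ℝ :=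
  omega ϑ q v (J q w)

/-- The velocity norm `|v|_q = √(g_q(v, v))`. -/
def velNorm {E : Type*} [NormedAddCommGroup E] [NormedSpace ℝ E]
    (ϑ : E → E →L[ℝ] ℝ) (J : E → E →L[ℝ] E) (q v : E) : ℝ :=
  Real.sqrt (metric ϑ J q v v)

/-- `ω = -dϑ` is an exact symplectic form on `Q`: `ϑ` is smooth and `ω` is nondegenerate
(closedness is automatic). -/
structure IsExactSymplectic {E : Type*} [NormedAddCommGroup E] [NormedSpace ℝ E]
    (Q : Set E) (ϑ : E → E →L[ℝ] ℝ) : Prop where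
  smooth : ContDiffOn ℝ ∞ ϑ Q
  nondegenerate : ∀ q ∈ Q, ∀ u, (∀ w, omega ϑ q u w = 0) → u = 0

/-- `J` is a smooth almost complex structure on `Q` compatible with `ω = -dϑ`:
`g(v, w) = ω(v, J w)` is a Riemannian metric. -/
structure IsCompatibleComplexStructure {E : Type*} [NormedAddCommGroup E] [NormedSpace ℝ E]
    (Q : Set E) (ϑ : E → E →L[ℝ] ℝ) (J : E → E →L[ℝ] E) : Prop where
  smooth : ContDiffOn ℝ ∞ J Q
  sq_eq_neg : ∀ q ∈ Q, ∀ v, J q (J q v) = -v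
  symm : ∀ q ∈ Q, ∀ v w, metric ϑ J q v w = metric ϑ J q w v
  pos : ∀ q ∈ Q, ∀ v, v ≠ 0 → 0 < metric ϑ J q v v

/-- The Hamiltonian vector field `X_H`, the solution of `ω(X_H, ·) = dH`. -/
def hamVF {E : Type*} [NormedAddCommGroup E] [NormedSpace ℝ E]
    (ϑ : E → E →L[ℝ] ℝ) (H : E → ℝ) (q : E) : E :=
  (omega ϑ q).inverse (fderiv ℝ H q)

/-- Hamilton's equation characterises `hamVF` wherever `ω` is nondegenerate. -/
theorem eq_hamVF_iff {E : Type*} [NormedAddCommGroup E] [NormedSpace ℝ E]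
    [FiniteDimensional ℝ E] (ϑ : E → E →L[ℝ] ℝ) (H : E → ℝ) (q X : E)
    (hω : ∀ u, (∀ w, omega ϑ q u w = 0) → u = 0) :
    X = hamVF ϑ H q ↔ ∀ w, omega ϑ q X w = fderiv ℝ H q w := by
  have hinj : Function.Injective (omega ϑ q : E →ₗ[ℝ] (E →L[ℝ] ℝ)) := by
    rw [injective_iff_map_eq_zero]
    intro u hu
    exact hω u fun w => by simpa using congrArg (fun f : E →L[ℝ] ℝ => f w) hu
  have hfin : Module.finrank ℝ E = Module.finrank ℝ (E →L[ℝ] ℝ) := by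
    rw [← LinearEquiv.finrank_eq (LinearMap.toContinuousLinearMap (𝕜 := ℝ) (E := E) (F' := ℝ))]
    exact (Subspace.dual_finrank_eq).symm
  have hinv : (omega ϑ q).IsInvertible :=
    ⟨(LinearEquiv.ofInjectiveOfFinrankEq _ hinj hfin).toContinuousLinearEquiv, by ext; rfl⟩
  rw [hamVF, eq_comm, hinv.inverse_apply_eq, eq_comm, ContinuousLinearMap.ext_iff]

/-- The function `Σ_ħ(x, ξ)` on `TQ`; the third term is
`-(1/12) ħ² ∂_k ω_{jℓ}(x) X_H^k(x) X_H^j(x) ξ^ℓ`. -/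
def genSigma {E : Type*} [NormedAddCommGroup E] [NormedSpace ℝ E]
    (ϑ : E → E →L[ℝ] ℝ) (J : E → E →L[ℝ] E) (H : E → ℝ) (θ₀ ħ : ℝ) (x ξ : E) : ℝ :=
  -ħ * H x + ħ ^ 2 * metric ϑ J x (hamVF ϑ H x) ξ
    - (1 / 12) * ħ ^ 2 * (fderiv ℝ (omega ϑ) x (hamVF ϑ H x)) (hamVF ϑ H x) ξ
    - (1 / 4) * (Real.sin θ₀ / (1 - Real.cos θ₀)) *
        metric ϑ J x (ξ - ħ • hamVF ϑ H x) (ξ - ħ • hamVF ϑ H x)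

/-- The generating function `S_ħ(q, q') = ∫_q^{q'} ϑ + Σ_ħ((q + q') / 2, q' - q)`, with the
integral taken along the straight line from `q` to `q'`. -/
def genS {E : Type*} [NormedAddCommGroup E] [NormedSpace ℝ E]
    (ϑ : E → E →L[ℝ] ℝ) (J : E → E →L[ℝ] E) (H : E → ℝ) (θ₀ ħ : ℝ) (q q' : E) : ℝ :=
  (∫ t in (0 : ℝ)..1, ϑ (q + t • (q' - q)) (q' - q))
    + genSigma ϑ J H θ₀ ħ ((1 / 2 : ℝ) • (q + q')) (q' - q)

/-- The implicit relations between `p = (q, v)` and its image `p' = (q', v')`: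
`ϑ_{q'} + ħ² g_{q'}(v', ·) = ∂S_ħ/∂q'` and `ϑ_q + ħ² g_q(v, ·) = -∂S_ħ/∂q`
(together with the condition that makes the line integral in `S_ħ` meaningful). -/
structure Relations {E : Type*} [NormedAddCommGroup E] [NormedSpace ℝ E]
    (Q : Set E) (ϑ : E → E →L[ℝ] ℝ) (J : E → E →L[ℝ] E) (H : E → ℝ) (θ₀ ħ : ℝ)
    (p p' : E × E) : Prop where
  segment_subset : segment ℝ p.1 p'.1 ⊆ Q
  forward : ∀ w, ϑ p'.1 w + ħ ^ 2 * metric ϑ J p'.1 p'.2 w =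
    fderiv ℝ (fun y => genS ϑ J H θ₀ ħ p.1 y) p'.1 w
  backward : ∀ w, ϑ p.1 w + ħ ^ 2 * metric ϑ J p.1 p.2 w =
    -fderiv ℝ (fun y => genS ϑ J H θ₀ ħ y p'.1) p.1 w

/-- `(U, Ψ)` is a symplectic Lorentz map: `U` is an open neighbourhood of `{0} × TQ` in `ℝ × TQ`,
and `(ħ, p) ↦ Ψ ħ p`, `(ħ, p) ∈ U`, is the continuous branch of solutions of the implicit
relations that fixes the base point when `ħ = 0`. The values of `Ψ` outside `U` are irrelevant. -/
structure IsSymplecticLorentzMap {E : Type*} [NormedAddCommGroup E] [NormedSpace ℝ E]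
    (Q : Set E) (ϑ : E → E →L[ℝ] ℝ) (J : E → E →L[ℝ] E) (H : E → ℝ) (θ₀ : ℝ)
    (U : Set (ℝ × (E × E))) (Ψ : ℝ → E × E → E × E) : Prop where
  isOpen : IsOpen U
  subset : U ⊆ univ ×ˢ (Q ×ˢ univ)
  zero_mem : ∀ p ∈ Q ×ˢ (univ : Set E), ((0 : ℝ), p) ∈ U
  continuousOn : ContinuousOn (fun z : ℝ × (E × E) => Ψ z.1 z.2) U
  base_zero : ∀ p ∈ Q ×ˢ (univ : Set E), (Ψ 0 p).1 = p.1
  relations : ∀ ħ p, (ħ, p) ∈ U → Relations Q ϑ J H θ₀ ħ p (Ψ ħ p)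

/-- `p` is positively contained in `C` at parameter `ħ`: all iterates `Ψ_ħ^k(p)`, `k ≥ 0`, are
defined and lie in `C`. -/
def PositivelyContained {E : Type*}
    (U : Set (ℝ × (E × E))) (Ψ : ℝ → E × E → E × E) (C : Set (E × E)) (ħ : ℝ) (p : E × E) :
    Prop :=
  ∀ k : ℕ, (ħ, (Ψ ħ)^[k] p) ∈ U ∧ (Ψ ħ)^[k] p ∈ C

end

end SymplecticLorentz

/-! Write u = v - X_H(q). The coefficients of Σ_ħ are tuned so that, in the coordinates (q, u), a
symplectic Lorentz map with ħ ≠ 0 agrees near the zero section with a smooth family f(ħ, ·) whose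
limit at ħ = 0 is (q, u) ↦ (q, cos θ u - sin θ J u). The implicit relations say that f pulls the
one-form ϑ + ħ² g(v, dq) back to itself plus an exact form (`IsAdmissible.exists_isRelChart`). The
zero section consists of fixed points of the limit map, with a non-resonant rotation in the fibres,
and stability comes from the adiabatic invariant of such a nearly periodic map.

The invariant is built from orbits, without a normal form. Put e = √ħ and let u = O(e). To every
order in e the iterates y_k are exponential polynomials in k with frequencies in θℤ
(`isExpPolyMod_orbit`): the recursion is solved by variation of constants around the rotation, one
order at a time. As θ/2π is irrational, the numbers exp(imθ) are distinct, and there are finitely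
many weights a_k(φ) whose weighted sums substitute φ for kθ and 0 for the secular variable k
(`exists_weights`). Applied to an orbit they give a loop γ(φ). The substitution is multiplicative,
hence commutes with smooth maps up to O(e^n) (`IsExpPolyMod.comp_smooth`). So the loop of the image
point is f(γ) up to O(e^n), and since exact forms integrate to zero, the integral of the one-form
over the loop changes by O(e^n) per step (`isBigO_loopAction_succ_sub`).

A second-order expansion of the orbit evaluates this action as -π ħ⁴ g(u, u) + O(e^11)
(`IsApproxOrbit.isBigO_loopAction`), the main term having size e^10. For n = 2m + 11 the drift over
ħ^(-m) steps is O(e^11), so g(u, u) grows by less than ħ, and a bootstrap in the number of steps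
closes (`IsAdmissible.exists_metric_le`). Compactness makes the constants uniform. When ħ is bounded
below, boundedness of the relative velocity on C suffices.

For existence, the implicit function theorem solves the backward relation for the displacement
(`IsAdmissible.exists_localBranch`); the local branches are glued through a characterisation of the
solution that refers to no chart. -/

namespace SymplecticLorentz

open Filter Asymptotics

/-! ### Smooth dependence of integrals on parameters, and Hadamard's lemma. -/

section Analysis

universe u

/-- A neighbourhood property that holds along a compact segment of parameters holds uniformly. -/
theorem eventually_forall_Icc {H : Type*} [TopologicalSpace H] {P : ℝ × H → Prop} {x : H}
    (h : ∀ t ∈ Icc (0 : ℝ) 1, ∀ᶠ z in 𝓝 (t, x), P z) :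
    ∀ᶠ y in 𝓝 x, ∀ t ∈ Icc (0 : ℝ) 1, P (t, y) := by
  refine isCompact_Icc.eventually_forall_of_forall_eventually (P := fun y t => P (t, y))
    fun t ht => ?_
  exact (continuous_swap.tendsto (x, t)).eventually (h t ht)

/-- Differentiation under the integral sign: compactness of the unit interval gives one
neighbourhood of `x` and one constant bounding the derivative for all `t`, and that constant is the
dominating function. -/
theorem hasFDerivAt_integral_Icc {H E : Type*} [NormedAddCommGroup H] [NormedSpace ℝ H]
    [NormedAddCommGroup E] [NormedSpace ℝ E] {f : ℝ × H → E} {x : H}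
    (hf : ∀ t ∈ Icc (0 : ℝ) 1, ContDiffAt ℝ 1 f (t, x)) :
    HasFDerivAt (fun y => ∫ t in (0 : ℝ)..1, f (t, y))
      (∫ t in (0 : ℝ)..1, (fderiv ℝ f (t, x)).comp (ContinuousLinearMap.inr ℝ ℝ H)) x := by
  have hev : ∀ᶠ y in 𝓝 x, ∀ t ∈ Icc (0 : ℝ) 1, ContDiffAt ℝ 1 f (t, y) :=
    eventually_forall_Icc fun t ht => (hf t ht).eventually (by simp)
  have hcont : ∀ y, (∀ t ∈ Icc (0 : ℝ) 1, ContDiffAt ℝ 1 f (t, y)) →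
      ContinuousOn (fun t => f (t, y)) (Icc 0 1) := fun y hy t ht =>
    ContinuousAt.continuousWithinAt <| ContinuousAt.comp (g := f) (f := fun t => (t, y))
      (hy t ht).continuousAt (by fun_prop)
  have hc' : ∀ t ∈ Icc (0 : ℝ) 1, ContinuousAt (fderiv ℝ f) (t, x) := fun t ht =>
    ((hf t ht).fderiv_right (m := 0) (by simp)).continuousAt
  have hd : ContinuousOn (fun t => (fderiv ℝ f (t, x)).comp (ContinuousLinearMap.inr ℝ ℝ H))
      (Icc 0 1) := fun t ht => by
    have h1 : ContinuousAt (fun t => fderiv ℝ f (t, x)) t :=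
      ContinuousAt.comp (g := fderiv ℝ f) (f := fun t => (t, x)) (hc' t ht) (by fun_prop)
    exact (h1.clm_comp continuousAt_const).continuousWithinAt
  obtain ⟨C, hC⟩ := (isCompact_Icc.image_of_continuousOn
    (hd.norm)).bddAbove
  have hb : ∀ᶠ y in 𝓝 x, ∀ t ∈ Icc (0 : ℝ) 1,
      ‖(fderiv ℝ f (t, y)).comp (ContinuousLinearMap.inr ℝ ℝ H)‖ ≤ C + 1 := by
    refine eventually_forall_Icc (P := fun z =>
      ‖(fderiv ℝ f z).comp (ContinuousLinearMap.inr ℝ ℝ H)‖ ≤ C + 1) fun t ht => ?_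
    have h1 : ContinuousAt
        (fun z => ‖(fderiv ℝ f z).comp (ContinuousLinearMap.inr ℝ ℝ H)‖) (t, x) :=
      ((hc' t ht).clm_comp continuousAt_const).norm
    have h2 := hC (mem_image_of_mem _ ht)
    exact (h1.eventually_lt_const (show _ < C + 1 by simp only at h2 ⊢; linarith)).mono
      fun _ h => h.le
  refine intervalIntegral.hasFDerivAt_integral_of_dominated_of_fderiv_le
    (F := fun y t => f (t, y))
    (F' := fun y t => (fderiv ℝ f (t, y)).comp (ContinuousLinearMap.inr ℝ ℝ H))
    (bound := fun _ => C + 1) (hb.and hev) ?_ ?_ ?_ ?_ ?_ ?_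
  · filter_upwards [hev] with y hy
    rw [uIoc_of_le zero_le_one]
    exact ((hcont y hy).mono Ioc_subset_Icc_self).aestronglyMeasurable measurableSet_Ioc
  · exact ContinuousOn.intervalIntegrable (by
      rw [uIcc_of_le zero_le_one]; exact hcont x hf)
  · rw [uIoc_of_le zero_le_one]
    exact (hd.mono Ioc_subset_Icc_self).aestronglyMeasurable measurableSet_Ioc
  · refine Eventually.of_forall fun t ht y hy => hy.1 t ?_
    rw [uIoc_of_le zero_le_one] at ht
    exact Ioc_subset_Icc_self ht
  · simp
  · refine Eventually.of_forall fun t ht y hy => ?_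
    rw [uIoc_of_le zero_le_one] at ht
    have h1 := ((hy.2 t (Ioc_subset_Icc_self ht)).differentiableAt (by simp)).hasFDerivAt
    refine h1.comp y ?_
    exact hasFDerivAt_prodMk_right t y

/-- Induction on `n`: the derivative of such an integral is again one, with values in a space of
linear maps. The target `E` therefore varies in the induction; having it in the universe of `H`
keeps the target of the derivative there as well. -/
theorem contDiffOn_integral_Icc {H : Type u} [NormedAddCommGroup H] [NormedSpace ℝ H] (n : ℕ)
    {E : Type u} [NormedAddCommGroup E] [NormedSpace ℝ E] {f : ℝ × H → E} {U : Set H}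
    (hU : IsOpen U) (hf : ∀ x ∈ U, ∀ t ∈ Icc (0 : ℝ) 1, ContDiffAt ℝ n f (t, x)) :
    ContDiffOn ℝ n (fun y => ∫ t in (0 : ℝ)..1, f (t, y)) U := by
  induction n generalizing E with
  | zero =>
    refine contDiffOn_zero.2 fun x hx => ContinuousAt.continuousWithinAt ?_
    have hcont : ∀ y ∈ U, ContinuousOn (fun t => f (t, y)) (Icc 0 1) := fun y hy t ht =>
      ContinuousAt.continuousWithinAt <| ContinuousAt.comp (g := f) (f := fun t => (t, y))
        (hf y hy t ht).continuousAt (by fun_prop)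
    obtain ⟨C, hC⟩ := (isCompact_Icc.image_of_continuousOn (hcont x hx).norm).bddAbove
    have hb : ∀ᶠ y in 𝓝 x, ∀ t ∈ Icc (0 : ℝ) 1, ‖f (t, y)‖ ≤ C + 1 := by
      refine eventually_forall_Icc (P := fun z => ‖f z‖ ≤ C + 1) fun t ht => ?_
      have h2 := hC (mem_image_of_mem _ ht)
      exact ((hf x hx t ht).continuousAt.norm.eventually_lt_const
        (show _ < C + 1 by simp only at h2 ⊢; linarith)).mono fun _ h => h.le
    refine intervalIntegral.continuousAt_of_dominated_interval (bound := fun _ => C + 1)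
      ?_ ?_ (by simp) ?_
    · filter_upwards [hU.mem_nhds hx] with y hy
      rw [uIoc_of_le zero_le_one]
      exact ((hcont y hy).mono Ioc_subset_Icc_self).aestronglyMeasurable measurableSet_Ioc
    · filter_upwards [hb] with y hy
      refine Eventually.of_forall fun t ht => hy t ?_
      rw [uIoc_of_le zero_le_one] at ht
      exact Ioc_subset_Icc_self ht
    · refine Eventually.of_forall fun t ht => ?_
      rw [uIoc_of_le zero_le_one] at ht
      exact ContinuousAt.comp (g := f) (f := fun y => (t, y))
        (hf x hx t (Ioc_subset_Icc_self ht)).continuousAt (by fun_prop)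
  | succ n ih =>
    have hder : ∀ x ∈ U, HasFDerivAt (fun y => ∫ t in (0 : ℝ)..1, f (t, y))
        (∫ t in (0 : ℝ)..1, (fderiv ℝ f (t, x)).comp (ContinuousLinearMap.inr ℝ ℝ H)) x :=
      fun x hx => hasFDerivAt_integral_Icc fun t ht => (hf x hx t ht).of_le (by simp)
    push_cast
    rw [contDiffOn_succ_iff_fderiv_of_isOpen hU]
    refine ⟨fun x hx => (hder x hx).differentiableAt.differentiableWithinAt, by simp, ?_⟩
    refine (ih (f := fun z => (fderiv ℝ f z).comp (ContinuousLinearMap.inr ℝ ℝ H))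
      fun x hx t ht => ?_).congr fun x hx => (hder x hx).fderiv
    exact ((hf x hx t ht).fderiv_right (m := n) (by simp)).clm_comp contDiffAt_const

theorem contDiffAt_integral_Icc {H : Type u} [NormedAddCommGroup H] [NormedSpace ℝ H]
    {E : Type u} [NormedAddCommGroup E] [NormedSpace ℝ E] {f : ℝ × H → E} {x : H}
    (hf : ∀ t ∈ Icc (0 : ℝ) 1, ContDiffAt ℝ ∞ f (t, x)) :
    ContDiffAt ℝ ∞ (fun y => ∫ t in (0 : ℝ)..1, f (t, y)) x := by
  rw [contDiffAt_infty]
  intro n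
  have hev : ∀ᶠ y in 𝓝 x, ∀ t ∈ Icc (0 : ℝ) 1, ContDiffAt ℝ n f (t, y) :=
    eventually_forall_Icc fun t ht =>
      ((hf t ht).of_le (by exact_mod_cast le_top)).eventually (by simp)
  obtain ⟨U, hU, hUo, hxU⟩ := eventually_nhds_iff.1 hev
  exact (contDiffOn_integral_Icc n hUo fun y hy => hU y hy).contDiffAt (hUo.mem_nhds hxU)

/-- Hadamard's lemma: a smooth `f` is `f x + h (x, y) (y - x)` near a point, with smooth `h`. -/
theorem exists_hadamard {V F : Type u} [NormedAddCommGroup V] [NormedSpace ℝ V]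
    [NormedAddCommGroup F] [NormedSpace ℝ F] [CompleteSpace F] {f : V → F} {a : V}
    (hf : ContDiffAt ℝ ∞ f a) :
    ∃ h : V × V → V →L[ℝ] F, ContDiffAt ℝ ∞ h (a, a) ∧ (∀ x, h (x, x) = fderiv ℝ f x) ∧
      ∀ᶠ z in 𝓝 (a, a), f z.2 = f z.1 + h z (z.2 - z.1) := by
  refine ⟨fun z => ∫ t in (0 : ℝ)..1, fderiv ℝ f (z.1 + t • (z.2 - z.1)), ?_, ?_, ?_⟩
  · refine contDiffAt_integral_Icc
      (f := fun z : ℝ × (V × V) => fderiv ℝ f (z.2.1 + z.1 • (z.2.2 - z.2.1))) fun t _ => ?_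
    have h1 : ContDiffAt ℝ ∞ (fderiv ℝ f) a := hf.fderiv_right (by simp)
    have h2 : ContDiffAt ℝ ∞ (fun z : ℝ × (V × V) => z.2.1 + z.1 • (z.2.2 - z.2.1)) (t, (a, a)) :=
      by fun_prop
    exact ContDiffAt.comp (g := fderiv ℝ f) (t, (a, a)) (by simpa using h1) h2
  · intro x; simp
  · have h1 : ∀ᶠ y in 𝓝 a, ContDiffAt ℝ 1 f y :=
      (hf.of_le (by exact_mod_cast le_top)).eventually (by simp)
    obtain ⟨r, hr, hball⟩ := Metric.eventually_nhds_iff_ball.1 h1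
    filter_upwards [Metric.ball_mem_nhds (a, a) hr] with z hz
    rw [← ball_prod_same] at hz
    have hmem : ∀ t ∈ Icc (0 : ℝ) 1, z.1 + t • (z.2 - z.1) ∈ Metric.ball a r := fun t ht =>
      (convex_ball a r).add_smul_sub_mem hz.1 hz.2 ht
    have hderiv : ∀ t ∈ uIcc (0 : ℝ) 1, HasDerivAt (fun t : ℝ => f (z.1 + t • (z.2 - z.1)))
        (fderiv ℝ f (z.1 + t • (z.2 - z.1)) (z.2 - z.1)) t := fun t ht => by
      rw [uIcc_of_le zero_le_one] at ht
      have h2 : HasDerivAt (fun t : ℝ => z.1 + t • (z.2 - z.1)) (z.2 - z.1) t := by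
        simpa using ((hasDerivAt_id t).smul_const (z.2 - z.1)).const_add z.1
      exact ((hball _ (hmem t ht)).differentiableAt (by simp)).hasFDerivAt.comp_hasDerivAt t h2
    have hcont : ContinuousOn (fun t : ℝ => fderiv ℝ f (z.1 + t • (z.2 - z.1))) (uIcc 0 1) := by
      intro t ht
      rw [uIcc_of_le zero_le_one] at ht
      have h3 : ContinuousAt (fderiv ℝ f) (z.1 + t • (z.2 - z.1)) :=
        ((hball _ (hmem t ht)).fderiv_right (m := 0) (by simp)).continuousAt
      exact (ContinuousAt.comp (g := fderiv ℝ f) (f := fun t : ℝ => z.1 + t • (z.2 - z.1)) h3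
        (by fun_prop)).continuousWithinAt
    have := intervalIntegral.integral_eq_sub_of_hasDerivAt hderiv
      (hcont.clm_apply continuousOn_const).intervalIntegrable
    rw [ContinuousLinearMap.intervalIntegral_apply hcont.intervalIntegrable, this]
    simp

/-- Division of a smooth function that vanishes at parameter value `0` by the parameter. -/
theorem exists_smul_of_eq_zero {V F : Type u} [NormedAddCommGroup V] [NormedSpace ℝ V]
    [NormedAddCommGroup F] [NormedSpace ℝ F] [CompleteSpace F] {f : ℝ × V → F} {a : V}
    (hf : ContDiffAt ℝ ∞ f (0, a)) (h0 : ∀ᶠ p in 𝓝 a, f (0, p) = 0) :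
    ∃ h : ℝ × V → F, ContDiffAt ℝ ∞ h (0, a) ∧ ∀ᶠ z in 𝓝 ((0 : ℝ), a), f z = z.1 • h z := by
  obtain ⟨k, hk, -, hkf⟩ := exists_hadamard hf
  have hc : ContDiffAt ℝ ∞ (fun z : ℝ × V => (((0 : ℝ), z.2), z)) (0, a) := by fun_prop
  -- Hadamard's formula between `(0, p)` and `(t, p)`, whose difference is `t • (1, 0)`.
  refine ⟨fun z => k ((0, z.2), z) (1, 0), ?_, ?_⟩
  · exact (ContDiffAt.comp (g := k) ((0 : ℝ), a) (by simpa using hk) hc).clm_apply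
      contDiffAt_const
  · have h1 := hc.continuousAt.tendsto.eventually hkf
    have h2 : ∀ᶠ z : ℝ × V in 𝓝 (0, a), f (0, z.2) = 0 :=
      (continuousAt_snd (p := ((0 : ℝ), a))).tendsto.eventually h0
    filter_upwards [h1, h2] with z hz hz2
    rw [hz, hz2, zero_add]
    have : z - (0, z.2) = z.1 • ((1 : ℝ), (0 : V)) := by ext <;> simp
    rw [this, map_smul]

end Analysis

end SymplecticLorentz

namespace SymplecticLorentz

open Filter Asymptotics

/-! ### Exponential polynomials in k, and weights realising kθ ↦ φ, k ↦ 0. -/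

section ExponentialPolynomials

/-- The sequence `k ↦ k ^ j * exp (i m θ k)`. -/
noncomputable def expPoly (θ : ℝ) (j : ℕ) (m : ℤ) : ℕ → ℂ :=
  fun k => (k : ℂ) ^ j * Complex.exp (m * θ * Complex.I) ^ k

/-- Complex exponential polynomials with frequencies and degrees at most `D`. -/
noncomputable def expPolySpan (θ : ℝ) (D : ℕ) : Submodule ℂ (ℕ → ℂ) :=
  Submodule.span ℂ {f | ∃ j ≤ D, ∃ m : ℤ, m.natAbs ≤ D ∧ f = expPoly θ j m}

variable {θ : ℝ}

theorem expPoly_mem {D j : ℕ} {m : ℤ} (hj : j ≤ D) (hm : m.natAbs ≤ D) :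
    expPoly θ j m ∈ expPolySpan θ D :=
  Submodule.subset_span ⟨j, hj, m, hm, rfl⟩

theorem expPolySpan_mono {D D' : ℕ} (h : D ≤ D') : expPolySpan θ D ≤ expPolySpan θ D' :=
  Submodule.span_mono fun _ ⟨j, hj, m, hm, hf⟩ => ⟨j, hj.trans h, m, hm.trans h, hf⟩

theorem expPoly_mul (j j' : ℕ) (m m' : ℤ) :
    expPoly θ j m * expPoly θ j' m' = expPoly θ (j + j') (m + m') := by
  ext k
  have : Complex.exp (((m + m' : ℤ) : ℂ) * θ * Complex.I) =
      Complex.exp (m * θ * Complex.I) * Complex.exp (m' * θ * Complex.I) := by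
    rw [← Complex.exp_add]; congr 1; push_cast; ring
  simp only [expPoly, Pi.mul_apply, this]
  ring

theorem expPolySpan_mul {D D' : ℕ} {f g : ℕ → ℂ} (hf : f ∈ expPolySpan θ D)
    (hg : g ∈ expPolySpan θ D') : f * g ∈ expPolySpan θ (D + D') := by
  have : expPolySpan θ D * expPolySpan θ D' ≤ expPolySpan θ (D + D') := by
    rw [expPolySpan, expPolySpan, Submodule.span_mul_span, Submodule.span_le]
    rintro _ ⟨_, ⟨j, hj, m, hm, rfl⟩, _, ⟨j', hj', m', hm', rfl⟩, rfl⟩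
    simp only [expPoly_mul]
    exact expPoly_mem (by omega) ((Int.natAbs_add_le _ _).trans (by omega))
  exact this (Submodule.mul_mem_mul hf hg)

/-- The shift of sequences. -/
noncomputable def seqShift : (ℕ → ℂ) →ₗ[ℂ] (ℕ → ℂ) where
  toFun f k := f (k + 1)
  map_add' _ _ := rfl
  map_smul' _ _ := rfl

theorem seqShift_expPoly (j : ℕ) (m : ℤ) :
    seqShift (expPoly θ j m) = Complex.exp (m * θ * Complex.I) •
      (expPoly θ j m + ∑ i ∈ Finset.range j, (j.choose i : ℂ) • expPoly θ i m) := by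
  ext k
  simp only [seqShift, LinearMap.coe_mk, AddHom.coe_mk, expPoly, Pi.smul_apply, Pi.add_apply,
    Finset.sum_apply, smul_eq_mul]
  push_cast
  rw [add_pow, Finset.sum_range_succ, pow_succ]
  simp only [one_pow, mul_one, Nat.choose_self, Nat.cast_one, add_mul, Finset.sum_mul, mul_add,
    Finset.mul_sum]
  rw [add_comm]
  congr 1
  · ring
  · exact Finset.sum_congr rfl fun i _ => by ring

/-- Every exponential polynomial is a difference of one whose degree is at most one higher. -/
theorem expPolySpan_le_map (D : ℕ) :
    expPolySpan θ D ≤ (expPolySpan θ (D + 1)).map (seqShift - LinearMap.id) := by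
  have key : ∀ j ≤ D, ∀ m : ℤ, m.natAbs ≤ D →
      expPoly θ j m ∈ (expPolySpan θ (D + 1)).map (seqShift - LinearMap.id) := by
    intro j
    induction j using Nat.strong_induction_on with
    | _ j ih =>
      intro hj m hm
      set W := (expPolySpan θ (D + 1)).map (seqShift - LinearMap.id) with hW
      set ρ := Complex.exp (m * θ * Complex.I) with hρ
      have hmem : ∀ i ≤ D + 1,
          (seqShift - LinearMap.id : (ℕ → ℂ) →ₗ[ℂ] ℕ → ℂ) (expPoly θ i m) ∈ W := fun i hi =>
        Submodule.mem_map_of_mem (expPoly_mem hi (hm.trans (Nat.le_succ D)))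
      have hsum : ∀ c : ℕ → ℂ, ∑ i ∈ Finset.range j, c i • expPoly θ i m ∈ W := fun c =>
        Submodule.sum_mem _ fun i hi => Submodule.smul_mem _ _
          (ih i (Finset.mem_range.1 hi) (by have := Finset.mem_range.1 hi; omega) m hm)
      -- If `ρ = 1` the leading terms of shift and identity cancel, and the target is reached from
      -- degree `j + 1` with coefficient `j + 1`. Otherwise degree `j` suffices, with coefficient `ρ
      -- - 1`. The remaining terms have lower degree.
      by_cases h1 : ρ = 1
      · have h2 := hmem (j + 1) (by omega)
        rw [LinearMap.sub_apply, seqShift_expPoly, ← hρ, h1, one_smul, LinearMap.id_apply,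
          add_sub_cancel_left, Finset.sum_range_succ] at h2
        have h3 := (Submodule.add_mem_iff_right _ (hsum fun i => ((j + 1).choose i : ℂ))).1 h2
        have h4 : (((j + 1).choose j : ℕ) : ℂ) ≠ 0 := by
          exact_mod_cast (Nat.choose_pos (by omega)).ne'
        exact (Submodule.smul_mem_iff _ h4).1 h3
      · have h2 := hmem j (by omega)
        rw [LinearMap.sub_apply, seqShift_expPoly, ← hρ, LinearMap.id_apply, smul_add,
          Finset.smul_sum, add_sub_right_comm] at h2
        have h5 := hsum fun i => ρ * (j.choose i : ℂ)
        simp only [mul_smul] at h5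
        have h3 := (Submodule.add_mem_iff_left _ h5).1 h2
        rw [show ρ • expPoly θ j m - expPoly θ j m = (ρ - 1) • expPoly θ j m by module] at h3
        exact (Submodule.smul_mem_iff _ (sub_ne_zero.2 h1)).1 h3
  rw [expPolySpan, Submodule.span_le]
  rintro _ ⟨j, hj, m, hm, rfl⟩
  exact key j hj m hm

/-- Non-resonance enters the construction of the weights here: distinct frequencies have distinct
multipliers, so polynomials in the shift can separate them. -/
theorem exp_injective_of_irrational (hθ : Irrational (θ / (2 * Real.pi))) :
    Function.Injective fun m : ℤ => Complex.exp (m * θ * Complex.I) := by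
  intro m m' h
  obtain ⟨n, hn⟩ := Complex.exp_eq_exp_iff_exists_int.1 h
  have hI : (m : ℂ) * θ = m' * θ + n * (2 * Real.pi) := by
    apply mul_right_cancel₀ Complex.I_ne_zero
    linear_combination hn
  have hR : (m : ℝ) * θ = m' * θ + n * (2 * Real.pi) := by exact_mod_cast hI
  by_contra hne
  have hne' : ((m - m' : ℤ) : ℝ) ≠ 0 := by exact_mod_cast sub_ne_zero.2 hne
  refine hθ ⟨(n : ℚ) / ((m - m' : ℤ) : ℚ), ?_⟩
  have hpi := Real.pi_ne_zero
  push_cast at hne' ⊢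
  field_simp
  linear_combination -hR

open Polynomial in
-- Evaluation at `0` turns a polynomial in the shift into a finite weighted sum of the first terms
-- of a sequence; this is how polynomials become weights.
theorem aeval_shift_apply_zero (B : ℂ[X]) (f : ℕ → ℂ) {K : ℕ} (hK : B.natDegree < K) :
    aeval seqShift B f 0 = ∑ k ∈ Finset.range K, B.coeff k * f k := by
  have hpow : ∀ k i, (seqShift ^ k) f i = f (i + k) := by
    intro k
    induction k with
    | zero => simp
    | succ k ih =>
      intro i
      rw [pow_succ', Module.End.mul_apply]
      change (seqShift ^ k) f (i + 1) = _
      rw [ih, add_right_comm, add_assoc]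
  rw [aeval_eq_sum_range' hK]
  simp [LinearMap.sum_apply, hpow]

open Polynomial in
-- On a fixed frequency, the shift minus the multiplier lowers the degree in `k`.
theorem aeval_shift_pow_expPoly (j : ℕ) (m : ℤ) {n : ℕ} (hn : j < n) :
    aeval seqShift ((X - C (Complex.exp (m * θ * Complex.I))) ^ n) (expPoly θ j m) = 0 := by
  set ρ := Complex.exp (m * θ * Complex.I) with hρ
  induction j using Nat.strong_induction_on generalizing n with
  | _ j ih =>
    obtain ⟨n, rfl⟩ : ∃ n', n = n' + 1 := ⟨n - 1, by omega⟩
    rw [pow_succ, map_mul, Module.End.mul_apply]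
    have h1 : aeval seqShift (X - C ρ) (expPoly θ j m) =
        ∑ i ∈ Finset.range j, (ρ * (j.choose i : ℂ)) • expPoly θ i m := by
      rw [map_sub, aeval_X, aeval_C, LinearMap.sub_apply, seqShift_expPoly, ← hρ,
        Module.algebraMap_end_apply, smul_add, add_sub_cancel_left, Finset.smul_sum]
      simp only [mul_smul]
    rw [h1, map_sum]
    refine Finset.sum_eq_zero fun i hi => ?_
    have := Finset.mem_range.1 hi
    rw [map_smul, ih i this (by omega), smul_zero]

open Polynomial in
/-- Polynomials in the shift that extract the constant coefficient at a given frequency. -/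
theorem exists_extraction (hθ : Irrational (θ / (2 * Real.pi))) (D : ℕ) (m : ℤ) :
    ∃ B : ℂ[X], ∀ j ≤ D, ∀ m' : ℤ, m'.natAbs ≤ D → ∀ K, B.natDegree < K →
      ∑ k ∈ Finset.range K, B.coeff k * expPoly θ j m' k = if m' = m ∧ j = 0 then 1 else 0 := by
  set μ : ℤ → ℂ := fun m => Complex.exp (m * θ * Complex.I) with hμ
  set s : Finset ℤ := (Finset.Icc (-(D : ℤ)) D).erase m with hs
  -- By Bézout a multiple of the second polynomial is `1` modulo the first. It kills every frequency
  -- other than `m` and is the identity at frequency `m`, where evaluation at `0` retains only `k ^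
  -- 0`.
  have hcop : IsCoprime ((X - C (μ m)) ^ (D + 1)) (∏ m' ∈ s, (X - C (μ m')) ^ (D + 1)) := by
    refine IsCoprime.prod_right fun m' hm' => IsCoprime.pow ?_
    refine isCoprime_X_sub_C_of_isUnit_sub (sub_ne_zero.2 fun h => ?_).isUnit
    exact (Finset.mem_erase.1 hm').1 (exp_injective_of_irrational hθ h).symm
  obtain ⟨u, v, huv⟩ := hcop
  refine ⟨v * ∏ m' ∈ s, (X - C (μ m')) ^ (D + 1), fun j hj m' hm' K hK => ?_⟩
  rw [← aeval_shift_apply_zero _ _ hK]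
  by_cases h : m' = m
  · subst h
    rw [eq_sub_of_add_eq' huv, map_sub, map_mul, map_one, LinearMap.sub_apply,
      Module.End.mul_apply, aeval_shift_pow_expPoly j m' (by omega), map_zero, sub_zero]
    rcases Nat.eq_zero_or_pos j with rfl | hj0
    · simp [expPoly]
    · simp [expPoly, hj0.ne']
  · rw [if_neg (by tauto), ← Finset.prod_erase_mul s _ (a := m')
      (Finset.mem_erase.2 ⟨h, Finset.mem_Icc.2 (by omega)⟩), ← mul_assoc, map_mul,
      Module.End.mul_apply, aeval_shift_pow_expPoly j m' (by omega), map_zero]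
    rfl

/-- Real exponential polynomials. -/
noncomputable def realExpPoly (θ : ℝ) (D : ℕ) : Submodule ℝ (ℕ → ℝ) where
  carrier := {w | (fun k => (w k : ℂ)) ∈ expPolySpan θ D}
  add_mem' {a b} ha hb := by
    simpa [Pi.add_def] using (expPolySpan θ D).add_mem ha hb
  zero_mem' := by
    have : (fun k : ℕ => (((0 : ℕ → ℝ) k : ℝ) : ℂ)) = 0 := by ext; simp
    rw [mem_ofPred_eq, this]
    exact (expPolySpan θ D).zero_mem
  smul_mem' c a ha := by
    simpa [Pi.smul_def] using (expPolySpan θ D).smul_mem (c : ℂ) ha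

theorem mem_realExpPoly {D : ℕ} {w : ℕ → ℝ} :
    w ∈ realExpPoly θ D ↔ (fun k => (w k : ℂ)) ∈ expPolySpan θ D := Iff.rfl

theorem realExpPoly_mono {D D' : ℕ} (h : D ≤ D') : realExpPoly θ D ≤ realExpPoly θ D' :=
  fun _ hw => expPolySpan_mono h hw

theorem realExpPoly_mul {D D' : ℕ} {f g : ℕ → ℝ} (hf : f ∈ realExpPoly θ D)
    (hg : g ∈ realExpPoly θ D') : (fun k => f k * g k) ∈ realExpPoly θ (D + D') := by
  simpa [mem_realExpPoly, Pi.mul_def] using expPolySpan_mul hf hg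

theorem pow_mem_realExpPoly {D j : ℕ} (hj : j ≤ D) :
    (fun k : ℕ => (k : ℝ) ^ j) ∈ realExpPoly θ D := by
  have := expPoly_mem (θ := θ) (m := 0) hj (by simp)
  have h2 : (fun k : ℕ => (((k : ℝ) ^ j : ℝ) : ℂ)) = expPoly θ j 0 := by
    ext k; simp [expPoly]
  rwa [mem_realExpPoly, h2]

theorem one_mem_realExpPoly (D : ℕ) : (fun _ : ℕ => (1 : ℝ)) ∈ realExpPoly θ D := by
  simpa using pow_mem_realExpPoly (θ := θ) (Nat.zero_le D)

theorem expPoly_zero_apply (m : ℤ) (k : ℕ) :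
    expPoly θ 0 m k = Complex.exp (m * θ * k * Complex.I) := by
  rw [expPoly, pow_zero, one_mul, ← Complex.exp_nat_mul]
  congr 1; ring

theorem cos_eq_expPoly : (fun k : ℕ => ((Real.cos (k * θ) : ℝ) : ℂ)) =
    (1 / 2 : ℂ) • (expPoly θ 0 1 + expPoly θ 0 (-1)) := by
  ext k
  simp only [Pi.smul_apply, Pi.add_apply, expPoly_zero_apply, smul_eq_mul]
  push_cast
  rw [Complex.cos, show -((k : ℂ) * θ) * Complex.I = -1 * θ * k * Complex.I by ring,
    show ((k : ℂ) * θ) * Complex.I = 1 * θ * k * Complex.I by ring]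
  ring

theorem sin_eq_expPoly : (fun k : ℕ => ((Real.sin (k * θ) : ℝ) : ℂ)) =
    (Complex.I / 2 : ℂ) • (expPoly θ 0 (-1) - expPoly θ 0 1) := by
  ext k
  simp only [Pi.smul_apply, Pi.sub_apply, expPoly_zero_apply, smul_eq_mul]
  push_cast
  rw [Complex.sin, show -((k : ℂ) * θ) * Complex.I = -1 * θ * k * Complex.I by ring,
    show ((k : ℂ) * θ) * Complex.I = 1 * θ * k * Complex.I by ring]
  ring

theorem cos_mem_realExpPoly : (fun k : ℕ => Real.cos (k * θ)) ∈ realExpPoly θ 1 := by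
  rw [mem_realExpPoly, cos_eq_expPoly]
  exact Submodule.smul_mem _ _ (Submodule.add_mem _ (expPoly_mem (by simp) (by simp))
    (expPoly_mem (by simp) (by simp)))

theorem sin_mem_realExpPoly : (fun k : ℕ => Real.sin (k * θ)) ∈ realExpPoly θ 1 := by
  rw [mem_realExpPoly, sin_eq_expPoly]
  exact Submodule.smul_mem _ _ (Submodule.sub_mem _ (expPoly_mem (by simp) (by simp))
    (expPoly_mem (by simp) (by simp)))

/-- A partial sum is an antidifference minus its initial value, and `expPolySpan_le_map` supplies
the antidifference. -/
theorem sum_mem_realExpPoly {D : ℕ} {w : ℕ → ℝ} (hw : w ∈ realExpPoly θ D) :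
    (fun k => ∑ i ∈ Finset.range k, w i) ∈ realExpPoly θ (D + 1) := by
  obtain ⟨s, hs, hsw⟩ := expPolySpan_le_map D (mem_realExpPoly.1 hw)
  have h1 : (fun k => ((∑ i ∈ Finset.range k, w i : ℝ) : ℂ)) = s - s 0 • expPoly θ 0 0 := by
    ext k
    simp only [Pi.sub_apply, Pi.smul_apply, expPoly_zero_apply, smul_eq_mul]
    push_cast
    simp only [zero_mul, Complex.exp_zero, mul_one]
    rw [Finset.sum_congr rfl fun i _ => (congrFun hsw i).symm]
    have : ∀ i, (seqShift - LinearMap.id : (ℕ → ℂ) →ₗ[ℂ] ℕ → ℂ) s i = s (i + 1) - s i :=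
      fun i => rfl
    simp only [this, Finset.sum_range_sub]
  rw [mem_realExpPoly, h1]
  exact Submodule.sub_mem _ hs (Submodule.smul_mem _ _ (expPoly_mem (by simp) (by simp)))

/-- Weights `a k φ`, `k < K`, that turn an exponential polynomial of degree at most `D`
into the trigonometric polynomial in `φ` obtained by `k θ ↦ φ`, `k ↦ 0`. -/
structure IsWeights (θ : ℝ) (D K : ℕ) (a a' : ℕ → ℝ → ℝ) : Prop where
  hasDerivAt : ∀ k φ, HasDerivAt (a k) (a' k φ) φ
  continuous_deriv : ∀ k, Continuous (a' k)
  periodic : ∀ k φ, a k (φ + 2 * Real.pi) = a k φ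
  periodic_deriv : ∀ k φ, a' k (φ + 2 * Real.pi) = a' k φ
  map_mul : ∀ φ D₁ D₂, D₁ + D₂ ≤ D → ∀ w₁ ∈ realExpPoly θ D₁, ∀ w₂ ∈ realExpPoly θ D₂,
    ∑ k ∈ Finset.range K, a k φ * (w₁ k * w₂ k) =
      (∑ k ∈ Finset.range K, a k φ * w₁ k) * ∑ k ∈ Finset.range K, a k φ * w₂ k
  map_one : ∀ φ, ∑ k ∈ Finset.range K, a k φ = 1
  map_pow : ∀ φ j, 0 < j → j ≤ D → ∑ k ∈ Finset.range K, a k φ * (k : ℝ) ^ j = 0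
  map_cos : ∀ φ, ∑ k ∈ Finset.range K, a k φ * Real.cos (k * θ) = Real.cos φ
  map_sin : ∀ φ, ∑ k ∈ Finset.range K, a k φ * Real.sin (k * θ) = Real.sin φ

/-- The functional sending `k ^ j * exp (i m k θ)` to `exp (i m φ)` if `j = 0`, and to `0`
otherwise, is multiplicative. Superposing the extraction polynomials with factors `exp (i m φ)`
realises it as a finite sum. It commutes with complex conjugation, so on real sequences the real
parts of the coefficients serve as weights. -/
theorem exists_weights (hθ : Irrational (θ / (2 * Real.pi))) {D : ℕ} (hD : 1 ≤ D) :
    ∃ K a a', IsWeights θ D K a a' := by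
  choose B hB using fun m => exists_extraction hθ D m
  set M : Finset ℤ := Finset.Icc (-(D : ℤ)) D with hM
  have hmemM : ∀ m : ℤ, m.natAbs ≤ D → m ∈ M := fun m hm => Finset.mem_Icc.2 (by omega)
  set K := M.sup (fun m => (B m).natDegree) + 1 with hK
  have hKm : ∀ m ∈ M, (B m).natDegree < K := fun m hm =>
    Nat.lt_succ_of_le (Finset.le_sup (f := fun m => (B m).natDegree) hm)
  set c : ℕ → ℝ → ℂ := fun k φ =>
    ∑ m ∈ M, Complex.exp (m * φ * Complex.I) * (B m).coeff k with hc
  set c' : ℕ → ℝ → ℂ := fun k φ =>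
    ∑ m ∈ M, Complex.exp (m * φ * Complex.I) * (m * Complex.I) * (B m).coeff k with hc'
  let Λ : ℝ → (ℕ → ℂ) →ₗ[ℂ] ℂ := fun φ =>
    { toFun := fun f => ∑ k ∈ Finset.range K, c k φ * f k
      map_add' := fun f g => by simp [mul_add, Finset.sum_add_distrib]
      map_smul' := fun r f => by
        simp only [Pi.smul_apply, smul_eq_mul, RingHom.id_apply, Finset.mul_sum]
        exact Finset.sum_congr rfl fun k _ => by ring }
  have hΛ : ∀ φ f, Λ φ f = ∑ k ∈ Finset.range K, c k φ * f k := fun _ _ => rfl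
  have hbasis : ∀ φ, ∀ j ≤ D, ∀ m : ℤ, m.natAbs ≤ D → Λ φ (expPoly θ j m) =
      if j = 0 then Complex.exp (m * φ * Complex.I) else 0 := by
    intro φ j hj m hm
    rw [hΛ]
    simp only [hc, Finset.sum_mul]
    rw [Finset.sum_comm]
    have : ∀ m' ∈ M, ∑ k ∈ Finset.range K,
        Complex.exp (m' * φ * Complex.I) * (B m').coeff k * expPoly θ j m k =
        if m = m' ∧ j = 0 then Complex.exp (m' * φ * Complex.I) else 0 := by
      intro m' hm'
      have := hB m' j hj m hm K (hKm m' hm')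
      simp only [mul_assoc, ← Finset.mul_sum, this]
      split_ifs <;> simp
    rw [Finset.sum_congr rfl this]
    split_ifs with h0
    · simp [h0, hmemM m hm]
    · simp [h0]
  have hmul : ∀ φ D₁ D₂, D₁ + D₂ ≤ D → ∀ f ∈ expPolySpan θ D₁, ∀ g ∈ expPolySpan θ D₂,
      Λ φ (f * g) = Λ φ f * Λ φ g := by
    intro φ D₁ D₂ hD f hf g hg
    induction hf using Submodule.span_induction with
    | zero => simp
    | add f₁ f₂ _ _ h1 h2 => rw [add_mul, map_add, map_add, h1, h2, add_mul]
    | smul r f _ h1 => rw [smul_mul_assoc, map_smul, map_smul, h1, smul_mul_assoc]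
    | mem f hf =>
      obtain ⟨j, hj, m, hm, rfl⟩ := hf
      induction hg using Submodule.span_induction with
      | zero => simp
      | add f₁ f₂ _ _ h1 h2 => rw [mul_add, map_add, map_add, h1, h2, mul_add]
      | smul r f _ h1 => rw [mul_smul_comm, map_smul, map_smul, h1, mul_smul_comm]
      | mem g hg =>
        obtain ⟨j', hj', m', hm', rfl⟩ := hg
        rw [expPoly_mul, hbasis φ _ (by omega) _ (by omega), hbasis φ j (by omega) m (by omega),
          hbasis φ j' (by omega) m' (by omega)]
        rcases Nat.eq_zero_or_pos j with rfl | h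
        · rcases Nat.eq_zero_or_pos j' with rfl | h'
          · simp only [add_zero, if_true, ← Complex.exp_add]
            congr 1; push_cast; ring
          · simp [h'.ne']
        · simp [h.ne']
  have hconj : ∀ φ, ∀ f ∈ expPolySpan θ D,
      Λ φ (fun k => starRingEnd ℂ (f k)) = starRingEnd ℂ (Λ φ f) := by
    intro φ f hf
    induction hf using Submodule.span_induction with
    | zero => simp [hΛ]
    | add f₁ f₂ _ _ h1 h2 =>
      rw [map_add, map_add, ← h1, ← h2, ← map_add]
      congr 1; ext k; simp
    | smul r f _ h1 =>
      rw [map_smul, smul_eq_mul, map_mul, ← h1, ← smul_eq_mul, ← map_smul]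
      congr 1; ext k; simp
    | mem f hf =>
      obtain ⟨j, hj, m, hm, rfl⟩ := hf
      have : (fun k => starRingEnd ℂ (expPoly θ j m k)) = expPoly θ j (-m) := by
        ext k; simp [expPoly, ← Complex.exp_conj]
      rw [this, hbasis φ j hj _ (by simpa using hm), hbasis φ j hj m hm]
      split_ifs
      · simp [← Complex.exp_conj]
      · simp
  have hreal : ∀ φ, ∀ w ∈ realExpPoly θ D,
      ((∑ k ∈ Finset.range K, (c k φ).re * w k : ℝ) : ℂ) = Λ φ (fun k => (w k : ℂ)) := by
    intro φ w hw
    have h1 := hconj φ _ (mem_realExpPoly.1 hw)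
    simp only [Complex.conj_ofReal] at h1
    rw [eq_comm, Complex.conj_eq_iff_re] at h1
    rw [← h1, hΛ]
    simp
  have hder : ∀ k φ, HasDerivAt (c k) (c' k φ) φ := by
    intro k φ
    refine HasDerivAt.fun_sum fun m _ => HasDerivAt.mul_const ?_ _
    have h1 : HasDerivAt (fun φ : ℝ => (m : ℂ) * φ * Complex.I) (m * Complex.I) φ := by
      simpa using ((Complex.ofRealCLM.hasDerivAt (x := φ)).const_mul (m : ℂ)).mul_const Complex.I
    exact h1.cexp
  have hexp : ∀ (m : ℤ) (φ : ℝ), Complex.exp (m * (φ + 2 * Real.pi : ℝ) * Complex.I) =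
      Complex.exp (m * φ * Complex.I) := by
    intro m φ
    rw [Complex.exp_eq_exp_iff_exists_int]
    exact ⟨m, by push_cast; ring⟩
  refine ⟨K, fun k φ => (c k φ).re, fun k φ => (c' k φ).re, ?_, ?_, ?_, ?_, ?_, ?_, ?_, ?_, ?_⟩
  · exact fun k φ => Complex.reCLM.hasFDerivAt.comp_hasDerivAt φ (hder k φ)
  · intro k
    simp only [hc']
    fun_prop
  · intro k φ
    simp only [hc, hexp]
  · intro k φ
    simp only [hc', hexp]
  · intro φ D₁ D₂ hD w₁ h₁ w₂ h₂
    apply Complex.ofReal_injective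
    rw [hreal φ _ (realExpPoly_mono hD (realExpPoly_mul h₁ h₂)), Complex.ofReal_mul,
      hreal φ _ (realExpPoly_mono (by omega) h₁), hreal φ _ (realExpPoly_mono (by omega) h₂),
      ← hmul φ D₁ D₂ hD _ h₁ _ h₂]
    congr 1; ext k; simp
  · intro φ
    apply Complex.ofReal_injective
    have h1 := hreal φ _ (one_mem_realExpPoly D)
    simp only [mul_one] at h1
    have h2 : (fun _ : ℕ => ((1 : ℝ) : ℂ)) = expPoly θ 0 0 := by
      ext k; simp [expPoly]
    rw [h1, h2, hbasis φ 0 (by omega) 0 (by simp)]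
    simp
  · intro φ j hj hjD
    apply Complex.ofReal_injective
    have h2 : (fun k : ℕ => (((k : ℝ) ^ j : ℝ) : ℂ)) = expPoly θ j 0 := by
      ext k; simp [expPoly]
    rw [hreal φ _ (pow_mem_realExpPoly hjD), h2, hbasis φ j hjD 0 (by simp)]
    simp [hj.ne']
  · intro φ
    apply Complex.ofReal_injective
    rw [hreal φ _ (realExpPoly_mono hD cos_mem_realExpPoly), cos_eq_expPoly, map_smul, map_add,
      hbasis φ 0 (by omega) 1 (by simpa using hD), hbasis φ 0 (by omega) (-1) (by simpa using hD)]
    simp [Complex.cos]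
    ring
  · intro φ
    apply Complex.ofReal_injective
    rw [hreal φ _ (realExpPoly_mono hD sin_mem_realExpPoly), sin_eq_expPoly, map_smul, map_sub,
      hbasis φ 0 (by omega) 1 (by simpa using hD), hbasis φ 0 (by omega) (-1) (by simpa using hD)]
    simp [Complex.sin]
    ring

end ExponentialPolynomials

end SymplecticLorentz

namespace SymplecticLorentz

open Filter Asymptotics

/-! ### Vector-valued exponential polynomials, exact and up to O(e ^ n). -/

section VectorExponentialPolynomials

universe u

variable {θ : ℝ} {F G H : Type u} [NormedAddCommGroup F] [NormedSpace ℝ F]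
  [NormedAddCommGroup G] [NormedSpace ℝ G] [NormedAddCommGroup H] [NormedSpace ℝ H]

/-- Vector-valued exponential polynomials. -/
def vecExpPoly (θ : ℝ) (D : ℕ) (F : Type u) [NormedAddCommGroup F] [NormedSpace ℝ F] :
    Submodule ℝ (ℕ → F) :=
  Submodule.span ℝ {f | ∃ w ∈ realExpPoly θ D, ∃ x : F, f = fun k => w k • x}

theorem smul_mem_vecExpPoly {D : ℕ} {w : ℕ → ℝ} (hw : w ∈ realExpPoly θ D) (x : F) :
    (fun k => w k • x) ∈ vecExpPoly θ D F :=
  Submodule.subset_span ⟨w, hw, x, rfl⟩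

theorem const_mem_vecExpPoly (D : ℕ) (x : F) : (fun _ => x) ∈ vecExpPoly θ D F := by
  simpa using smul_mem_vecExpPoly (one_mem_realExpPoly (θ := θ) D) x

theorem bilin_mem_vecExpPoly (B : F →L[ℝ] G →L[ℝ] H) {D D' : ℕ} {f : ℕ → F} {g : ℕ → G}
    (hf : f ∈ vecExpPoly θ D F) (hg : g ∈ vecExpPoly θ D' G) :
    (fun k => B (f k) (g k)) ∈ vecExpPoly θ (D + D') H := by
  induction hf using Submodule.span_induction with
  | zero => simpa using const_mem_vecExpPoly (D + D') (0 : H)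
  | add f₁ f₂ _ _ h1 h2 => simpa [Pi.add_def] using Submodule.add_mem _ h1 h2
  | smul r f _ h1 => simpa [Pi.smul_def] using Submodule.smul_mem _ r h1
  | mem f hf =>
    obtain ⟨w, hw, x, rfl⟩ := hf
    induction hg using Submodule.span_induction with
    | zero => simpa using const_mem_vecExpPoly (D + D') (0 : H)
    | add f₁ f₂ _ _ h1 h2 => simpa [Pi.add_def] using Submodule.add_mem _ h1 h2
    | smul r f _ h1 =>
      have := Submodule.smul_mem _ r h1
      simpa only [Pi.smul_def, map_smul] using this
    | mem g hg =>
      obtain ⟨w', hw', x', rfl⟩ := hg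
      have := smul_mem_vecExpPoly (realExpPoly_mul hw hw') (B x x')
      simpa [smul_smul, mul_comm] using this

theorem clm_mem_vecExpPoly (B : F →L[ℝ] G) {D : ℕ} {f : ℕ → F}
    (hf : f ∈ vecExpPoly θ D F) : (fun k => B (f k)) ∈ vecExpPoly θ D G := by
  induction hf using Submodule.span_induction with
  | zero => simpa using const_mem_vecExpPoly D (0 : G)
  | add f₁ f₂ _ _ h1 h2 => simpa [Pi.add_def] using Submodule.add_mem _ h1 h2
  | smul r f _ h1 => simpa [Pi.smul_def] using Submodule.smul_mem _ r h1
  | mem f hf =>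
    obtain ⟨w, hw, x, rfl⟩ := hf
    simpa using smul_mem_vecExpPoly hw (B x)

theorem sum_mem_vecExpPoly {D : ℕ} {f : ℕ → F} (hf : f ∈ vecExpPoly θ D F) :
    (fun k => ∑ i ∈ Finset.range k, f i) ∈ vecExpPoly θ (D + 1) F := by
  induction hf using Submodule.span_induction with
  | zero => simpa using const_mem_vecExpPoly (D + 1) (0 : F)
  | add f₁ f₂ _ _ h1 h2 => 
    simpa [Pi.add_def, Finset.sum_add_distrib] using Submodule.add_mem _ h1 h2
  | smul r f _ h1 => simpa [Pi.smul_def, Finset.smul_sum] using Submodule.smul_mem _ r h1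
  | mem f hf =>
    obtain ⟨w, hw, x, rfl⟩ := hf
    simpa [Finset.sum_smul] using smul_mem_vecExpPoly (sum_mem_realExpPoly hw) x

/-- The weighted average of a sequence. -/
def wavg (K : ℕ) (a : ℕ → ℝ → ℝ) (φ : ℝ) (y : ℕ → F) : F :=
  ∑ k ∈ Finset.range K, a k φ • y k

theorem wavg_add (K : ℕ) (a : ℕ → ℝ → ℝ) (φ : ℝ) (y z : ℕ → F) :
    wavg K a φ (fun k => y k + z k) = wavg K a φ y + wavg K a φ z := by
  simp [wavg, Finset.sum_add_distrib]

theorem wavg_sub (K : ℕ) (a : ℕ → ℝ → ℝ) (φ : ℝ) (y z : ℕ → F) :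
    wavg K a φ (fun k => y k - z k) = wavg K a φ y - wavg K a φ z := by
  simp [wavg, smul_sub]

theorem wavg_smul (K : ℕ) (a : ℕ → ℝ → ℝ) (φ : ℝ) (r : ℝ) (y : ℕ → F) :
    wavg K a φ (fun k => r • y k) = r • wavg K a φ y := by
  simp [wavg, Finset.smul_sum, smul_comm r]

theorem wavg_clm (K : ℕ) (a : ℕ → ℝ → ℝ) (φ : ℝ) (B : F →L[ℝ] G) (y : ℕ → F) :
    wavg K a φ (fun k => B (y k)) = B (wavg K a φ y) := by
  simp [wavg]

theorem wavg_smul_const (K : ℕ) (a : ℕ → ℝ → ℝ) (φ : ℝ) (w : ℕ → ℝ) (x : F) :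
    wavg K a φ (fun k => w k • x) = (∑ k ∈ Finset.range K, a k φ * w k) • x := by
  simp [wavg, Finset.sum_smul, mul_smul]

theorem IsWeights.wavg_const {D K : ℕ} {a a' : ℕ → ℝ → ℝ} (h : IsWeights θ D K a a') (φ : ℝ)
    (x : F) : wavg K a φ (fun _ => x) = x := by
  rw [wavg, ← Finset.sum_smul, h.map_one, one_smul]

/-- Multiplicativity of the scalar substitution, extended by linearity in both arguments from the
generators `w k • x`. -/
theorem IsWeights.wavg_bilin {D K : ℕ} {a a' : ℕ → ℝ → ℝ} (h : IsWeights θ D K a a')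
    (B : F →L[ℝ] G →L[ℝ] H) {D₁ D₂ : ℕ} (hD : D₁ + D₂ ≤ D) {f : ℕ → F} {g : ℕ → G}
    (hf : f ∈ vecExpPoly θ D₁ F) (hg : g ∈ vecExpPoly θ D₂ G) (φ : ℝ) :
    wavg K a φ (fun k => B (f k) (g k)) = B (wavg K a φ f) (wavg K a φ g) := by
  induction hf using Submodule.span_induction with
  | zero => simp [wavg]
  | add f₁ f₂ _ _ h1 h2 =>
    simp only [Pi.add_def, map_add, add_apply, wavg_add, h1, h2]
  | smul r f _ h1 =>
    simp only [Pi.smul_def, map_smul, smul_apply, wavg_smul, h1]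
  | mem f hf =>
    obtain ⟨w, hw, x, rfl⟩ := hf
    induction hg using Submodule.span_induction with
    | zero => simp [wavg]
    | add f₁ f₂ _ _ h1 h2 => simp only [Pi.add_def, map_add, wavg_add, h1, h2]
    | smul r f _ h1 =>
      have := congrArg (r • ·) h1
      simpa only [Pi.smul_def, map_smul, wavg_smul] using this
    | mem g hg =>
      obtain ⟨w', hw', x', rfl⟩ := hg
      simp only [map_smul, smul_apply, wavg_smul_const, smul_smul]
      rw [mul_comm, ← h.map_mul φ D₁ D₂ hD w hw w' hw']
      simp only [mul_comm]

theorem IsWeights.continuous {D K : ℕ} {a a' : ℕ → ℝ → ℝ} (h : IsWeights θ D K a a') (k : ℕ) :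
    Continuous (a k) :=
  continuous_iff_continuousAt.2 fun φ => (h.hasDerivAt k φ).continuousAt

theorem exists_bound_of_periodic {f : ℝ → ℝ} (hf : Continuous f)
    (hp : ∀ φ, f (φ + 2 * Real.pi) = f φ) : ∃ C, ∀ φ, |f φ| ≤ C := by
  obtain ⟨C, hC⟩ := (isCompact_Icc (a := (0 : ℝ)) (b := 2 * Real.pi)).exists_bound_of_continuousOn
    hf.continuousOn
  refine ⟨C, fun φ => ?_⟩
  obtain ⟨ψ, hψ, hψ'⟩ := Function.Periodic.exists_mem_Ico₀ (f := f) hp Real.two_pi_pos φ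
  rw [hψ']
  exact hC ψ (Ico_subset_Icc_self hψ)

/-- Continuity and periodicity make the bounds uniform in the phase. -/
theorem IsWeights.exists_bound {D K : ℕ} {a a' : ℕ → ℝ → ℝ} (h : IsWeights θ D K a a') :
    ∃ C, ∀ k < K, ∀ φ, |a k φ| ≤ C ∧ |a' k φ| ≤ C := by
  choose C hC using fun k => exists_bound_of_periodic (h.continuous k) (h.periodic k)
  choose C' hC' using fun k =>
    exists_bound_of_periodic (h.continuous_deriv k) (h.periodic_deriv k)
  have h0 : ∀ k, 0 ≤ C k := fun k => (abs_nonneg _).trans (hC k 0)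
  have h0' : ∀ k, 0 ≤ C' k := fun k => (abs_nonneg _).trans (hC' k 0)
  refine ⟨∑ k ∈ Finset.range K, (C k + C' k), fun k hk φ => ?_⟩
  have h1 := Finset.single_le_sum (f := fun k => C k + C' k)
    (fun i _ => add_nonneg (h0 i) (h0' i)) (Finset.mem_range.2 hk)
  have := hC k φ; have := hC' k φ; have := h0 k; have := h0' k
  exact ⟨by linarith, by linarith⟩

/-- Weighted averages with bounded weights preserve asymptotic bounds, uniformly in the phase. -/
theorem isBigO_wavg {ι : Type*} {l : Filter ι} {K : ℕ} {a : ℕ → ℝ → ℝ} {C : ℝ}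
    (hC : ∀ k < K, ∀ φ, |a k φ| ≤ C) {y : ι → ℕ → F} {e : ι → ℝ}
    (hy : ∀ k, (fun b => y b k) =O[l] e) :
    (fun z : ι × ℝ => wavg K a z.2 (y z.1)) =O[l ×ˢ ⊤] fun z => e z.1 := by
  refine IsBigO.fun_sum fun k hk => ?_
  have h1 : (fun z : ι × ℝ => a k z.2) =O[l ×ˢ ⊤] fun _ => (1 : ℝ) :=
    IsBigO.of_bound C (Eventually.of_forall fun z => by
      simpa using hC k (Finset.mem_range.1 hk) z.2)
  simpa using h1.smul ((hy k).comp_tendsto tendsto_fst)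

/-- Families of sequences that are exponential polynomials up to errors `O(e ^ n)`. -/
def IsExpPolyMod {ι : Type*} (θ : ℝ) (l : Filter ι) (e : ι → ℝ) (n D : ℕ) (y : ι → ℕ → F) :
    Prop :=
  ∃ g : ι → ℕ → F, (∀ b, g b ∈ vecExpPoly θ D F) ∧
    ∀ k, (fun b => y b k - g b k) =O[l] fun b => e b ^ n

variable {ι : Type*} {l : Filter ι} {e : ι → ℝ}

theorem isBigO_pow_of_le (he : Tendsto e l (𝓝 0)) {m n : ℕ} (h : m ≤ n) :
    (fun b => e b ^ n) =O[l] fun b => e b ^ m := by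
  obtain ⟨k, rfl⟩ := Nat.exists_eq_add_of_le h
  have h1 : (fun b => e b ^ k) =O[l] fun _ => (1 : ℝ) := (he.pow k).isBigO_one ℝ
  simpa [pow_add] using (isBigO_refl (fun b => e b ^ m) l).mul h1

theorem IsExpPolyMod.of_le (he : Tendsto e l (𝓝 0)) {m n D : ℕ} (hmn : m ≤ n) {y : ι → ℕ → F}
    (h : IsExpPolyMod θ l e n D y) : IsExpPolyMod θ l e m D y :=
  let ⟨g, hg, hy⟩ := h
  ⟨g, hg, fun k => (hy k).trans (isBigO_pow_of_le he hmn)⟩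

theorem isExpPolyMod_const (n D : ℕ) (x : ι → F) : IsExpPolyMod θ l e n D fun b _ => x b :=
  ⟨fun b _ => x b, fun b => const_mem_vecExpPoly D _, fun k => by simpa using isBigO_zero _ _⟩

theorem isExpPolyMod_of_isBigO {n : ℕ} {y : ι → ℕ → F}
    (h : ∀ k, (fun b => y b k) =O[l] fun b => e b ^ n) (D : ℕ) : IsExpPolyMod θ l e n D y :=
  ⟨fun _ _ => 0, fun _ => const_mem_vecExpPoly D _, by simpa using h⟩

theorem IsExpPolyMod.add {n D : ℕ} {y z : ι → ℕ → F} (hy : IsExpPolyMod θ l e n D y)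
    (hz : IsExpPolyMod θ l e n D z) : IsExpPolyMod θ l e n D fun b k => y b k + z b k := by
  obtain ⟨f, hf, hyf⟩ := hy
  obtain ⟨g, hg, hzg⟩ := hz
  refine ⟨fun b => f b + g b, fun b => Submodule.add_mem _ (hf b) (hg b), fun k => ?_⟩
  refine ((hyf k).add (hzg k)).congr_left fun b => ?_
  simp only [Pi.add_apply]; abel

theorem IsExpPolyMod.sub {n D : ℕ} {y z : ι → ℕ → F} (hy : IsExpPolyMod θ l e n D y)
    (hz : IsExpPolyMod θ l e n D z) : IsExpPolyMod θ l e n D fun b k => y b k - z b k := by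
  obtain ⟨f, hf, hyf⟩ := hy
  obtain ⟨g, hg, hzg⟩ := hz
  refine ⟨fun b => f b - g b, fun b => Submodule.sub_mem _ (hf b) (hg b), fun k => ?_⟩
  refine ((hyf k).sub (hzg k)).congr_left fun b => ?_
  simp only [Pi.sub_apply]; abel

theorem IsExpPolyMod.clm {n D : ℕ} (B : F →L[ℝ] G) {y : ι → ℕ → F}
    (hy : IsExpPolyMod θ l e n D y) : IsExpPolyMod θ l e n D fun b k => B (y b k) := by
  obtain ⟨f, hf, hyf⟩ := hy
  refine ⟨fun b k => B (f b k), fun b => clm_mem_vecExpPoly B (hf b), fun k => ?_⟩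
  simp only [← map_sub]
  exact (B.isBigO_comp _ _).trans (hyf k)

theorem IsExpPolyMod.sum {n D : ℕ} {y : ι → ℕ → F} (hy : IsExpPolyMod θ l e n D y) :
    IsExpPolyMod θ l e n (D + 1) fun b k => ∑ i ∈ Finset.range k, y b i := by
  obtain ⟨f, hf, hyf⟩ := hy
  refine ⟨fun b k => ∑ i ∈ Finset.range k, f b i, fun b => sum_mem_vecExpPoly (hf b), fun k => ?_⟩
  simp only [← Finset.sum_sub_distrib]
  exact IsBigO.fun_sum fun i _ => hyf i

theorem isBigO_bilin {F G H : Type*} [NormedAddCommGroup F] [NormedSpace ℝ F]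
    [NormedAddCommGroup G] [NormedSpace ℝ G] [NormedAddCommGroup H] [NormedSpace ℝ H]
    (B : F →L[ℝ] G →L[ℝ] H) {κ : Type*} {l : Filter κ} {f : κ → F} {g : κ → G}
    {a b : κ → ℝ} (hf : f =O[l] a) (hg : g =O[l] b) :
    (fun z => B (f z) (g z)) =O[l] fun z => a z * b z :=
  IsBigO.trans (g := fun z => ‖f z‖ * ‖g z‖) (IsBigO.of_bound ‖B‖ (Eventually.of_forall fun z => by
    simpa [mul_assoc] using B.le_opNorm₂ (f z) (g z))) (hf.norm_left.mul hg.norm_left)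

theorem isBigO_clm_apply {F G : Type*} [NormedAddCommGroup F] [NormedSpace ℝ F]
    [NormedAddCommGroup G] [NormedSpace ℝ G] {κ : Type*} {l : Filter κ} {f : κ → F →L[ℝ] G}
    {g : κ → F} {a b : κ → ℝ} (hf : f =O[l] a) (hg : g =O[l] b) :
    (fun z => f z (g z)) =O[l] fun z => a z * b z :=
  IsBigO.trans (g := fun z => ‖f z‖ * ‖g z‖) (IsBigO.of_bound 1 (Eventually.of_forall fun z => by
    simpa using (f z).le_opNorm (g z))) (hf.norm_left.mul hg.norm_left)

/-- Product of two approximate exponential polynomials of sizes `O(e ^ p)` and `O(e ^ q)`. -/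
theorem IsExpPolyMod.bilin (he : Tendsto e l (𝓝 0)) (B : F →L[ℝ] G →L[ℝ] H)
    {m n p q r D D' : ℕ} {y : ι → ℕ → F} {z : ι → ℕ → G} (hy : IsExpPolyMod θ l e m D y)
    (hz : IsExpPolyMod θ l e n D' z) (hyO : ∀ k, (fun b => y b k) =O[l] fun b => e b ^ p)
    (hzO : ∀ k, (fun b => z b k) =O[l] fun b => e b ^ q) (hq : q ≤ n) (h1 : r ≤ p + n)
    (h2 : r ≤ m + q) :
    IsExpPolyMod θ l e r (D + D') fun b k => B (y b k) (z b k) := by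
  obtain ⟨f, hf, hyf⟩ := hy
  obtain ⟨g, hg, hzg⟩ := hz
  refine ⟨fun b k => B (f b k) (g b k), fun b => bilin_mem_vecExpPoly B (hf b) (hg b),
    fun k => ?_⟩
  have hgO : (fun b => g b k) =O[l] fun b => e b ^ q := by
    simpa using (hzO k).sub ((hzg k).trans (isBigO_pow_of_le he hq))
  -- `B y z - B f g = B y (z - g) + B (y - f) g`: each error is multiplied by the size of the other
  -- factor, which gains an order `e ^ p` or `e ^ q`.
  have h3 := isBigO_bilin B (hyO k) (hzg k)
  have h4 := isBigO_bilin B (hyf k) hgO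
  simp only [← pow_add] at h3 h4
  refine ((h3.trans (isBigO_pow_of_le he h1)).add (h4.trans (isBigO_pow_of_le he h2))).congr_left
    fun b => ?_
  simp only [map_sub, sub_apply]
  abel

/-- Weighted averages are multiplicative on approximate exponential polynomials. -/
theorem IsWeights.isBigO_wavg_bilin (he : Tendsto e l (𝓝 0)) (B : F →L[ℝ] G →L[ℝ] H)
    {D₀ K : ℕ} {a a' : ℕ → ℝ → ℝ} (ha : IsWeights θ D₀ K a a')
    {m n p q r D D' : ℕ} (hD : D + D' ≤ D₀) {y : ι → ℕ → F} {z : ι → ℕ → G}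
    (hy : IsExpPolyMod θ l e m D y)
    (hz : IsExpPolyMod θ l e n D' z) (hyO : ∀ k, (fun b => y b k) =O[l] fun b => e b ^ p)
    (hzO : ∀ k, (fun b => z b k) =O[l] fun b => e b ^ q) (hq : q ≤ n) (h1 : r ≤ p + n)
    (h2 : r ≤ m + q) :
    (fun x : ι × ℝ => wavg K a x.2 (fun k => B (y x.1 k) (z x.1 k)) -
      B (wavg K a x.2 (y x.1)) (wavg K a x.2 (z x.1))) =O[l ×ˢ ⊤] fun x => e x.1 ^ r := by
  obtain ⟨f, hf, hyf⟩ := hy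
  obtain ⟨g, hg, hzg⟩ := hz
  obtain ⟨C, hC⟩ := ha.exists_bound
  have hC' : ∀ k < K, ∀ φ, |a k φ| ≤ C := fun k hk φ => (hC k hk φ).1
  have hgO : ∀ k, (fun b => g b k) =O[l] fun b => e b ^ q := fun k => by
    simpa using (hzO k).sub ((hzg k).trans (isBigO_pow_of_le he hq))
  -- The splitting of `IsExpPolyMod.bilin`, needed for every single term and once more for the
  -- averages.
  have key : ∀ {κ : Type _} {l' : Filter κ} {e' : κ → ℝ} (he' : Tendsto e' l' (𝓝 0))
      {y f : κ → F} {z g : κ → G}, y =O[l'] (fun x => e' x ^ p) → g =O[l'] (fun x => e' x ^ q) →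
      (fun x => y x - f x) =O[l'] (fun x => e' x ^ m) →
      (fun x => z x - g x) =O[l'] (fun x => e' x ^ n) →
      (fun x => B (y x) (z x) - B (f x) (g x)) =O[l'] fun x => e' x ^ r := by
    intro κ l' e' he' y f z g hy hg hyf hzg
    have h3 := isBigO_bilin B hy hzg
    have h4 := isBigO_bilin B hyf hg
    simp only [← pow_add] at h3 h4
    refine ((h3.trans (isBigO_pow_of_le he' h1)).add
      (h4.trans (isBigO_pow_of_le he' h2))).congr_left fun b => ?_
    simp only [map_sub, sub_apply]
    abel
  have he' : Tendsto (fun x : ι × ℝ => e x.1) (l ×ˢ ⊤) (𝓝 0) := he.comp tendsto_fst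
  have h3 := isBigO_wavg hC' (y := fun b k => B (y b k) (z b k) - B (f b k) (g b k))
    fun k => key he (hyO k) (hgO k) (hyf k) (hzg k)
  have h4 := key he' (isBigO_wavg hC' hyO) (isBigO_wavg hC' hgO)
    (f := fun x => wavg K a x.2 (f x.1)) (z := fun x => wavg K a x.2 (z x.1))
    ((isBigO_wavg hC' hyf).congr_left fun x => wavg_sub _ _ _ _ _)
    ((isBigO_wavg hC' hzg).congr_left fun x => wavg_sub _ _ _ _ _)
  refine (h3.sub h4).congr_left fun x => ?_
  rw [wavg_sub, ha.wavg_bilin B hD (hf x.1) (hg x.1)]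
  abel

end VectorExponentialPolynomials

end SymplecticLorentz

namespace SymplecticLorentz

open Filter Asymptotics

/-! ### Orbits near fixed points as exponential polynomials to all orders. -/

section ApproximateOrbits

universe u

variable {θ : ℝ} {V W G : Type u} [NormedAddCommGroup V] [NormedSpace ℝ V]
  [NormedAddCommGroup W] [NormedSpace ℝ W]
  {ι : Type*} {l : Filter ι} {e : ι → ℝ}

theorem IsExpPolyMod.congr {n D : ℕ} {y z : ι → ℕ → V} (hy : IsExpPolyMod θ l e n D y)
    (h : ∀ k, ∀ᶠ b in l, y b k = z b k) : IsExpPolyMod θ l e n D z := by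
  obtain ⟨g, hg, hyg⟩ := hy
  exact ⟨g, hg, fun k => (hyg k).congr' ((h k).mono fun b hb => by simp [hb]) EventuallyEq.rfl⟩

theorem isExpPolyMod_of_mem {n D : ℕ} {y : ι → ℕ → V} (hy : ∀ b, y b ∈ vecExpPoly θ D V) :
    IsExpPolyMod θ l e n D y :=
  ⟨y, hy, fun k => by simpa using isBigO_zero _ _⟩

theorem isBigO_one_of_tendsto {F : Type*} [NormedAddCommGroup F] {κ : Type*} {l : Filter κ}
    {e : κ → ℝ} {f : κ → F} {c : F}
    (h : Tendsto f l (𝓝 c)) : f =O[l] fun b => e b ^ 0 := by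
  simpa using h.isBigO_one ℝ

theorem tendsto_of_sub_isBigO {F : Type*} [NormedAddCommGroup F] {κ : Type*} {l : Filter κ}
    {e : κ → ℝ} {f g : κ → F} {c : F} (he : Tendsto e l (𝓝 0)) (hg : Tendsto g l (𝓝 c))
    (h : (fun b => f b - g b) =O[l] fun b => e b ^ 1) : Tendsto f l (𝓝 c) := by
  have h1 : Tendsto (fun b => f b - g b) l (𝓝 0) :=
    h.trans_tendsto (by simpa using he)
  simpa using h1.add hg

/-- Hadamard's lemma in the second variable, expanded at the diagonal. The coefficient `h` is again
a function of the pair, so the induction in `IsExpPolyMod.comp_smooth` applies to it. -/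
theorem exists_hadamard_snd {V G : Type u} [NormedAddCommGroup V] [NormedSpace ℝ V]
    [NormedAddCommGroup G] [NormedSpace ℝ G] [CompleteSpace G] {f : V × V → G} {c : V}
    (hf : ContDiffAt ℝ ∞ f (c, c)) :
    ∃ h : V × V → V →L[ℝ] G, ContDiffAt ℝ ∞ h (c, c) ∧
      ∀ᶠ z in 𝓝 (c, c), f z = f (z.1, z.1) + h z (z.2 - z.1) := by
  obtain ⟨k, hk, -, hkf⟩ := exists_hadamard hf
  have hc : ContDiffAt ℝ ∞ (fun z : V × V => ((z.1, z.1), z)) (c, c) := by fun_prop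
  refine ⟨fun z => (k ((z.1, z.1), z)).comp (ContinuousLinearMap.inr ℝ V V), ?_, ?_⟩
  · exact (ContDiffAt.comp (g := k) (f := fun z : V × V => ((z.1, z.1), z)) (c, c) hk hc).clm_comp contDiffAt_const
  · filter_upwards [hc.continuousAt.tendsto.eventually hkf] with z hz
    rw [hz]
    congr 1
    rw [ContinuousLinearMap.comp_apply]
    congr 1
    ext <;> simp

/-- Smooth functions of approximate exponential polynomials are approximate exponential
polynomials, and weighted averages commute with them up to a small error. -/
theorem IsExpPolyMod.comp_smooth [NormedAddCommGroup G] [NormedSpace ℝ G] [CompleteSpace G]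
    (he : Tendsto e l (𝓝 0)) {c : V} {base : ι → V}
    (hbase : Tendsto base l (𝓝 c)) {Y : ι → ℕ → V}
    (hYO : ∀ k, (fun b => Y b k - base b) =O[l] fun b => e b ^ 1) {D : ℕ} (n : ℕ)
    (hY : IsExpPolyMod θ l e n D Y) {f : V × V → G} (hf : ContDiffAt ℝ ∞ f (c, c)) :
    IsExpPolyMod θ l e n (n * D) (fun b k => f (base b, Y b k)) ∧
      ∀ D₀ K a a', n * D ≤ D₀ → IsWeights θ D₀ K a a' →
        (fun x : ι × ℝ => wavg K a x.2 (fun k => f (base x.1, Y x.1 k)) -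
          f (base x.1, wavg K a x.2 (Y x.1))) =O[l ×ˢ ⊤] fun x => e x.1 ^ n := by
  have hYt : ∀ k, Tendsto (fun b => Y b k) l (𝓝 c) := fun k =>
    tendsto_of_sub_isBigO he hbase (hYO k)
  have htt : ∀ k, Tendsto (fun b => (base b, Y b k)) l (𝓝 (c, c)) := fun k =>
    hbase.prodMk_nhds (hYt k)
  have he' : Tendsto (fun x : ι × ℝ => e x.1) (l ×ˢ ⊤) (𝓝 0) := he.comp tendsto_fst
  have havg : ∀ {D₀ K a a'}, IsWeights θ D₀ K a a' →
      (fun x : ι × ℝ => wavg K a x.2 (Y x.1) - base x.1) =O[l ×ˢ ⊤] fun x => e x.1 ^ 1 := by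
    intro D₀ K a a' ha
    obtain ⟨C, hC⟩ := ha.exists_bound
    refine (isBigO_wavg (fun k hk φ => (hC k hk φ).1) hYO).congr_left fun x => ?_
    rw [wavg_sub, ha.wavg_const]
  have havgt : ∀ {D₀ K a a'}, IsWeights θ D₀ K a a' →
      Tendsto (fun x : ι × ℝ => (base x.1, wavg K a x.2 (Y x.1))) (l ×ˢ ⊤) (𝓝 (c, c)) :=
    fun ha => (hbase.comp tendsto_fst).prodMk_nhds
      (tendsto_of_sub_isBigO he' (hbase.comp tendsto_fst) (havg ha))
  -- Each step uses `f (b, Y) = f (b, b) + h (b, Y) (Y - b)`. Since `Y - b` is `O(e)`, knowing `h`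
  -- to order `n` and `Y` to order `n + 1` determines `f` to order `n + 1`; the same gain holds for
  -- the averages.
  induction n generalizing G with
  | zero =>
    have h0 : ∀ k, (fun b => f (base b, Y b k)) =O[l] fun b => e b ^ 0 := fun k =>
      isBigO_one_of_tendsto (hf.continuousAt.tendsto.comp (htt k))
    refine ⟨isExpPolyMod_of_isBigO h0 _, fun D₀ K a a' _ ha => ?_⟩
    obtain ⟨C, hC⟩ := ha.exists_bound
    exact (isBigO_wavg (fun k hk φ => (hC k hk φ).1) h0).sub
      (isBigO_one_of_tendsto (hf.continuousAt.tendsto.comp (havgt ha)))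
  | succ n ih =>
    obtain ⟨h, hh, hfh⟩ := exists_hadamard_snd hf
    obtain ⟨hD', hcomm⟩ := ih (hY.of_le he (Nat.le_succ n)) hh
    have hh0 : ∀ k, (fun b => h (base b, Y b k)) =O[l] fun b => e b ^ 0 := fun k =>
      isBigO_one_of_tendsto (hh.continuousAt.tendsto.comp (htt k))
    have hYb : IsExpPolyMod θ l e (n + 1) D fun b k => Y b k - base b :=
      hY.sub (isExpPolyMod_const _ _ _)
    have hEq : ∀ k, ∀ᶠ b in l,
        f (base b, base b) + h (base b, Y b k) (Y b k - base b) = f (base b, Y b k) := fun k =>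
      ((htt k).eventually hfh).mono fun b hb => hb.symm
    rw [Nat.succ_mul]
    refine ⟨?_, fun D₀ K a a' hD₀ ha => ?_⟩
    · refine ((isExpPolyMod_const (n + 1) (n * D + D) fun b => f (base b, base b)).add
        (IsExpPolyMod.bilin he (ContinuousLinearMap.id ℝ (V →L[ℝ] G)) (r := n + 1)
          hD' hYb hh0 hYO (by omega) (by omega) (by omega))).congr hEq
    · obtain ⟨C, hC⟩ := ha.exists_bound
      have hC' : ∀ k < K, ∀ φ, |a k φ| ≤ C := fun k hk φ => (hC k hk φ).1
      have h1 := ha.isBigO_wavg_bilin he (ContinuousLinearMap.id ℝ (V →L[ℝ] G)) (r := n + 1)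
        hD₀ hD' hYb hh0 hYO (by omega) (by omega) (by omega)
      have h2 := isBigO_bilin (ContinuousLinearMap.id ℝ (V →L[ℝ] G))
        (hcomm D₀ K a a' (by omega) ha) (havg ha)
      simp only [← pow_add] at h2
      refine (h1.add h2).congr' ?_ EventuallyEq.rfl
      have h3 : ∀ᶠ b in l, ∀ k ∈ Finset.range K,
          f (base b, base b) + h (base b, Y b k) (Y b k - base b) = f (base b, Y b k) :=
        (Finset.eventually_all _).2 fun k _ => hEq k
      filter_upwards [(havgt ha).eventually hfh, tendsto_fst.eventually h3] with x hx1 hx2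
      have h4 : wavg K a x.2 (fun k => f (base x.1, Y x.1 k)) = f (base x.1, base x.1) +
          wavg K a x.2 (fun k => h (base x.1, Y x.1 k) (Y x.1 k - base x.1)) := by
        rw [← ha.wavg_const x.2 (f (base x.1, base x.1)), ← wavg_add]
        exact Finset.sum_congr rfl fun k hk => by simp only [hx2 k hk]
      rw [hx1, h4, wavg_sub, ha.wavg_const]
      simp only [ContinuousLinearMap.id_apply, sub_apply]
      abel

/-- The data describing the linearisation of a family of maps along fixed points: `P b k` is the
`k`-th iterate of the linear map `L b`, and `M b k` the inverse of the `(k + 1)`-st iterate. -/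
structure IsRotationFamily (θ : ℝ) (l : Filter ι) (L : ι → W →L[ℝ] W)
    (P M : ι → ℕ → W →L[ℝ] W) : Prop where
  mem : ∀ b, P b ∈ vecExpPoly θ 1 (W →L[ℝ] W)
  mem_inv : ∀ b, M b ∈ vecExpPoly θ 1 (W →L[ℝ] W)
  bound : ∀ k, (fun b => P b k) =O[l] fun _ => (1 : ℝ)
  bound_inv : ∀ k, (fun b => M b k) =O[l] fun _ => (1 : ℝ)
  zero : ∀ᶠ b in l, P b 0 = ContinuousLinearMap.id ℝ W
  succ : ∀ᶠ b in l, ∀ k x, P b (k + 1) x = L b (P b k x)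
  inv : ∀ᶠ b in l, ∀ k x, P b (k + 1) (M b k x) = x

/-- Variation of constants, `M b i` being the inverse of the power `i + 1` of `L b`. The partial sum
is the reason why exponential polynomials have to be closed under summation. -/
theorem IsRotationFamily.solve {L : ι → W →L[ℝ] W} {P M : ι → ℕ → W →L[ℝ] W}
    (h : IsRotationFamily θ l L P M) {z N : ι → ℕ → W}
    (hz : ∀ k, ∀ᶠ b in l, z b (k + 1) = L b (z b k) + N b k) (k : ℕ) :
    ∀ᶠ b in l, P b k (z b 0 + ∑ i ∈ Finset.range k, M b i (N b i)) = z b k := by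
  induction k with
  | zero => filter_upwards [h.zero] with b hb; simp [hb]
  | succ k ih =>
    filter_upwards [ih, hz k, h.succ, h.inv] with b h1 h2 h3 h4
    rw [Finset.sum_range_succ, ← add_assoc, map_add, h4, h3, h1, h2]

/-- A bound on the degree of the exponential polynomials that approximate an orbit. -/
def orbitDegree : ℕ → ℕ
  | 0 => 0
  | n + 1 => 1 + (1 + ((n + 1) * orbitDegree n + orbitDegree n) + 1)

/-- Orbits near a manifold of fixed points are exponential polynomials to all orders. -/
theorem isExpPolyMod_orbit [CompleteSpace W] (he : Tendsto e l (𝓝 0)) {c : W}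
    {w : ι → W} (hw : Tendsto w l (𝓝 c)) {ħ : ι → ℝ} (hħ : ħ =O[l] fun b => e b ^ 1)
    {f : ℝ × W → W} (hf : ContDiffAt ℝ ∞ f (0, c)) (hfix : ∀ᶠ b in l, f (0, w b) = w b)
    {P M : ι → ℕ → W →L[ℝ] W}
    (hrot : IsRotationFamily θ l
      (fun b => (fderiv ℝ f (0, w b)).comp (ContinuousLinearMap.inr ℝ ℝ W)) P M)
    {y : ι → ℕ → W} (hyO : ∀ k, (fun b => y b k - w b) =O[l] fun b => e b ^ 1)
    (hy : ∀ k, ∀ᶠ b in l, y b (k + 1) = f (ħ b, y b k)) (n : ℕ) :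
    IsExpPolyMod θ l e n (orbitDegree n) y := by
  -- The induction proves one order more with the same degree bound: at `n = 0` the constant
  -- sequence `w b` is already correct to order one.
  suffices h : ∀ n, IsExpPolyMod θ l e (n + 1) (orbitDegree n) y from
    (h n).of_le he (Nat.le_succ n)
  clear n
  obtain ⟨h, hh, hhd, hfh⟩ := exists_hadamard hf
  have hbase : Tendsto (fun b => ((0 : ℝ), w b)) l (𝓝 (0, c)) := tendsto_const_nhds.prodMk_nhds hw
  have hYO : ∀ k, (fun b => (ħ b, y b k) - ((0 : ℝ), w b)) =O[l] fun b => e b ^ 1 := fun k => by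
    simp only [Prod.mk_sub_mk, sub_zero]
    exact hħ.prod_left (hyO k)
  have hYt : ∀ k, Tendsto (fun b => (ħ b, y b k)) l (𝓝 (0, c)) := fun k =>
    tendsto_of_sub_isBigO he hbase (hYO k)
  have hhO : ∀ k, (fun b => h ((0, w b), (ħ b, y b k)) - h ((0, w b), (0, w b)))
      =O[l] fun b => e b ^ 1 := by
    intro k
    have h1 := (hh.hasStrictFDerivAt (by simp)).isBigO_sub
    have h2 : Tendsto (fun b => ((((0 : ℝ), w b), (ħ b, y b k)), (((0 : ℝ), w b), ((0 : ℝ), w b))))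
        l (𝓝 (((0, c), (0, c)), ((0, c), (0, c)))) :=
      (hbase.prodMk_nhds (hYt k)).prodMk_nhds (hbase.prodMk_nhds hbase)
    refine (h1.comp_tendsto h2).trans (IsBigO.trans (IsBigO.of_bound 1 ?_) (hYO k))
    refine Eventually.of_forall fun b => ?_
    simp [Prod.norm_def]
  intro n
  induction n with
  | zero =>
    refine ⟨fun b _ => w b, fun b => const_mem_vecExpPoly 0 _, fun k => ?_⟩
    simpa using hyO k
  | succ n ih =>
    have hD := ih
    set D := orbitDegree n with hDn
    set D' := (n + 1) * D with hDn'
    have hY : IsExpPolyMod θ l e (n + 1) D fun b k => (ħ b, y b k) := by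
      have h1 := (hD.clm (ContinuousLinearMap.inr ℝ ℝ W)).add
        (isExpPolyMod_const (n + 1) D fun b => (ħ b, (0 : W)))
      refine h1.congr fun k => Eventually.of_forall fun b => ?_
      simp
    have hD' : IsExpPolyMod θ l e (n + 1) D' fun b k => h ((0, w b), (ħ b, y b k)) :=
      (hY.comp_smooth he hbase hYO (n + 1) hh).1
    -- The nonlinear remainder is a product of two `O(e)` factors, each known to order `n + 1`,
    -- hence it is known to order `n + 2`.
    have hN2 := IsExpPolyMod.bilin he (ContinuousLinearMap.id ℝ (ℝ × W →L[ℝ] W)) (r := n + 2)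
      (hD'.sub (isExpPolyMod_const (n + 1) D' fun b => h ((0, w b), (0, w b))))
      (hY.sub (isExpPolyMod_const (n + 1) D fun b => ((0 : ℝ), w b))) hhO hYO
      (by omega) (by omega) (by omega)
    have hN := (isExpPolyMod_const (θ := θ) (l := l) (e := e) (n + 2) (D' + D) fun b =>
      ħ b • fderiv ℝ f (0, w b) (1, 0)).add hN2
    set N : ι → ℕ → W := fun b k => ħ b • fderiv ℝ f (0, w b) (1, 0) +
      (ContinuousLinearMap.id ℝ (ℝ × W →L[ℝ] W))
        (h ((0, w b), (ħ b, y b k)) - h ((0, w b), (0, w b))) ((ħ b, y b k) - (0, w b)) with hNdef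
    -- Hadamard's formula at the fixed point: the linear part in the space direction is split off,
    -- while the parameter term and the quadratic remainder are collected in `N`.
    have hrec : ∀ k, ∀ᶠ b in l, y b (k + 1) - w b =
        (fderiv ℝ f (0, w b)).comp (ContinuousLinearMap.inr ℝ ℝ W) (y b k - w b) + N b k := by
      intro k
      filter_upwards [hy k, hfix, (hbase.prodMk_nhds (hYt k)).eventually hfh] with b h1 h2 h3
      simp only [h2] at h3
      rw [h1, h3, hNdef]
      simp only [hhd, ContinuousLinearMap.id_apply, sub_apply]
      have h4 : (ħ b, y b k) - ((0 : ℝ), w b) = ħ b • ((1 : ℝ), (0 : W)) +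
          ContinuousLinearMap.inr ℝ ℝ W (y b k - w b) := by ext <;> simp
      have h5 : fderiv ℝ f (0, w b) ((ħ b, y b k) - (0, w b)) = ħ b • fderiv ℝ f (0, w b) (1, 0) +
          fderiv ℝ f (0, w b) (ContinuousLinearMap.inr ℝ ℝ W (y b k - w b)) := by
        rw [h4, map_add, map_smul]
      rw [h5, ContinuousLinearMap.comp_apply]
      abel
    have hNO : ∀ k, (fun b => N b k) =O[l] fun b => e b ^ 0 := by
      intro k
      have h1 : (fun b => ħ b • fderiv ℝ f (0, w b) (1, 0)) =O[l] fun b => e b ^ 0 := by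
        have h2 : Tendsto (fun b => fderiv ℝ f (0, w b)) l (𝓝 (fderiv ℝ f (0, c))) :=
          (hf.fderiv_right (m := 0) (by simp)).continuousAt.tendsto.comp hbase
        have h3 : Tendsto ħ l (𝓝 0) := hħ.trans_tendsto (by simpa using he)
        exact isBigO_one_of_tendsto (h3.smul
          (((ContinuousLinearMap.apply ℝ W ((1 : ℝ), (0 : W))).continuous.tendsto _).comp h2))
      have h2 := isBigO_bilin (ContinuousLinearMap.id ℝ (ℝ × W →L[ℝ] W)) (hhO k) (hYO k)
      simp only [← pow_add] at h2
      exact h1.add (h2.trans (isBigO_pow_of_le he (by omega)))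
    have hMO : ∀ k, (fun b => M b k) =O[l] fun b => e b ^ 0 := fun k => by
      simpa using hrot.bound_inv k
    have hPO : ∀ k, (fun b => P b k) =O[l] fun b => e b ^ 0 := fun k => by
      simpa using hrot.bound k
    -- Degrees: `M` contributes one, the partial sum one, and the later multiplication by `P` one
    -- more, in agreement with `orbitDegree`.
    have hMN := (IsExpPolyMod.bilin he (ContinuousLinearMap.id ℝ (W →L[ℝ] W)) (r := n + 2)
      (isExpPolyMod_of_mem (n := n + 2) hrot.mem_inv) hN hMO hNO (by omega) (by omega)
      (by omega)).sum
    have hMNO : ∀ k, (fun b => ∑ i ∈ Finset.range k, M b i (N b i)) =O[l] fun b => e b ^ 0 :=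
      fun k => IsBigO.fun_sum fun i _ => by
        simpa using isBigO_bilin (ContinuousLinearMap.id ℝ (W →L[ℝ] W)) (hMO i) (hNO i)
    have hS := (isExpPolyMod_const (n + 2) _ fun b => y b 0 - w b).add hMN
    have hSO : ∀ k, (fun b => y b 0 - w b + ∑ i ∈ Finset.range k, M b i (N b i))
        =O[l] fun b => e b ^ 0 := fun k =>
      ((hyO 0).trans (isBigO_pow_of_le he (by omega))).add (hMNO k)
    have hfin := IsExpPolyMod.bilin he (ContinuousLinearMap.id ℝ (W →L[ℝ] W)) (r := n + 2)
      (isExpPolyMod_of_mem (n := n + 2) hrot.mem) hS hPO hSO (by omega) (by omega) (by omega)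
    refine (hfin.add (isExpPolyMod_const (n + 2) _ w)).congr fun k => ?_
    filter_upwards [hrot.solve (z := fun b k => y b k - w b) (N := N) hrec k] with b hb
    simp only [ContinuousLinearMap.id_apply] at hb ⊢
    rw [hb, sub_add_cancel]

end ApproximateOrbits

end SymplecticLorentz

namespace SymplecticLorentz

open Filter Asymptotics

/-! ### Rotations as exponential polynomials, and their averages. -/

section Rotations

universe u

variable {E : Type u} [NormedAddCommGroup E] [NormedSpace ℝ E]

/-- The rotation `cos t - sin t J = exp (-t J)` of a complex structure `J`. -/
noncomputable def rot (t : ℝ) (J : E →L[ℝ] E) : E →L[ℝ] E :=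
  Real.cos t • ContinuousLinearMap.id ℝ E - Real.sin t • J

theorem rot_apply (t : ℝ) (J : E →L[ℝ] E) (x : E) :
    rot t J x = Real.cos t • x - Real.sin t • J x := by
  simp [rot]

theorem rot_zero (J : E →L[ℝ] E) (x : E) : rot 0 J x = x := by simp [rot_apply]

theorem rot_rot {J : E →L[ℝ] E} (hJ : ∀ v, J (J v) = -v) (s t : ℝ) (x : E) :
    rot s J (rot t J x) = rot (s + t) J x := by
  simp only [rot_apply, map_sub, map_smul, hJ, Real.cos_add, Real.sin_add]
  module

/-- The rotation acting on the second component only. -/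
noncomputable def rotSnd (t : ℝ) (J : E →L[ℝ] E) : E × E →L[ℝ] E × E :=
  (ContinuousLinearMap.fst ℝ E E).prod ((rot t J).comp (ContinuousLinearMap.snd ℝ E E))

theorem rotSnd_apply (t : ℝ) (J : E →L[ℝ] E) (x : E × E) :
    rotSnd t J x = (x.1, rot t J x.2) := rfl

theorem rotSnd_eq (t : ℝ) (J : E →L[ℝ] E) : rotSnd t J =
    (ContinuousLinearMap.inl ℝ E E).comp (ContinuousLinearMap.fst ℝ E E) +
    (Real.cos t • (ContinuousLinearMap.inr ℝ E E).comp (ContinuousLinearMap.snd ℝ E E) +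
    Real.sin t • -(ContinuousLinearMap.inr ℝ E E).comp
      (J.comp (ContinuousLinearMap.snd ℝ E E))) := by
  ext x <;> simp [rotSnd_apply, rot_apply, sub_eq_add_neg]

variable {θ : ℝ}

theorem cos_add_mem_realExpPoly (c : ℝ) :
    (fun k : ℕ => Real.cos (k * θ + c)) ∈ realExpPoly θ 1 := by
  have := Submodule.sub_mem _ (Submodule.smul_mem _ (Real.cos c) (cos_mem_realExpPoly (θ := θ)))
    (Submodule.smul_mem _ (Real.sin c) (sin_mem_realExpPoly (θ := θ)))
  convert this using 1
  ext k
  simp [Real.cos_add, mul_comm]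

theorem sin_add_mem_realExpPoly (c : ℝ) :
    (fun k : ℕ => Real.sin (k * θ + c)) ∈ realExpPoly θ 1 := by
  have := Submodule.add_mem _ (Submodule.smul_mem _ (Real.sin c) (cos_mem_realExpPoly (θ := θ)))
    (Submodule.smul_mem _ (Real.cos c) (sin_mem_realExpPoly (θ := θ)))
  convert this using 1
  ext k
  simp [Real.sin_add, mul_comm, add_comm]

theorem rotSnd_mem_vecExpPoly (c : ℝ) (J : E →L[ℝ] E) :
    (fun k : ℕ => rotSnd (k * θ + c) J) ∈ vecExpPoly θ 1 (E × E →L[ℝ] E × E) := by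
  simp only [rotSnd_eq]
  exact Submodule.add_mem _ (const_mem_vecExpPoly 1 _)
    (Submodule.add_mem _ (smul_mem_vecExpPoly (cos_add_mem_realExpPoly c) _)
      (smul_mem_vecExpPoly (sin_add_mem_realExpPoly c) _))

/-- Reversing the angle only permutes the frequencies; this is needed for inverse rotations. -/
theorem realExpPoly_neg (D : ℕ) : realExpPoly (-θ) D = realExpPoly θ D := by
  have : ∀ (θ : ℝ), expPolySpan (-θ) D ≤ expPolySpan θ D := by
    intro θ
    rw [expPolySpan, Submodule.span_le]
    rintro _ ⟨j, hj, m, hm, rfl⟩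
    have : expPoly (-θ) j m = expPoly θ j (-m) := by ext k; simp [expPoly]
    rw [this]
    exact expPoly_mem hj (by simpa using hm)
  have h2 : expPolySpan (-θ) D = expPolySpan θ D :=
    le_antisymm (this θ) (by simpa using this (-θ))
  ext w
  rw [mem_realExpPoly, mem_realExpPoly, h2]

theorem vecExpPoly_neg (D : ℕ) : vecExpPoly (-θ) D E = vecExpPoly θ D E := by
  rw [vecExpPoly, vecExpPoly, realExpPoly_neg]

/-- The linearisation is the identity in the base directions and a rotation in the fibres, so its
powers and their inverses involve only `cos` and `sin` of multiples of `θ`. -/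
theorem isRotationFamily_rotSnd {ι : Type*} {l : Filter ι} {J : ι → E →L[ℝ] E}
    {J₀ : E →L[ℝ] E} (hJ : Tendsto J l (𝓝 J₀)) (hsq : ∀ᶠ b in l, ∀ v, J b (J b v) = -v)
    {L : ι → E × E →L[ℝ] E × E} (hL : ∀ᶠ b in l, L b = rotSnd θ (J b)) :
    IsRotationFamily θ l L (fun b k => rotSnd (k * θ) (J b))
      (fun b k => rotSnd (k * -θ + -θ) (J b)) := by
  have hb : ∀ t : ℝ, (fun b => rotSnd t (J b)) =O[l] fun _ => (1 : ℝ) := by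
    intro t
    have h1 : Continuous fun J : E →L[ℝ] E => rotSnd t J := by
      simp only [rotSnd_eq]
      fun_prop
    exact ((h1.tendsto J₀).comp hJ).isBigO_one ℝ
  refine ⟨fun b => ?_, fun b => ?_, fun k => hb _, fun k => hb _, ?_, ?_, ?_⟩
  · simpa using rotSnd_mem_vecExpPoly (θ := θ) 0 (J b)
  · rw [← vecExpPoly_neg]
    exact rotSnd_mem_vecExpPoly (θ := -θ) (-θ) (J b)
  · refine Eventually.of_forall fun b => ?_
    ext x <;> simp [rotSnd_apply, rot_apply]
  · filter_upwards [hsq, hL] with b h1 h2 k x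
    rw [h2]
    simp only [rotSnd_apply, rot_rot h1]
    congr 2; push_cast; ring_nf
  · filter_upwards [hsq] with b h1 k x
    simp only [rotSnd_apply, rot_rot h1]
    rw [show ((k + 1 : ℕ) : ℝ) * θ + (k * -θ + -θ) = 0 by push_cast; ring, rot_zero]

theorem IsWeights.hasDerivAt_wavg {D K : ℕ} {a a' : ℕ → ℝ → ℝ} (h : IsWeights θ D K a a')
    (φ : ℝ) (y : ℕ → E) : HasDerivAt (fun φ => wavg K a φ y) (wavg K a' φ y) φ :=
  HasDerivAt.fun_sum fun k _ => (h.hasDerivAt k φ).smul_const (y k)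

theorem IsWeights.continuous_wavg {D K : ℕ} {a a' : ℕ → ℝ → ℝ} (h : IsWeights θ D K a a')
    (y : ℕ → E) : Continuous fun φ => wavg K a φ y :=
  continuous_finsetSum _ fun k _ => (h.continuous k).smul continuous_const

theorem IsWeights.continuous_wavg_deriv {D K : ℕ} {a a' : ℕ → ℝ → ℝ}
    (h : IsWeights θ D K a a') (y : ℕ → E) : Continuous fun φ => wavg K a' φ y :=
  continuous_finsetSum _ fun k _ => (h.continuous_deriv k).smul continuous_const

theorem IsWeights.wavg_periodic {D K : ℕ} {a a' : ℕ → ℝ → ℝ} (h : IsWeights θ D K a a')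
    (y : ℕ → E) : wavg K a (2 * Real.pi) y = wavg K a 0 y := by
  refine Finset.sum_congr rfl fun k _ => ?_
  have := h.periodic k 0
  rw [zero_add] at this
  rw [this]

/-- Averages against `a'` need no formulas of their own: they are the derivatives of the averages
against `a`. -/
theorem IsWeights.wavg_deriv_eq {D K : ℕ} {a a' : ℕ → ℝ → ℝ} (h : IsWeights θ D K a a')
    {y : ℕ → E} {g g' : ℝ → E} (hg : ∀ φ, wavg K a φ y = g φ)
    (hg' : ∀ φ, HasDerivAt g (g' φ) φ) (φ : ℝ) : wavg K a' φ y = g' φ := by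
  have h1 := h.hasDerivAt_wavg φ y
  simp only [hg] at h1
  exact h1.unique (hg' φ)

theorem IsWeights.wavg_rot {D K : ℕ} {a a' : ℕ → ℝ → ℝ} (h : IsWeights θ D K a a')
    (J : E →L[ℝ] E) (x : E) (φ : ℝ) : wavg K a φ (fun k => rot (k * θ) J x) = rot φ J x := by
  simp only [rot_apply, wavg_sub, wavg_smul_const, h.map_cos, h.map_sin]

theorem hasDerivAt_rot (J : E →L[ℝ] E) (hJ : ∀ v, J (J v) = -v) (x : E) (φ : ℝ) :
    HasDerivAt (fun φ => rot φ J x) (-rot φ J (J x)) φ := by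
  simp only [rot_apply, hJ]
  have := ((Real.hasDerivAt_cos φ).smul_const x).fun_sub ((Real.hasDerivAt_sin φ).smul_const (J x))
  convert this using 1
  module

end Rotations

/-! ### Integrals of one-forms over close loops. -/

section Loops

universe u

variable {θ : ℝ} {W : Type u} [NormedAddCommGroup W] [NormedSpace ℝ W]
  {ι : Type*} {l : Filter ι} {e : ι → ℝ}

/-- The factor `⊤` on the phase expresses uniformity in `φ`. -/
theorem eventually_prod_top_iff {P : ι × ℝ → Prop} :
    (∀ᶠ x in l ×ˢ (⊤ : Filter ℝ), P x) ↔ ∀ᶠ b in l, ∀ φ, P (b, φ) := by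
  rw [← principal_univ, eventually_prod_principal_iff]
  simp

theorem isBigO_integral {F : Type*} [NormedAddCommGroup F] [NormedSpace ℝ F]
    {f : ι × ℝ → F} {e : ι → ℝ} (hf : f =O[l ×ˢ ⊤] fun x => e x.1) :
    (fun b => ∫ φ in (0 : ℝ)..2 * Real.pi, f (b, φ)) =O[l] e := by
  obtain ⟨C, hC⟩ := hf.bound
  rw [eventually_prod_top_iff] at hC
  refine IsBigO.of_bound (C * |2 * Real.pi - 0|) (hC.mono fun b hb => ?_)
  refine (intervalIntegral.norm_integral_le_of_norm_le_const (C := C * ‖e b‖) fun φ _ => hb φ).trans (le_of_eq ?_)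
  ring

/-- The integral of the one-form `T (ħ, ·)` along a loop with velocity `γ'`. -/
noncomputable def loopAction (T : ℝ × W → W →L[ℝ] ℝ) (ħ : ℝ) (γ γ' : ℝ → W) : ℝ :=
  ∫ φ in (0 : ℝ)..2 * Real.pi, T (ħ, γ φ) (γ' φ)

/-- Integrals of a one-form along two close loops are close. -/
theorem isBigO_loopAction_sub {T : ℝ × W → W →L[ℝ] ℝ} {c : W} (hT : ContDiffAt ℝ 1 T (0, c))
    {ħ : ι → ℝ} (hħ : Tendsto ħ l (𝓝 0)) {γ₁ γ₂ γ₁' γ₂' : ι → ℝ → W} {n : ℕ}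
    (h₁ : ∀ᶠ b in l, (∀ φ, HasDerivAt (γ₁ b) (γ₁' b φ) φ) ∧ Continuous (γ₁' b) ∧
      γ₁ b (2 * Real.pi) = γ₁ b 0)
    (h₂ : ∀ᶠ b in l, (∀ φ, HasDerivAt (γ₂ b) (γ₂' b φ) φ) ∧ Continuous (γ₂' b) ∧
      γ₂ b (2 * Real.pi) = γ₂ b 0)
    (ht₁ : Tendsto (fun x : ι × ℝ => γ₁ x.1 x.2) (l ×ˢ ⊤) (𝓝 c))
    (ht₂ : Tendsto (fun x : ι × ℝ => γ₂ x.1 x.2) (l ×ˢ ⊤) (𝓝 c))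
    (hb₁ : (fun x : ι × ℝ => γ₁' x.1 x.2) =O[l ×ˢ ⊤] fun _ => (1 : ℝ))
    (hb₂ : (fun x : ι × ℝ => γ₂' x.1 x.2) =O[l ×ˢ ⊤] fun _ => (1 : ℝ))
    (hsub : (fun x : ι × ℝ => γ₂ x.1 x.2 - γ₁ x.1 x.2) =O[l ×ˢ ⊤] fun x => e x.1 ^ n) :
    (fun b => loopAction T (ħ b) (γ₂ b) (γ₂' b) - loopAction T (ħ b) (γ₁ b) (γ₁' b))
      =O[l] fun b => e b ^ n := by
  have hp₁ : Tendsto (fun x : ι × ℝ => (ħ x.1, γ₁ x.1 x.2)) (l ×ˢ ⊤) (𝓝 (0, c)) :=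
    (hħ.comp tendsto_fst).prodMk_nhds ht₁
  have hp₂ : Tendsto (fun x : ι × ℝ => (ħ x.1, γ₂ x.1 x.2)) (l ×ˢ ⊤) (𝓝 (0, c)) :=
    (hħ.comp tendsto_fst).prodMk_nhds ht₂
  have hev : ∀ᶠ z in 𝓝 ((0 : ℝ), c), ContDiffAt ℝ 1 T z := hT.eventually (by simp)
  have hA : (fun x : ι × ℝ => T (ħ x.1, γ₂ x.1 x.2) - T (ħ x.1, γ₁ x.1 x.2))
      =O[l ×ˢ ⊤] fun x => e x.1 ^ n := by
    refine (((hT.hasStrictFDerivAt (by simp)).isBigO_sub).comp_tendsto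
      (hp₂.prodMk_nhds hp₁)).trans (IsBigO.trans (IsBigO.of_bound 1 ?_) hsub)
    exact Eventually.of_forall fun b => by simp [Prod.norm_def]
  have hD : (fun x : ι × ℝ => fderiv ℝ T (ħ x.1, γ₁ x.1 x.2)) =O[l ×ˢ ⊤] fun _ => (1 : ℝ) :=
    (((hT.fderiv_right (m := 0) (by simp)).continuousAt.tendsto).comp hp₁).isBigO_one ℝ
  -- Integration by parts: the two integrands differ by `B` plus the derivative of `T(γ₁)(γ₂ - γ₁)`,
  -- which integrates to zero over closed loops. Hence the loops have to be close, but not their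
  -- velocities.
  set B : ι × ℝ → ℝ := fun x =>
    (T (ħ x.1, γ₂ x.1 x.2) - T (ħ x.1, γ₁ x.1 x.2)) (γ₂' x.1 x.2) -
      (fderiv ℝ T (ħ x.1, γ₁ x.1 x.2) (0, γ₁' x.1 x.2)) (γ₂ x.1 x.2 - γ₁ x.1 x.2) with hB
  have hBO : B =O[l ×ˢ ⊤] fun x => e x.1 ^ n := by
    have h1 := isBigO_clm_apply hA hb₂
    have h0 : (fun x : ι × ℝ => ((0 : ℝ), γ₁' x.1 x.2)) =O[l ×ˢ ⊤] fun _ => (1 : ℝ) :=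
      (isBigO_zero _ _).prod_left hb₁
    have h2 := isBigO_clm_apply hD h0
    have h3 := isBigO_clm_apply h2 hsub
    simp only [mul_one, one_mul] at h1 h3
    exact h1.sub h3
  refine (isBigO_integral hBO).congr' ?_ EventuallyEq.rfl
  have hev₁ := eventually_prod_top_iff.1 (hp₁.eventually hev)
  have hev₂ := eventually_prod_top_iff.1 (hp₂.eventually hev)
  filter_upwards [h₁, h₂, hev₁, hev₂] with b ⟨hd₁, hc₁, hper₁⟩ ⟨hd₂, hc₂, hper₂⟩ hs₁ hs₂
  have hcγ₁ : Continuous (γ₁ b) := continuous_iff_continuousAt.2 fun φ => (hd₁ φ).continuousAt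
  have hcγ₂ : Continuous (γ₂ b) := continuous_iff_continuousAt.2 fun φ => (hd₂ φ).continuousAt
  have hcT₁ : Continuous fun φ => T (ħ b, γ₁ b φ) := continuous_iff_continuousAt.2 fun φ =>
    ContinuousAt.comp (g := T) (f := fun φ => (ħ b, γ₁ b φ)) (hs₁ φ).continuousAt (by fun_prop)
  have hcT₂ : Continuous fun φ => T (ħ b, γ₂ b φ) := continuous_iff_continuousAt.2 fun φ =>
    ContinuousAt.comp (g := T) (f := fun φ => (ħ b, γ₂ b φ)) (hs₂ φ).continuousAt (by fun_prop)
  have hcD : Continuous fun φ => fderiv ℝ T (ħ b, γ₁ b φ) := continuous_iff_continuousAt.2 fun φ =>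
    ContinuousAt.comp (g := fderiv ℝ T) (f := fun φ => (ħ b, γ₁ b φ))
      ((hs₁ φ).fderiv_right (m := 0) (by simp)).continuousAt (by fun_prop)
  have hder : ∀ φ ∈ uIcc 0 (2 * Real.pi), HasDerivAt
      (fun φ => T (ħ b, γ₁ b φ) (γ₂ b φ - γ₁ b φ))
      ((fderiv ℝ T (ħ b, γ₁ b φ) (0, γ₁' b φ)) (γ₂ b φ - γ₁ b φ) +
        T (ħ b, γ₁ b φ) (γ₂' b φ - γ₁' b φ)) φ := by
    intro φ _
    have h1 : HasDerivAt (fun φ => (ħ b, γ₁ b φ)) (0, γ₁' b φ) φ :=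
      (hasDerivAt_const φ _).prodMk (hd₁ φ)
    have h2 : HasDerivAt (fun φ => T (ħ b, γ₁ b φ)) (fderiv ℝ T (ħ b, γ₁ b φ) (0, γ₁' b φ)) φ :=
      HasFDerivAt.comp_hasDerivAt φ ((hs₁ φ).differentiableAt (by simp)).hasFDerivAt h1
    have h3 : HasDerivAt (fun φ => γ₂ b φ - γ₁ b φ) (γ₂' b φ - γ₁' b φ) φ :=
      (hd₂ φ).fun_sub (hd₁ φ)
    exact h2.clm_apply h3
  have hi1 : Continuous fun φ =>
      (fderiv ℝ T (ħ b, γ₁ b φ) (0, γ₁' b φ)) (γ₂ b φ - γ₁ b φ) := by fun_prop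
  have hi2 : Continuous fun φ => T (ħ b, γ₁ b φ) (γ₂' b φ - γ₁' b φ) :=
    hcT₁.clm_apply (hc₂.sub hc₁)
  have hint := intervalIntegral.integral_eq_sub_of_hasDerivAt hder
    (hi1.add hi2).continuousOn.intervalIntegrable
  rw [hper₁, hper₂, sub_self] at hint
  have hi3 : Continuous fun φ => T (ħ b, γ₁ b φ) (γ₁' b φ) := hcT₁.clm_apply hc₁
  have hi4 : Continuous fun φ => T (ħ b, γ₂ b φ) (γ₂' b φ) := hcT₂.clm_apply hc₂
  have hi5 : Continuous fun φ => (fderiv ℝ T (ħ b, γ₁ b φ) (0, γ₁' b φ)) (γ₂ b φ - γ₁ b φ) +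
        T (ħ b, γ₁ b φ) (γ₂' b φ - γ₁' b φ) := hi1.add hi2
  have hBeq : ∀ φ, B (b, φ) = (T (ħ b, γ₂ b φ) (γ₂' b φ) - T (ħ b, γ₁ b φ) (γ₁' b φ)) -
      ((fderiv ℝ T (ħ b, γ₁ b φ) (0, γ₁' b φ)) (γ₂ b φ - γ₁ b φ) +
        T (ħ b, γ₁ b φ) (γ₂' b φ - γ₁' b φ)) := fun φ => by
    simp only [hB, sub_apply, map_sub]
    ring
  have hi6 : Continuous fun φ => T (ħ b, γ₂ b φ) (γ₂' b φ) - T (ħ b, γ₁ b φ) (γ₁' b φ) :=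
    hi4.sub hi3
  simp only [hBeq]
  rw [intervalIntegral.integral_sub (hi6.intervalIntegrable _ _)
    (hi5.intervalIntegrable _ _), hint, sub_zero, intervalIntegral.integral_sub
    (hi4.intervalIntegrable _ _) (hi3.intervalIntegrable _ _), loopAction, loopAction]

end Loops

end SymplecticLorentz

namespace SymplecticLorentz

open Filter Asymptotics

/-! ### Almost invariance of the loop action. -/

section ApproximateInvariance

universe u

variable {θ : ℝ} {W : Type u} [NormedAddCommGroup W] [NormedSpace ℝ W]
  {ι : Type*} {l : Filter ι} {e : ι → ℝ}

theorem IsWeights.wavg_prod_const {D K : ℕ} {a a' : ℕ → ℝ → ℝ} (h : IsWeights θ D K a a')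
    (φ : ℝ) (x : ℝ) (y : ℕ → W) : wavg K a φ (fun k => (x, y k)) = (x, wavg K a φ y) := by
  have h1 := h.map_one φ
  refine Prod.ext ?_ ?_
  · simp [wavg, Prod.fst_sum, ← Finset.sum_mul, h1]
  · simp [wavg, Prod.snd_sum]

/-- The integral of a one-form over the loop through an orbit, when the one-form is preserved up to
exact one-forms, is an invariant to all orders. -/
theorem isBigO_loopAction_succ_sub [CompleteSpace W] (he : Tendsto e l (𝓝 0)) {c : W}
    {w : ι → W} (hw : Tendsto w l (𝓝 c)) {ħ : ι → ℝ} (hħ : ħ =O[l] fun b => e b ^ 1)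
    (hħ0 : ∀ᶠ b in l, ħ b ≠ 0)
    {f : ℝ × W → W} (hf : ContDiffAt ℝ ∞ f (0, c)) (hfix : ∀ᶠ b in l, f (0, w b) = w b)
    {P M : ι → ℕ → W →L[ℝ] W}
    (hrot : IsRotationFamily θ l
      (fun b => (fderiv ℝ f (0, w b)).comp (ContinuousLinearMap.inr ℝ ℝ W)) P M)
    {T : ℝ × W → W →L[ℝ] ℝ} (hT : ContDiffAt ℝ 1 T (0, c)) {s : ℝ → W → ℝ}
    (hexact : ∀ᶠ z in 𝓝 ((0 : ℝ), c), z.1 ≠ 0 → HasFDerivAt (s z.1)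
      ((T (z.1, f z)).comp ((fderiv ℝ f z).comp (ContinuousLinearMap.inr ℝ ℝ W)) - T z) z.2)
    {y : ι → ℕ → W} (hyO : ∀ k, (fun b => y b k - w b) =O[l] fun b => e b ^ 1)
    (hy : ∀ k, ∀ᶠ b in l, y b (k + 1) = f (ħ b, y b k)) (n : ℕ) :
    ∀ D₀ K a a', n * orbitDegree n ≤ D₀ → IsWeights θ D₀ K a a' →
      (fun b => loopAction T (ħ b) (fun φ => wavg K a φ fun k => y b (k + 1))
          (fun φ => wavg K a' φ fun k => y b (k + 1)) -
        loopAction T (ħ b) (fun φ => wavg K a φ (y b)) (fun φ => wavg K a' φ (y b)))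
        =O[l] fun b => e b ^ n := by
  rcases l.eq_or_neBot with rfl | hl
  · exact fun D₀ K a a' _ _ => by simp
  set D := orbitDegree n
  have hD : IsExpPolyMod θ l e n D y := isExpPolyMod_orbit he hw hħ hf hfix hrot hyO hy n
  have hbase : Tendsto (fun b => ((0 : ℝ), w b)) l (𝓝 (0, c)) := tendsto_const_nhds.prodMk_nhds hw
  have hYO : ∀ k, (fun b => (ħ b, y b k) - ((0 : ℝ), w b)) =O[l] fun b => e b ^ 1 := fun k => by
    simp only [Prod.mk_sub_mk, sub_zero]
    exact hħ.prod_left (hyO k)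
  have hY : IsExpPolyMod θ l e n D fun b k => (ħ b, y b k) := by
    have h1 := (hD.clm (ContinuousLinearMap.inr ℝ ℝ W)).add
      (isExpPolyMod_const n D fun b => (ħ b, (0 : W)))
    refine h1.congr fun k => Eventually.of_forall fun b => ?_
    simp
  have hf2 : ContDiffAt ℝ ∞ (fun z : (ℝ × W) × (ℝ × W) => f z.2) ((0, c), (0, c)) :=
    ContDiffAt.comp (g := f) _ hf contDiffAt_snd
  obtain ⟨-, hcomm⟩ := hY.comp_smooth he hbase hYO n hf2
  intro D₀ K a a' hD₀ ha
  obtain ⟨C, hC⟩ := ha.exists_bound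
  have hC1 : ∀ k < K, ∀ φ, |a k φ| ≤ C := fun k hk φ => (hC k hk φ).1
  have hC2 : ∀ k < K, ∀ φ, |a' k φ| ≤ C := fun k hk φ => (hC k hk φ).2
  have he' : Tendsto (fun x : ι × ℝ => e x.1) (l ×ˢ ⊤) (𝓝 0) := he.comp tendsto_fst
  have hw' : Tendsto (fun x : ι × ℝ => w x.1) (l ×ˢ ⊤) (𝓝 c) := hw.comp tendsto_fst
  have hħt : Tendsto ħ l (𝓝 0) := hħ.trans_tendsto (by simpa using he)
  have hħt' : Tendsto (fun x : ι × ℝ => ħ x.1) (l ×ˢ ⊤) (𝓝 0) := hħt.comp tendsto_fst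
  have htend : ∀ z : ι → ℕ → W, (∀ k, (fun b => z b k - w b) =O[l] fun b => e b ^ 1) →
      Tendsto (fun x : ι × ℝ => wavg K a x.2 (z x.1)) (l ×ˢ ⊤) (𝓝 c) := fun z hz =>
    tendsto_of_sub_isBigO he' hw' ((isBigO_wavg hC1 hz).congr_left fun x => by
      rw [wavg_sub, ha.wavg_const])
  have hbd : ∀ z : ι → ℕ → W, (∀ k, (fun b => z b k - w b) =O[l] fun b => e b ^ 1) →
      (fun x : ι × ℝ => wavg K a' x.2 (z x.1)) =O[l ×ˢ ⊤] fun _ => (1 : ℝ) := fun z hz =>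
    isBigO_wavg (e := fun _ => 1) hC2 fun k => (tendsto_of_sub_isBigO he hw (hz k)).isBigO_one ℝ
  have hγt := htend y hyO
  have hpt : Tendsto (fun x : ι × ℝ => (ħ x.1, wavg K a x.2 (y x.1))) (l ×ˢ ⊤) (𝓝 (0, c)) :=
    hħt'.prodMk_nhds hγt
  have hfc : f (0, c) = c := by
    have h1 : Tendsto (fun b => f (0, w b)) l (𝓝 (f (0, c))) :=
      hf.continuousAt.tendsto.comp hbase
    exact tendsto_nhds_unique (h1.congr' hfix) hw
  have hfd : ∀ᶠ b in l, ∀ φ, HasDerivAt (fun φ => f (ħ b, wavg K a φ (y b)))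
      (fderiv ℝ f (ħ b, wavg K a φ (y b)) (0, wavg K a' φ (y b))) φ := by
    have h1 : ∀ᶠ z in 𝓝 ((0 : ℝ), c), DifferentiableAt ℝ f z :=
      ((hf.of_le (by simp) : ContDiffAt ℝ 1 f (0, c)).eventually (by simp)).mono
        fun z hz => hz.differentiableAt (by simp)
    filter_upwards [eventually_prod_top_iff.1 (hpt.eventually h1)] with b hb φ
    exact (hb φ).hasFDerivAt.comp_hasDerivAt φ
      ((hasDerivAt_const φ _).prodMk (ha.hasDerivAt_wavg φ (y b)))
  have hfc' : ∀ᶠ b in l, Continuous fun φ =>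
      fderiv ℝ f (ħ b, wavg K a φ (y b)) (0, wavg K a' φ (y b)) := by
    have h1 : ∀ᶠ z in 𝓝 ((0 : ℝ), c), ContinuousAt (fderiv ℝ f) z :=
      ((hf.of_le (by simp) : ContDiffAt ℝ 1 f (0, c)).eventually (by simp)).mono
        fun z hz => (hz.fderiv_right (m := 0) (by simp)).continuousAt
    filter_upwards [eventually_prod_top_iff.1 (hpt.eventually h1)] with b hb
    have h2 : Continuous fun φ => (ħ b, wavg K a φ (y b)) :=
      continuous_const.prodMk (ha.continuous_wavg (y b))
    have h3 : Continuous fun φ => fderiv ℝ f (ħ b, wavg K a φ (y b)) :=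
      continuous_iff_continuousAt.2 fun φ =>
        ContinuousAt.comp (g := fderiv ℝ f) (hb φ) h2.continuousAt
    exact h3.clm_apply (continuous_const.prodMk (ha.continuous_wavg_deriv (y b)))
  -- `γ₁` is the loop of the shifted orbit and `γ₂` the image under `f` of the loop of the orbit.
  -- They are `O(e ^ n)` close because averaging commutes with `f` to that order.
  have hmain := isBigO_loopAction_sub hT hħt (e := e) (n := n)
    (γ₁ := fun b φ => wavg K a φ fun k => y b (k + 1))
    (γ₁' := fun b φ => wavg K a' φ fun k => y b (k + 1))
    (γ₂ := fun b φ => f (ħ b, wavg K a φ (y b)))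
    (γ₂' := fun b φ => fderiv ℝ f (ħ b, wavg K a φ (y b)) (0, wavg K a' φ (y b)))
    (Eventually.of_forall fun b => ⟨fun φ => ha.hasDerivAt_wavg φ _, ha.continuous_wavg_deriv _,
      ha.wavg_periodic _⟩)
    (by
      filter_upwards [hfd, hfc'] with b h1 h2
      exact ⟨h1, h2, by rw [ha.wavg_periodic]⟩)
    (htend _ fun k => hyO (k + 1))
    (by
      have h1 := hf.continuousAt.tendsto.comp hpt
      rwa [hfc] at h1)
    (hbd _ fun k => hyO (k + 1))
    (by
      have h1 : (fun x : ι × ℝ => fderiv ℝ f (ħ x.1, wavg K a x.2 (y x.1)))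
          =O[l ×ˢ ⊤] fun _ => (1 : ℝ) :=
        (((hf.fderiv_right (m := 0) (by simp)).continuousAt.tendsto).comp hpt).isBigO_one ℝ
      simpa using isBigO_clm_apply h1 ((isBigO_zero (E' := ℝ) _ _).prod_left (hbd _ hyO)))
    (by
      have h1 : ∀ᶠ b in l, ∀ k ∈ Finset.range K, y b (k + 1) = f (ħ b, y b k) :=
        (Finset.eventually_all _).2 fun k _ => hy k
      refine ((hcomm D₀ K a a' hD₀ ha).neg_left).congr' ?_ EventuallyEq.rfl
      filter_upwards [tendsto_fst.eventually h1] with x hx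
      simp only [ha.wavg_prod_const, neg_sub]
      congr 1
      exact Finset.sum_congr rfl fun k hk => by simp only [hx k hk])
  refine hmain.neg_left.congr' ?_ EventuallyEq.rfl
  -- The actions of a loop and of its image under `f` coincide: the integrands differ by the
  -- derivative of `s (ħ b)` along a closed loop.
  have hev := eventually_prod_top_iff.1 (hpt.eventually hexact)
  have hTc : ∀ᶠ z in 𝓝 ((0 : ℝ), c), ContinuousAt T z :=
    (hT.eventually (by simp)).mono fun z hz => hz.continuousAt
  have hfcont : ∀ᶠ z in 𝓝 ((0 : ℝ), c), ContinuousAt f z :=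
    ((hf.of_le (by simp) : ContDiffAt ℝ 1 f (0, c)).eventually (by simp)).mono
      fun z hz => hz.continuousAt
  have hTf : Tendsto (fun x : ι × ℝ => (ħ x.1, f (ħ x.1, wavg K a x.2 (y x.1)))) (l ×ˢ ⊤)
      (𝓝 (0, c)) := by
    have h1 := hf.continuousAt.tendsto.comp hpt
    rw [hfc] at h1
    exact hħt'.prodMk_nhds h1
  filter_upwards [hev, hħ0, hfc', hfd, eventually_prod_top_iff.1 (hpt.eventually hTc),
    eventually_prod_top_iff.1 (hTf.eventually hTc)] with b hb hb0 hc1 hd hcT hcTf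
  rw [neg_sub]
  congr 1
  rw [← sub_eq_zero]
  have hγ : Continuous fun φ => wavg K a φ (y b) := ha.continuous_wavg (y b)
  have hcf : Continuous fun φ => f (ħ b, wavg K a φ (y b)) :=
    continuous_iff_continuousAt.2 fun φ => (hd φ).continuousAt
  have hi1 : Continuous fun φ => T (ħ b, wavg K a φ (y b)) (wavg K a' φ (y b)) := by
    have h1 : Continuous fun φ => T (ħ b, wavg K a φ (y b)) :=
      continuous_iff_continuousAt.2 fun φ =>
        ContinuousAt.comp (g := T) (hcT φ) (continuous_const.prodMk hγ).continuousAt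
    exact h1.clm_apply (ha.continuous_wavg_deriv (y b))
  have hi2 : Continuous fun φ => T (ħ b, f (ħ b, wavg K a φ (y b)))
      (fderiv ℝ f (ħ b, wavg K a φ (y b)) (0, wavg K a' φ (y b))) := by
    have h1 : Continuous fun φ => T (ħ b, f (ħ b, wavg K a φ (y b))) :=
      continuous_iff_continuousAt.2 fun φ =>
        ContinuousAt.comp (g := T) (hcTf φ) (continuous_const.prodMk hcf).continuousAt
    exact h1.clm_apply hc1
  have hder : ∀ φ ∈ uIcc 0 (2 * Real.pi), HasDerivAt (fun φ => s (ħ b) (wavg K a φ (y b)))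
      (T (ħ b, f (ħ b, wavg K a φ (y b)))
        (fderiv ℝ f (ħ b, wavg K a φ (y b)) (0, wavg K a' φ (y b))) -
          T (ħ b, wavg K a φ (y b)) (wavg K a' φ (y b))) φ := by
    intro φ _
    exact (hb φ hb0).comp_hasDerivAt φ (ha.hasDerivAt_wavg φ (y b))
  have hint := intervalIntegral.integral_eq_sub_of_hasDerivAt hder
    (hi2.sub hi1).continuousOn.intervalIntegrable
  rw [ha.wavg_periodic, sub_self] at hint
  rw [loopAction, loopAction, ← intervalIntegral.integral_sub (hi2.intervalIntegrable _ _)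
    (hi1.intervalIntegrable _ _), hint]

end ApproximateInvariance

end SymplecticLorentz

namespace SymplecticLorentz

open Filter Asymptotics

/-! ### Differential of the generating function, and the relations in terms of it. -/

section GeneratingFunction

set_option maxSynthPendingDepth 3

universe u

variable {E : Type u} [NormedAddCommGroup E] [NormedSpace ℝ E]

/-- The metric as a bounded bilinear map. -/
noncomputable def metricL (ϑ : E → E →L[ℝ] ℝ) (J : E → E →L[ℝ] E) (q : E) : E →L[ℝ] E →L[ℝ] ℝ :=
  ((ContinuousLinearMap.compL ℝ E E ℝ).flip (J q)).comp (omega ϑ q)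

theorem metricL_apply (ϑ : E → E →L[ℝ] ℝ) (J : E → E →L[ℝ] E) (q v w : E) :
    metricL ϑ J q v w = metric ϑ J q v w := rfl

theorem omega_self (ϑ : E → E →L[ℝ] ℝ) (q v : E) : omega ϑ q v v = 0 := by
  simp [omega]

theorem omega_swap (ϑ : E → E →L[ℝ] ℝ) (q v w : E) : omega ϑ q v w = -omega ϑ q w v := by
  simp [omega]

/-- The linear part of the generating function in the displacement. -/
noncomputable def linPart (ϑ : E → E →L[ℝ] ℝ) (J : E → E →L[ℝ] E) (H : E → ℝ) (x : E) :
    E →L[ℝ] ℝ :=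
  metricL ϑ J x (hamVF ϑ H x) -
    (1 / 12 : ℝ) • fderiv ℝ (omega ϑ) x (hamVF ϑ H x) (hamVF ϑ H x)

/-- The derivative of `genSigma` with respect to the displacement. -/
noncomputable def sigmaXi (ϑ : E → E →L[ℝ] ℝ) (J : E → E →L[ℝ] E) (H : E → ℝ) (κ ħ : ℝ) (x ξ : E) :
    E →L[ℝ] ℝ :=
  ħ ^ 2 • linPart ϑ J H x - (κ / 2) • metricL ϑ J x (ξ - ħ • hamVF ϑ H x)

/-- The quadratic correction in the derivative of `genSigma` with respect to the base point. -/
noncomputable def sigmaRem (ϑ : E → E →L[ℝ] ℝ) (J : E → E →L[ℝ] E) (H : E → ℝ) (κ ħ : ℝ)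
    (x ξ δ : E) : E →L[ℝ] ℝ :=
  ħ ^ 2 • (fderiv ℝ (linPart ϑ J H) x).flip ξ - (κ / 4) •
    (((fderiv ℝ (metricL ϑ J) x).flip δ).flip δ -
      (2 * ħ) • (metricL ϑ J x δ).comp (fderiv ℝ (hamVF ϑ H) x))

/-- The derivative of `genSigma` with respect to the base point. -/
noncomputable def sigmaX (ϑ : E → E →L[ℝ] ℝ) (J : E → E →L[ℝ] E) (H : E → ℝ) (κ ħ : ℝ) (x ξ : E) :
    E →L[ℝ] ℝ :=
  -(ħ • fderiv ℝ H x) + sigmaRem ϑ J H κ ħ x ξ (ξ - ħ • hamVF ϑ H x)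

/-- The weighted integral of `ω` along a segment, with weight `1 - t`. -/
noncomputable def omegaAvg₀ (ϑ : E → E →L[ℝ] ℝ) (q ξ : E) : E →L[ℝ] E →L[ℝ] ℝ :=
  ∫ t in (0 : ℝ)..1, (1 - t) • omega ϑ (q + t • ξ)

/-- The weighted integral of `ω` along a segment, with weight `t`. -/
noncomputable def omegaAvg₁ (ϑ : E → E →L[ℝ] ℝ) (q ξ : E) : E →L[ℝ] E →L[ℝ] ℝ :=
  ∫ t in (0 : ℝ)..1, t • omega ϑ (q + t • ξ)

/-- The right hand side of the backward relation, as a function of `ħ`, `q`, `ξ = q' - q`. -/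
noncomputable def backForm (ϑ : E → E →L[ℝ] ℝ) (J : E → E →L[ℝ] E) (H : E → ℝ) (κ ħ : ℝ)
    (q ξ : E) : E →L[ℝ] ℝ :=
  -omegaAvg₀ ϑ q ξ ξ - (1 / 2 : ℝ) • sigmaX ϑ J H κ ħ (q + (1 / 2 : ℝ) • ξ) ξ +
    sigmaXi ϑ J H κ ħ (q + (1 / 2 : ℝ) • ξ) ξ

/-- The right hand side of the forward relation, as a function of `ħ`, `q`, `ξ = q' - q`. -/
noncomputable def fwdForm (ϑ : E → E →L[ℝ] ℝ) (J : E → E →L[ℝ] E) (H : E → ℝ) (κ ħ : ℝ)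
    (q ξ : E) : E →L[ℝ] ℝ :=
  omegaAvg₁ ϑ q ξ ξ + (1 / 2 : ℝ) • sigmaX ϑ J H κ ħ (q + (1 / 2 : ℝ) • ξ) ξ +
    sigmaXi ϑ J H κ ħ (q + (1 / 2 : ℝ) • ξ) ξ

/-- The hypotheses of the theorem on `Q`, `ϑ`, `J`, `H`. -/
structure IsAdmissible (Q : Set E) (ϑ : E → E →L[ℝ] ℝ) (J : E → E →L[ℝ] E) (H : E → ℝ) : Prop where
  isOpen : IsOpen Q
  symplectic : IsExactSymplectic Q ϑ
  compatible : IsCompatibleComplexStructure Q ϑ J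
  smooth : ContDiffOn ℝ ∞ H Q

namespace IsAdmissible

variable {Q : Set E} {ϑ : E → E →L[ℝ] ℝ} {J : E → E →L[ℝ] E} {H : E → ℝ}

theorem contDiffAt_theta (h : IsAdmissible Q ϑ J H) {q : E} (hq : q ∈ Q) : ContDiffAt ℝ ∞ ϑ q :=
  h.symplectic.smooth.contDiffAt (h.isOpen.mem_nhds hq)

theorem contDiffAt_omega (h : IsAdmissible Q ϑ J H) {q : E} (hq : q ∈ Q) :
    ContDiffAt ℝ ∞ (omega ϑ) q := by
  have h1 : ContDiffAt ℝ ∞ (fderiv ℝ ϑ) q := (h.contDiffAt_theta hq).fderiv_right (by simp)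
  have h2 : ContDiffAt ℝ ∞ (fun q => (fderiv ℝ ϑ q).flip) q :=
    ContDiff.comp_contDiffAt (g := fun B : E →L[ℝ] E →L[ℝ] ℝ => B.flip) q
      (ContinuousLinearMap.flipₗᵢ ℝ E E ℝ).contDiff h1
  exact h2.sub h1

theorem contDiffAt_J (h : IsAdmissible Q ϑ J H) {q : E} (hq : q ∈ Q) : ContDiffAt ℝ ∞ J q :=
  h.compatible.smooth.contDiffAt (h.isOpen.mem_nhds hq)

theorem contDiffAt_H (h : IsAdmissible Q ϑ J H) {q : E} (hq : q ∈ Q) : ContDiffAt ℝ ∞ H q :=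
  h.smooth.contDiffAt (h.isOpen.mem_nhds hq)

theorem contDiffAt_metricL (h : IsAdmissible Q ϑ J H) {q : E} (hq : q ∈ Q) :
    ContDiffAt ℝ ∞ (metricL ϑ J) q := by
  have h1 : ContDiffAt ℝ ∞ (fun q => (ContinuousLinearMap.compL ℝ E E ℝ).flip (J q)) q :=
    ((ContinuousLinearMap.compL ℝ E E ℝ).flip).contDiff.comp_contDiffAt q (h.contDiffAt_J hq)
  exact h1.clm_comp (h.contDiffAt_omega hq)

theorem metricL_symm (h : IsAdmissible Q ϑ J H) {q : E} (hq : q ∈ Q) (v w : E) :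
    metricL ϑ J q v w = metricL ϑ J q w v :=
  h.compatible.symm q hq v w

theorem metricL_J (h : IsAdmissible Q ϑ J H) {q : E} (hq : q ∈ Q) (v w : E) :
    metricL ϑ J q (J q v) w = omega ϑ q v w := by
  rw [h.metricL_symm hq, metricL_apply, metric, h.compatible.sq_eq_neg q hq, map_neg,
    ← omega_swap]

theorem injective_metricL (h : IsAdmissible Q ϑ J H) {q : E} (hq : q ∈ Q) (v : E)
    (hv : metricL ϑ J q v = 0) : v = 0 := by
  by_contra hne
  have := h.compatible.pos q hq v hne
  rw [← metricL_apply, hv] at this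
  simp at this

theorem genSigma_eq (θ₀ ħ : ℝ) (x ξ : E) : genSigma ϑ J H θ₀ ħ x ξ =
    -ħ * H x + ħ ^ 2 * linPart ϑ J H x ξ - (1 / 4) * (Real.sin θ₀ / (1 - Real.cos θ₀)) *
      metricL ϑ J x (ξ - ħ • hamVF ϑ H x) (ξ - ħ • hamVF ϑ H x) := by
  simp only [genSigma, linPart, metricL_apply, sub_apply, smul_apply, smul_eq_mul]
  ring

theorem continuousOn_comp_segment {F : Type*} [TopologicalSpace F] {f : E → F} {q ξ : E}
    (hf : ∀ t ∈ Icc (0 : ℝ) 1, ContinuousAt f (q + t • ξ)) :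
    ContinuousOn (fun t : ℝ => f (q + t • ξ)) (uIcc 0 1) := by
  intro t ht
  rw [uIcc_of_le zero_le_one] at ht
  exact (ContinuousAt.comp (g := f) (f := fun t : ℝ => q + t • ξ)
    (hf t ht) (by fun_prop)).continuousWithinAt

/-- The fundamental theorem of calculus along the segment, with `ϑ` applied to a field interpolating
`d` and `e`. It produces the boundary terms in the derivative of the line integral. -/
theorem integral_theta_deriv (h : IsAdmissible Q ϑ J H) {q ξ : E}
    (hmem : ∀ t ∈ Icc (0 : ℝ) 1, q + t • ξ ∈ Q) (d e : E)
    (hi : ContinuousOn (fun t : ℝ => fderiv ℝ ϑ (q + t • ξ) ξ (d + t • (e - d)) +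
      ϑ (q + t • ξ) (e - d)) (uIcc 0 1)) :
    ∫ t in (0 : ℝ)..1, (fderiv ℝ ϑ (q + t • ξ) ξ (d + t • (e - d)) +
      ϑ (q + t • ξ) (e - d)) = ϑ (q + ξ) e - ϑ q d := by
  have hd : ∀ t ∈ uIcc (0 : ℝ) 1, HasDerivAt (fun t : ℝ => ϑ (q + t • ξ) (d + t • (e - d)))
      (fderiv ℝ ϑ (q + t • ξ) ξ (d + t • (e - d)) + ϑ (q + t • ξ) (e - d)) t := by
    intro t ht
    rw [uIcc_of_le zero_le_one] at ht
    have h1 : HasDerivAt (fun t : ℝ => q + t • ξ) ξ t := by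
      simpa only [one_smul, id] using ((hasDerivAt_id t).smul_const ξ).const_add q
    have h2 : HasDerivAt (fun t : ℝ => d + t • (e - d)) (e - d) t := by
      simpa only [one_smul, id] using ((hasDerivAt_id t).smul_const (e - d)).const_add d
    have h3 : HasDerivAt (fun t : ℝ => ϑ (q + t • ξ)) (fderiv ℝ ϑ (q + t • ξ) ξ) t :=
      HasFDerivAt.comp_hasDerivAt (l := ϑ) t
        ((h.contDiffAt_theta (hmem t ht)).differentiableAt (by simp)).hasFDerivAt h1
    exact h3.clm_apply h2
  rw [intervalIntegral.integral_eq_sub_of_hasDerivAt hd hi.intervalIntegrable]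
  simp

theorem fderiv_theta_segment (h : IsAdmissible Q ϑ J H) {q q' : E} {t : ℝ}
    (hmem : q + t • (q' - q) ∈ Q)
    (hsm : ContDiffAt ℝ 1
      (fun z : ℝ × (E × E) => ϑ (z.2.1 + z.1 • (z.2.2 - z.2.1)) (z.2.2 - z.2.1)) (t, (q, q')))
    (d : E × E) :
    (fderiv ℝ (fun z : ℝ × (E × E) => ϑ (z.2.1 + z.1 • (z.2.2 - z.2.1)) (z.2.2 - z.2.1))
        (t, (q, q'))).comp (ContinuousLinearMap.inr ℝ ℝ (E × E)) d =
      fderiv ℝ ϑ (q + t • (q' - q)) (d.1 + t • (d.2 - d.1)) (q' - q) +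
        ϑ (q + t • (q' - q)) (d.2 - d.1) := by
  have h1 : HasDerivAt (fun s : ℝ => (t, ((q, q') + s • d : E × E))) (0, d) 0 := by
    refine (hasDerivAt_const _ _).prodMk ?_
    simpa using ((hasDerivAt_id (0 : ℝ)).smul_const d).const_add (q, q')
  have h2 := HasFDerivAt.comp_hasDerivAt_of_eq (0 : ℝ)
    (hsm.differentiableAt (by simp)).hasFDerivAt h1 (by simp)
  have h3 : HasDerivAt (fun s : ℝ => q' + s • d.2 - (q + s • d.1)) (d.2 - d.1) 0 := by
    have h4 := ((hasDerivAt_id (0 : ℝ)).smul_const d.2).const_add q'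
    have h5 := ((hasDerivAt_id (0 : ℝ)).smul_const d.1).const_add q
    simpa using h4.fun_sub h5
  have h4 : HasDerivAt (fun s : ℝ => q + s • d.1 + t • (q' + s • d.2 - (q + s • d.1)))
      (d.1 + t • (d.2 - d.1)) 0 := by
    have h5 := ((hasDerivAt_id (0 : ℝ)).smul_const d.1).const_add q
    simpa using h5.fun_add (h3.const_smul t)
  have h5 := HasFDerivAt.comp_hasDerivAt_of_eq (0 : ℝ)
    ((h.contDiffAt_theta hmem).differentiableAt (by simp)).hasFDerivAt h4 (by simp)
  have h6 := h5.clm_apply h3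
  have h7 := h2.unique h6
  simpa using h7

/-- The derivative of the integral of `ϑ` along the segment between two points. -/
theorem hasFDerivAt_integral_theta (h : IsAdmissible Q ϑ J H) {q q' : E}
    (hseg : segment ℝ q q' ⊆ Q) :
    HasFDerivAt (fun p : E × E => ∫ t in (0 : ℝ)..1, ϑ (p.1 + t • (p.2 - p.1)) (p.2 - p.1))
      ((ϑ q' + omegaAvg₁ ϑ q (q' - q) (q' - q)).comp (ContinuousLinearMap.snd ℝ E E) -
        (ϑ q - omegaAvg₀ ϑ q (q' - q) (q' - q)).comp (ContinuousLinearMap.fst ℝ E E)) (q, q') := by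
  set ξ := q' - q with hξ
  have hmem : ∀ t ∈ Icc (0 : ℝ) 1, q + t • ξ ∈ Q := fun t ht =>
    hseg (segment_eq_image' ℝ q q' ▸ mem_image_of_mem _ ht)
  have hpt : ∀ t : ℝ, ContDiffAt ℝ ∞ (fun z : ℝ × (E × E) => z.2.1 + z.1 • (z.2.2 - z.2.1))
      (t, (q, q')) := fun t => by fun_prop
  have hsm : ∀ t ∈ Icc (0 : ℝ) 1, ContDiffAt ℝ 1
      (fun z : ℝ × (E × E) => ϑ (z.2.1 + z.1 • (z.2.2 - z.2.1)) (z.2.2 - z.2.1)) (t, (q, q')) := by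
    intro t ht
    have h1 := ContDiffAt.comp (g := ϑ) (t, (q, q')) (h.contDiffAt_theta (hmem t ht)) (hpt t)
    have h2 : ContDiffAt ℝ ∞ (fun z : ℝ × (E × E) => z.2.2 - z.2.1) (t, (q, q')) := by fun_prop
    exact (h1.clm_apply h2).of_le (by simp)
  refine (hasFDerivAt_integral_Icc hsm).congr_fderiv ?_
  have hcω : ContinuousOn (fun t : ℝ => omega ϑ (q + t • ξ)) (uIcc 0 1) :=
    continuousOn_comp_segment fun t ht => (h.contDiffAt_omega (hmem t ht)).continuousAt
  have hcθ : ContinuousOn (fun t : ℝ => ϑ (q + t • ξ)) (uIcc 0 1) :=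
    continuousOn_comp_segment fun t ht => (h.contDiffAt_theta (hmem t ht)).continuousAt
  have hcd : ContinuousOn (fun t : ℝ => fderiv ℝ ϑ (q + t • ξ)) (uIcc 0 1) :=
    continuousOn_comp_segment fun t ht =>
      ((h.contDiffAt_theta (hmem t ht)).fderiv_right (m := 0) (by simp)).continuousAt
  have hcA : ContinuousOn (fun t : ℝ => (fderiv ℝ (fun z : ℝ × (E × E) =>
      ϑ (z.2.1 + z.1 • (z.2.2 - z.2.1)) (z.2.2 - z.2.1)) (t, (q, q'))).comp
        (ContinuousLinearMap.inr ℝ ℝ (E × E))) (uIcc 0 1) := by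
    intro t ht
    rw [uIcc_of_le zero_le_one] at ht
    have h1 : ContinuousAt (fun t : ℝ => fderiv ℝ (fun z : ℝ × (E × E) =>
      ϑ (z.2.1 + z.1 • (z.2.2 - z.2.1)) (z.2.2 - z.2.1)) (t, (q, q'))) t :=
      ContinuousAt.comp (f := fun t : ℝ => (t, (q, q')))
        ((hsm t ht).fderiv_right (m := 0) (by simp)).continuousAt (by fun_prop)
    exact (h1.clm_comp continuousAt_const).continuousWithinAt
  refine ContinuousLinearMap.ext fun d => ?_
  have hδ : Continuous fun t : ℝ => d.1 + t • (d.2 - d.1) := by fun_prop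
  have hi1 : ContinuousOn (fun t : ℝ => fderiv ℝ ϑ (q + t • ξ) ξ (d.1 + t • (d.2 - d.1)) +
      ϑ (q + t • ξ) (d.2 - d.1)) (uIcc 0 1) :=
    ((hcd.clm_apply continuousOn_const).clm_apply hδ.continuousOn).add
      (hcθ.clm_apply continuousOn_const)
  have hi2 : ContinuousOn (fun t : ℝ => (1 - t) • omega ϑ (q + t • ξ)) (uIcc 0 1) :=
    (continuous_const.sub continuous_id).continuousOn.smul hcω
  have hi3 : ContinuousOn (fun t : ℝ => t • omega ϑ (q + t • ξ)) (uIcc 0 1) :=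
    continuous_id.continuousOn.smul hcω
  have hftc := h.integral_theta_deriv hmem d.1 d.2 hi1
  rw [show q + ξ = q' by simp [hξ]] at hftc
  have hK0 : omegaAvg₀ ϑ q ξ ξ d.1 =
      ∫ t in (0 : ℝ)..1, (1 - t) * omega ϑ (q + t • ξ) ξ d.1 := by
    rw [omegaAvg₀, ContinuousLinearMap.intervalIntegral_apply hi2.intervalIntegrable,
      ContinuousLinearMap.intervalIntegral_apply
        (hi2.clm_apply continuousOn_const).intervalIntegrable]
    simp
  have hK1 : omegaAvg₁ ϑ q ξ ξ d.2 =
      ∫ t in (0 : ℝ)..1, t * omega ϑ (q + t • ξ) ξ d.2 := by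
    rw [omegaAvg₁, ContinuousLinearMap.intervalIntegral_apply hi3.intervalIntegrable,
      ContinuousLinearMap.intervalIntegral_apply
        (hi3.clm_apply continuousOn_const).intervalIntegrable]
    simp
  have hi4 : ContinuousOn (fun t : ℝ => (1 - t) * omega ϑ (q + t • ξ) ξ d.1) (uIcc 0 1) := by
    simpa using (hi2.clm_apply continuousOn_const).clm_apply (continuousOn_const (c := d.1))
  have hi5 : ContinuousOn (fun t : ℝ => t * omega ϑ (q + t • ξ) ξ d.2) (uIcc 0 1) := by
    simpa using (hi3.clm_apply continuousOn_const).clm_apply (continuousOn_const (c := d.2))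
  rw [ContinuousLinearMap.intervalIntegral_apply hcA.intervalIntegrable]
  simp only [sub_apply, ContinuousLinearMap.comp_apply, ContinuousLinearMap.coe_snd',
    ContinuousLinearMap.coe_fst', add_apply]
  -- With `d` and `e` the variations of the two endpoints, the derivative of the line integral
  -- exceeds the boundary terms by the integral of `ω(ξ, (1 - t) d + t e)`, which splits into the
  -- two weighted averages.
  rw [hK0, hK1, show ∀ a b c e : ℝ, a + b - (c - e) = (a - c) + e + b by intros; ring, ← hftc,
    ← intervalIntegral.integral_add hi1.intervalIntegrable hi4.intervalIntegrable,
    ← intervalIntegral.integral_add (hi1.fun_add hi4).intervalIntegrable hi5.intervalIntegrable]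
  refine intervalIntegral.integral_congr fun t ht => ?_
  rw [uIcc_of_le zero_le_one] at ht
  have h1 := h.fderiv_theta_segment (hmem t ht) (hsm t ht) d
  simp only [ContinuousLinearMap.comp_apply] at h1
  rw [h1, ← hξ]
  simp only [omega, sub_apply, ContinuousLinearMap.flip_apply, map_add, map_smul, map_sub,
    add_apply, smul_apply, smul_eq_mul]
  ring

variable [FiniteDimensional ℝ E]

theorem _root_.SymplecticLorentz.isInvertible_of_injective (B : E →L[ℝ] E →L[ℝ] ℝ)
    (hB : ∀ v, B v = 0 → v = 0) : B.IsInvertible := by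
  have hinj : Function.Injective (B : E →ₗ[ℝ] (E →L[ℝ] ℝ)) := by
    rw [injective_iff_map_eq_zero]
    exact hB
  have hfin : Module.finrank ℝ E = Module.finrank ℝ (E →L[ℝ] ℝ) := by
    rw [← LinearEquiv.finrank_eq (LinearMap.toContinuousLinearMap (𝕜 := ℝ) (E := E) (F' := ℝ))]
    exact (Subspace.dual_finrank_eq).symm
  exact ⟨(LinearEquiv.ofInjectiveOfFinrankEq _ hinj hfin).toContinuousLinearEquiv, by ext; rfl⟩

theorem isInvertible_omega (h : IsAdmissible Q ϑ J H) {q : E} (hq : q ∈ Q) :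
    (omega ϑ q).IsInvertible :=
  isInvertible_of_injective _ fun v hv => h.symplectic.nondegenerate q hq v fun w => by simp [hv]

theorem isInvertible_metricL (h : IsAdmissible Q ϑ J H) {q : E} (hq : q ∈ Q) :
    (metricL ϑ J q).IsInvertible :=
  isInvertible_of_injective _ (h.injective_metricL hq)

/-- Pairing with `J v` gives `ω(v, J v) = g(v, v)`, while `g(v, J v) = 0`; so the sum is
nondegenerate for every `κ`. This makes the backward relation solvable for the displacement. -/
theorem isInvertible_omega_add (h : IsAdmissible Q ϑ J H) {q : E} (hq : q ∈ Q) (κ : ℝ) :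
    (omega ϑ q + κ • metricL ϑ J q).IsInvertible := by
  refine isInvertible_of_injective _ fun v hv => ?_
  by_contra hne
  have h1 := h.compatible.pos q hq v hne
  have h2 := congrArg (fun f : E →L[ℝ] ℝ => f (J q v)) hv
  have h3 : metricL ϑ J q v (J q v) = 0 := by
    rw [metricL_apply, metric, h.compatible.sq_eq_neg q hq, map_neg, omega_self, neg_zero]
  simp only [add_apply, smul_apply, h3, smul_zero, add_zero, zero_apply] at h2
  rw [metric, h2] at h1
  exact lt_irrefl _ h1

theorem contDiffAt_hamVF (h : IsAdmissible Q ϑ J H) {q : E} (hq : q ∈ Q) :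
    ContDiffAt ℝ ∞ (hamVF ϑ H) q := by
  have h1 : ContDiffAt ℝ ∞ (fun q => (omega ϑ q).inverse) q :=
    (h.isInvertible_omega hq).contDiffAt_map_inverse.comp q (h.contDiffAt_omega hq)
  exact h1.clm_apply ((h.contDiffAt_H hq).fderiv_right (by simp))

theorem omega_hamVF (h : IsAdmissible Q ϑ J H) {q : E} (hq : q ∈ Q) :
    omega ϑ q (hamVF ϑ H q) = fderiv ℝ H q := by
  ext w
  exact (eq_hamVF_iff ϑ H q _ (h.symplectic.nondegenerate q hq)).1 rfl w

theorem contDiffAt_linPart (h : IsAdmissible Q ϑ J H) {q : E} (hq : q ∈ Q) :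
    ContDiffAt ℝ ∞ (linPart ϑ J H) q := by
  have h1 := h.contDiffAt_hamVF hq
  have h2 : ContDiffAt ℝ ∞ (fderiv ℝ (omega ϑ)) q :=
    (h.contDiffAt_omega hq).fderiv_right (by simp)
  exact ((h.contDiffAt_metricL hq).clm_apply h1).sub
    (ContDiffAt.const_smul (1 / 12 : ℝ) ((h2.clm_apply h1).clm_apply h1))

theorem hasFDerivAt_genSigma (h : IsAdmissible Q ϑ J H) (θ₀ ħ : ℝ) {x : E} (hx : x ∈ Q) (ξ : E) :
    HasFDerivAt (fun p : E × E => genSigma ϑ J H θ₀ ħ p.1 p.2)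
      ((sigmaX ϑ J H (Real.sin θ₀ / (1 - Real.cos θ₀)) ħ x ξ).comp (ContinuousLinearMap.fst ℝ E E) +
        (sigmaXi ϑ J H (Real.sin θ₀ / (1 - Real.cos θ₀)) ħ x ξ).comp
          (ContinuousLinearMap.snd ℝ E E)) (x, ξ) := by
  set κ := Real.sin θ₀ / (1 - Real.cos θ₀)
  have hf : HasFDerivAt (fun p : E × E => p.1) (ContinuousLinearMap.fst ℝ E E) (x, ξ) :=
    hasFDerivAt_fst
  have hs : HasFDerivAt (fun p : E × E => p.2) (ContinuousLinearMap.snd ℝ E E) (x, ξ) :=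
    hasFDerivAt_snd
  have hH : HasFDerivAt (fun p : E × E => H p.1) _ (x, ξ) :=
    HasFDerivAt.comp (g := H) (x, ξ) ((h.contDiffAt_H hx).differentiableAt (by simp)).hasFDerivAt hf
  have hX : HasFDerivAt (fun p : E × E => hamVF ϑ H p.1) _ (x, ξ) :=
    HasFDerivAt.comp (g := hamVF ϑ H) (x, ξ) ((h.contDiffAt_hamVF hx).differentiableAt (by simp)).hasFDerivAt hf
  have hA : HasFDerivAt (fun p : E × E => linPart ϑ J H p.1) _ (x, ξ) :=
    HasFDerivAt.comp (g := linPart ϑ J H) (x, ξ) ((h.contDiffAt_linPart hx).differentiableAt (by simp)).hasFDerivAt hf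
  have hG : HasFDerivAt (fun p : E × E => metricL ϑ J p.1) _ (x, ξ) :=
    HasFDerivAt.comp (g := metricL ϑ J) (x, ξ) ((h.contDiffAt_metricL hx).differentiableAt (by simp)).hasFDerivAt hf
  have hδ := hs.fun_sub (hX.const_smul ħ)
  have := ((hH.const_mul (-ħ)).fun_add ((hA.clm_apply hs).const_mul (ħ ^ 2))).fun_sub
    (((hG.clm_apply hδ).clm_apply hδ).const_mul ((1 / 4) * κ))
  simp only [genSigma_eq]
  refine this.congr_fderiv ?_
  ext w
  · simp [sigmaX, sigmaXi, sigmaRem, ContinuousLinearMap.flip_apply]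
    have := h.metricL_symm hx
    simp only [this (fderiv ℝ (hamVF ϑ H) x w) _]
    ring
  · simp [sigmaX, sigmaXi, sigmaRem, ContinuousLinearMap.flip_apply]
    have := h.metricL_symm hx
    simp only [this w _]
    ring

/-- The derivative of the generating function. -/
theorem hasFDerivAt_genS (h : IsAdmissible Q ϑ J H) (θ₀ ħ : ℝ) {q q' : E}
    (hseg : segment ℝ q q' ⊆ Q) :
    HasFDerivAt (fun p : E × E => genS ϑ J H θ₀ ħ p.1 p.2)
      ((ϑ q' + fwdForm ϑ J H (Real.sin θ₀ / (1 - Real.cos θ₀)) ħ q (q' - q)).comp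
          (ContinuousLinearMap.snd ℝ E E) -
        (ϑ q + backForm ϑ J H (Real.sin θ₀ / (1 - Real.cos θ₀)) ħ q (q' - q)).comp
          (ContinuousLinearMap.fst ℝ E E)) (q, q') := by
  set κ := Real.sin θ₀ / (1 - Real.cos θ₀) with hκ
  have hx : (1 / 2 : ℝ) • (q + q') ∈ Q := by
    refine hseg ⟨1 / 2, 1 / 2, by norm_num, by norm_num, by norm_num, ?_⟩
    rw [smul_add]
  have hx' : (1 / 2 : ℝ) • (q + q') = q + (1 / 2 : ℝ) • (q' - q) := by module
  have h1 := h.hasFDerivAt_integral_theta hseg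
  have h2 := h.hasFDerivAt_genSigma θ₀ ħ hx (q' - q)
  have h3 : HasFDerivAt (fun p : E × E => ((1 / 2 : ℝ) • (p.1 + p.2), p.2 - p.1))
      (((1 / 2 : ℝ) • (ContinuousLinearMap.fst ℝ E E + ContinuousLinearMap.snd ℝ E E)).prod
        (ContinuousLinearMap.snd ℝ E E - ContinuousLinearMap.fst ℝ E E)) (q, q') :=
    ((hasFDerivAt_fst.fun_add hasFDerivAt_snd).const_smul (1 / 2 : ℝ)).prodMk
      (hasFDerivAt_snd.fun_sub hasFDerivAt_fst)
  have h4 := h1.fun_add (HasFDerivAt.comp (g := fun p : E × E => genSigma ϑ J H θ₀ ħ p.1 p.2)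
    (q, q') h2 h3)
  refine h4.congr_fderiv ?_
  rw [hx', ← hκ, fwdForm, backForm]
  refine ContinuousLinearMap.ext fun d => ?_
  simp
  ring

theorem fderiv_genS_right (h : IsAdmissible Q ϑ J H) (θ₀ ħ : ℝ) {q q' : E}
    (hseg : segment ℝ q q' ⊆ Q) (w : E) :
    fderiv ℝ (fun y => genS ϑ J H θ₀ ħ q y) q' w =
      ϑ q' w + fwdForm ϑ J H (Real.sin θ₀ / (1 - Real.cos θ₀)) ħ q (q' - q) w := by
  have := HasFDerivAt.comp (f := fun y => (q, y)) q' (h.hasFDerivAt_genS θ₀ ħ hseg)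
    (hasFDerivAt_prodMk_right q q')
  have h2 := congrArg (fun f : E →L[ℝ] ℝ => f w) this.fderiv
  simpa [Function.comp_def] using h2

theorem fderiv_genS_left (h : IsAdmissible Q ϑ J H) (θ₀ ħ : ℝ) {q q' : E}
    (hseg : segment ℝ q q' ⊆ Q) (w : E) :
    fderiv ℝ (fun y => genS ϑ J H θ₀ ħ y q') q w =
      -(ϑ q w + backForm ϑ J H (Real.sin θ₀ / (1 - Real.cos θ₀)) ħ q (q' - q) w) := by
  have := HasFDerivAt.comp (f := fun y => (y, q')) q (h.hasFDerivAt_genS θ₀ ħ hseg)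
    (hasFDerivAt_prodMk_left q q')
  have h2 := congrArg (fun f : E →L[ℝ] ℝ => f w) this.fderiv
  simpa [Function.comp_def] using h2

/-- The implicit relations in terms of the forms `backForm` and `fwdForm`. -/
theorem relations_iff (h : IsAdmissible Q ϑ J H) (θ₀ ħ : ℝ) (p p' : E × E) :
    Relations Q ϑ J H θ₀ ħ p p' ↔ segment ℝ p.1 p'.1 ⊆ Q ∧
      ħ ^ 2 • metricL ϑ J p'.1 p'.2 =
        fwdForm ϑ J H (Real.sin θ₀ / (1 - Real.cos θ₀)) ħ p.1 (p'.1 - p.1) ∧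
      ħ ^ 2 • metricL ϑ J p.1 p.2 =
        backForm ϑ J H (Real.sin θ₀ / (1 - Real.cos θ₀)) ħ p.1 (p'.1 - p.1) := by
  constructor
  · rintro ⟨h1, h2, h3⟩
    refine ⟨h1, ContinuousLinearMap.ext fun w => ?_, ContinuousLinearMap.ext fun w => ?_⟩
    · have := h2 w
      rw [h.fderiv_genS_right θ₀ ħ h1] at this
      simpa [metricL_apply] using this
    · have := h3 w
      rw [h.fderiv_genS_left θ₀ ħ h1] at this
      simpa [metricL_apply] using this
  · rintro ⟨h1, h2, h3⟩
    refine ⟨h1, fun w => ?_, fun w => ?_⟩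
    · rw [h.fderiv_genS_right θ₀ ħ h1, ← h2]
      simp [metricL_apply]
    · rw [h.fderiv_genS_left θ₀ ħ h1, ← h3]
      simp [metricL_apply]

end IsAdmissible

end GeneratingFunction

end SymplecticLorentz

namespace SymplecticLorentz

open Filter Asymptotics

/-! ### Taylor estimates, and averages of ω along short segments. -/

section Expansion

set_option maxSynthPendingDepth 3

universe u

variable {E : Type u} [NormedAddCommGroup E] [NormedSpace ℝ E]

theorem isBigO_sub_of_contDiffAt {F G ι : Type*} [NormedAddCommGroup F] [NormedSpace ℝ F]
    [NormedAddCommGroup G] [NormedSpace ℝ G] {f : F → G} {a : F} (hf : ContDiffAt ℝ 1 f a)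
    {l : Filter ι} {x y : ι → F} (hx : Tendsto x l (𝓝 a)) (hy : Tendsto y l (𝓝 a)) :
    (fun b => f (x b) - f (y b)) =O[l] fun b => x b - y b :=
  (hf.hasStrictFDerivAt one_ne_zero).isBigO_sub.comp_tendsto (hx.prodMk_nhds hy)

/-- Taylor's formula of order two, uniformly in the base point. -/
theorem isBigO_taylor {V F : Type u} [NormedAddCommGroup V] [NormedSpace ℝ V]
    [NormedAddCommGroup F] [NormedSpace ℝ F] [CompleteSpace F] {f : V → F} {a : V}
    (hf : ContDiffAt ℝ ∞ f a) :
    (fun z : V × V => f z.2 - f z.1 - fderiv ℝ f z.1 (z.2 - z.1)) =O[𝓝 (a, a)]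
      fun z => ‖z.2 - z.1‖ ^ 2 := by
  obtain ⟨h, h1, h2, h3⟩ := exists_hadamard hf
  have hz : Tendsto (fun z : V × V => z) (𝓝 (a, a)) (𝓝 (a, a)) := tendsto_id
  have hd : Tendsto (fun z : V × V => (z.1, z.1)) (𝓝 (a, a)) (𝓝 (a, a)) := by
    have : Continuous fun z : V × V => (z.1, z.1) := by fun_prop
    exact this.tendsto (a, a)
  have h4 := isBigO_sub_of_contDiffAt (h1.of_le (by simp)) hz hd
  have h5 : (fun z : V × V => z - (z.1, z.1)) =O[𝓝 (a, a)] fun z => ‖z.2 - z.1‖ := by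
    refine IsBigO.of_bound 1 (Eventually.of_forall fun z => ?_)
    simp [Prod.norm_def]
  have h6 : (fun z : V × V => z.2 - z.1) =O[𝓝 (a, a)] fun z => ‖z.2 - z.1‖ :=
    (isBigO_refl _ _).norm_right
  refine (isBigO_clm_apply (h4.trans h5) h6).congr' ?_ ?_
  · filter_upwards [h3] with z hz
    rw [hz, ← h2]
    simp
  · exact Eventually.of_forall fun z => by simp [sq]

theorem hasFDerivAt_of_isBigO_sq {V F : Type*} [NormedAddCommGroup V] [NormedSpace ℝ V]
    [NormedAddCommGroup F] [NormedSpace ℝ F] {f : V → F} {L : V →L[ℝ] F} (h0 : f 0 = 0)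
    (h : (fun x => f x - L x) =O[𝓝 0] fun x => ‖x‖ ^ 2) : HasFDerivAt f L 0 := by
  rw [hasFDerivAt_iff_isLittleO]
  have h1 : (fun x : V => ‖x‖ ^ 2) =o[𝓝 0] fun x => x := isLittleO_norm_pow_id one_lt_two
  simpa [h0] using h.trans_isLittleO h1

/-- Division by the parameter, for continuous functions. -/
theorem isBigO_of_smul_isBigO {V F : Type*} [NormedAddCommGroup V] [NormedSpace ℝ V]
    [NormedAddCommGroup F] [NormedSpace ℝ F] {g : ℝ × V → F} {a : V} {n : ℕ}
    (hg : ∀ᶠ z in 𝓝 ((0 : ℝ), a), ContinuousAt g z)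
    (h : (fun z : ℝ × V => z.1 • g z) =O[𝓝 (0, a)] fun z => z.1 ^ (n + 1)) :
    g =O[𝓝 (0, a)] fun z => z.1 ^ n := by
  obtain ⟨C, hC⟩ := h.bound
  refine IsBigO.of_bound C ?_
  filter_upwards [hg, hC.eventually_nhds] with z hz hz'
  have key : ∀ z : ℝ × V, z.1 ≠ 0 → ‖z.1 • g z‖ ≤ C * ‖z.1 ^ (n + 1)‖ →
      ‖g z‖ ≤ C * ‖z.1 ^ n‖ := by
    intro z h0 h1
    rw [norm_smul, pow_succ, norm_mul] at h1
    have h2 : 0 < ‖z.1‖ := norm_pos_iff.2 h0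
    nlinarith
  -- Where the parameter vanishes one cannot divide; there the bound is the limit of the bounds
  -- along the line of nonzero parameters.
  by_cases h0 : z.1 = 0
  · have hcur : Tendsto (fun t : ℝ => ((t, z.2) : ℝ × V)) (𝓝[≠] 0) (𝓝 z) := by
      have : Continuous fun t : ℝ => ((t, z.2) : ℝ × V) := by fun_prop
      have h1 := this.tendsto 0
      rw [show ((0 : ℝ), z.2) = z from Prod.ext h0.symm rfl] at h1
      exact h1.mono_left nhdsWithin_le_nhds
    have h1 : Tendsto (fun t : ℝ => ‖g (t, z.2)‖) (𝓝[≠] 0) (𝓝 ‖g z‖) :=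
      (hz.tendsto.comp hcur).norm
    have h2 : Tendsto (fun t : ℝ => C * ‖t ^ n‖) (𝓝[≠] 0) (𝓝 (C * ‖z.1 ^ n‖)) := by
      have : Continuous fun t : ℝ => C * ‖t ^ n‖ := by fun_prop
      have h3 := this.tendsto 0
      rw [h0]
      exact h3.mono_left nhdsWithin_le_nhds
    refine le_of_tendsto_of_tendsto h1 h2 ?_
    filter_upwards [hcur.eventually hz', self_mem_nhdsWithin] with t ht ht0
    exact key (t, z.2) ht0 ht
  · exact key z h0 hz'.self_of_nhds

variable {Q : Set E} {ϑ : E → E →L[ℝ] ℝ} {J : E → E →L[ℝ] E} {H : E → ℝ}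

/-- Weighted averages of `ω` along a short segment. -/
theorem IsAdmissible.isBigO_omega_avg (h : IsAdmissible Q ϑ J H) {q₀ : E} (hq₀ : q₀ ∈ Q)
    {w : ℝ → ℝ} (hw : Continuous w) (hw1 : ∀ t ∈ Icc (0 : ℝ) 1, |w t| ≤ 1) :
    (fun y : E × E => (∫ t in (0 : ℝ)..1, w t • omega ϑ (y.1 + t • y.2)) -
      (∫ t in (0 : ℝ)..1, w t) • omega ϑ (y.1 + (1 / 2 : ℝ) • y.2) -
      (∫ t in (0 : ℝ)..1, w t * (t - 1 / 2)) •
        fderiv ℝ (omega ϑ) (y.1 + (1 / 2 : ℝ) • y.2) y.2) =O[𝓝 (q₀, 0)] fun y => ‖y.2‖ ^ 2 := by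
  obtain ⟨C, hC⟩ := (isBigO_taylor (h.contDiffAt_omega hq₀)).bound
  have hC0 : 0 ≤ |C| := abs_nonneg C
  -- Taylor's formula at the midpoint of the segment, uniformly in `t`; the linear term then carries
  -- the factor `t - 1 / 2`.
  have hev : ∀ᶠ y : E × E in 𝓝 (q₀, 0), ∀ t ∈ Icc (0 : ℝ) 1,
      ContDiffAt ℝ 1 (omega ϑ) (y.1 + t • y.2) ∧
      ‖omega ϑ (y.1 + t • y.2) - omega ϑ (y.1 + (1 / 2 : ℝ) • y.2) -
        fderiv ℝ (omega ϑ) (y.1 + (1 / 2 : ℝ) • y.2)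
          (y.1 + t • y.2 - (y.1 + (1 / 2 : ℝ) • y.2))‖ ≤
        C * ‖‖y.1 + t • y.2 - (y.1 + (1 / 2 : ℝ) • y.2)‖ ^ 2‖ := by
    refine eventually_forall_Icc (P := fun z : ℝ × (E × E) =>
      ContDiffAt ℝ 1 (omega ϑ) (z.2.1 + z.1 • z.2.2) ∧
      ‖omega ϑ (z.2.1 + z.1 • z.2.2) - omega ϑ (z.2.1 + (1 / 2 : ℝ) • z.2.2) -
        fderiv ℝ (omega ϑ) (z.2.1 + (1 / 2 : ℝ) • z.2.2)
          (z.2.1 + z.1 • z.2.2 - (z.2.1 + (1 / 2 : ℝ) • z.2.2))‖ ≤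
        C * ‖‖z.2.1 + z.1 • z.2.2 - (z.2.1 + (1 / 2 : ℝ) • z.2.2)‖ ^ 2‖) fun t _ => ?_
    have h1 : Continuous fun z : ℝ × (E × E) => z.2.1 + z.1 • z.2.2 := by fun_prop
    have h2 : Continuous fun z : ℝ × (E × E) => z.2.1 + (1 / 2 : ℝ) • z.2.2 := by fun_prop
    have h3 : Tendsto (fun z : ℝ × (E × E) => z.2.1 + z.1 • z.2.2) (𝓝 (t, (q₀, 0))) (𝓝 q₀) := by
      simpa using h1.tendsto (t, (q₀, 0))
    have h4 : Tendsto (fun z : ℝ × (E × E) => z.2.1 + (1 / 2 : ℝ) • z.2.2) (𝓝 (t, (q₀, 0)))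
        (𝓝 q₀) := by simpa using h2.tendsto (t, (q₀, 0))
    have h5 : ∀ᶠ x in 𝓝 q₀, ContDiffAt ℝ 1 (omega ϑ) x :=
      ((h.contDiffAt_omega hq₀).of_le (by simp) : ContDiffAt ℝ 1 _ _).eventually (by simp)
    exact (h3.eventually h5).and ((h4.prodMk_nhds h3).eventually hC)
  refine IsBigO.of_bound |C| ?_
  filter_upwards [hev] with y hy
  have hcω : ContinuousOn (fun t : ℝ => omega ϑ (y.1 + t • y.2)) (uIcc 0 1) :=
    IsAdmissible.continuousOn_comp_segment fun t ht => (hy t ht).1.continuousAt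
  have hi1 : IntervalIntegrable (fun t : ℝ => w t • omega ϑ (y.1 + t • y.2))
    MeasureTheory.volume 0 1 := (hw.continuousOn.smul hcω).intervalIntegrable
  have hi2 : IntervalIntegrable (fun t : ℝ => w t • omega ϑ (y.1 + (1 / 2 : ℝ) • y.2))
    MeasureTheory.volume 0 1 := (hw.smul continuous_const).intervalIntegrable _ _
  have hw' : Continuous fun t : ℝ => w t * (t - 1 / 2) := hw.mul (by fun_prop)
  have hi3 : IntervalIntegrable (fun t : ℝ => (w t * (t - 1 / 2)) •
      fderiv ℝ (omega ϑ) (y.1 + (1 / 2 : ℝ) • y.2) y.2)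
    MeasureTheory.volume 0 1 := (hw'.smul continuous_const).intervalIntegrable _ _
  rw [← intervalIntegral.integral_smul_const, ← intervalIntegral.integral_smul_const,
    ← intervalIntegral.integral_sub hi1 hi2, ← intervalIntegral.integral_sub (hi1.sub hi2) hi3]
  have := intervalIntegral.norm_integral_le_of_norm_le_const (a := (0 : ℝ)) (b := 1)
    (C := |C| * ‖‖y.2‖ ^ 2‖) (f := fun t => w t • omega ϑ (y.1 + t • y.2) -
      w t • omega ϑ (y.1 + (1 / 2 : ℝ) • y.2) -
      (w t * (t - 1 / 2)) • fderiv ℝ (omega ϑ) (y.1 + (1 / 2 : ℝ) • y.2) y.2) ?_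
  · simpa using this
  · intro t ht
    rw [uIoc_of_le zero_le_one] at ht
    have ht' : t ∈ Icc (0 : ℝ) 1 := ⟨ht.1.le, ht.2⟩
    have h1 := (hy t ht').2
    have h2 : y.1 + t • y.2 - (y.1 + (1 / 2 : ℝ) • y.2) = (t - 1 / 2) • y.2 := by module
    rw [h2, map_smul] at h1
    rw [show w t • omega ϑ (y.1 + t • y.2) - w t • omega ϑ (y.1 + (1 / 2 : ℝ) • y.2) -
      (w t * (t - 1 / 2)) • fderiv ℝ (omega ϑ) (y.1 + (1 / 2 : ℝ) • y.2) y.2 =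
      w t • (omega ϑ (y.1 + t • y.2) - omega ϑ (y.1 + (1 / 2 : ℝ) • y.2) -
        (t - 1 / 2) • fderiv ℝ (omega ϑ) (y.1 + (1 / 2 : ℝ) • y.2) y.2) by module, norm_smul]
    have h3 : ‖‖(t - 1 / 2) • y.2‖ ^ 2‖ ≤ ‖‖y.2‖ ^ 2‖ := by
      have h6 : ‖t - 1 / 2‖ ≤ 1 := by
        rw [Real.norm_eq_abs, abs_le]; constructor <;> linarith [ht.1, ht.2]
      have h7 : ‖(t - 1 / 2) • y.2‖ ≤ ‖y.2‖ := by
        rw [norm_smul]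
        exact mul_le_of_le_one_left (norm_nonneg _) h6
      simpa only [norm_pow, norm_norm] using pow_le_pow_left₀ (norm_nonneg _) h7 2
    have h4 : ‖w t‖ ≤ 1 := hw1 t ht'
    calc _ ≤ 1 * (C * ‖‖(t - 1 / 2) • y.2‖ ^ 2‖) :=
        mul_le_mul h4 h1 (norm_nonneg _) zero_le_one
      _ ≤ |C| * ‖‖y.2‖ ^ 2‖ := by
        rw [one_mul]
        exact mul_le_mul (le_abs_self C) h3 (norm_nonneg _) hC0

/-- The weight `1 - t` has integral `1 / 2` and first moment `-1 / 12` about the midpoint, which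
explains the coefficient `1 / 12` in `genSigma`. -/
theorem IsAdmissible.isBigO_omegaAvg₀ (h : IsAdmissible Q ϑ J H) {q₀ : E} (hq₀ : q₀ ∈ Q) :
    (fun y : E × E => omegaAvg₀ ϑ y.1 y.2 - (1 / 2 : ℝ) • omega ϑ (y.1 + (1 / 2 : ℝ) • y.2) +
      (1 / 12 : ℝ) • fderiv ℝ (omega ϑ) (y.1 + (1 / 2 : ℝ) • y.2) y.2) =O[𝓝 (q₀, 0)]
      fun y => ‖y.2‖ ^ 2 := by
  have h1 := h.isBigO_omega_avg hq₀ (w := fun t => 1 - t) (by fun_prop)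
    (fun t ht => abs_le.2 ⟨by linarith [ht.2], by linarith [ht.1]⟩)
  have e1 : ∫ t in (0 : ℝ)..1, (1 - t) = 1 / 2 := by
    rw [intervalIntegral.integral_sub (by simp) (by simp)]; norm_num
  have e2 : ∫ t in (0 : ℝ)..1, (1 - t) * (t - 1 / 2) = -(1 / 12) := by
    have : ∀ t : ℝ, (1 - t) * (t - 1 / 2) = (3 / 2) * t - 1 / 2 - t ^ 2 := fun t => by ring
    simp only [this]
    rw [intervalIntegral.integral_sub (Continuous.intervalIntegrable (by fun_prop) _ _)
      (Continuous.intervalIntegrable (by fun_prop) _ _),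
      intervalIntegral.integral_sub (Continuous.intervalIntegrable (by fun_prop) _ _) (by simp),
      intervalIntegral.integral_const_mul]
    norm_num
  rw [e1, e2] at h1
  refine h1.congr_left fun y => ?_
  rw [omegaAvg₀, neg_smul, sub_neg_eq_add]

theorem IsAdmissible.isBigO_omegaAvg₁ (h : IsAdmissible Q ϑ J H) {q₀ : E} (hq₀ : q₀ ∈ Q) :
    (fun y : E × E => omegaAvg₁ ϑ y.1 y.2 - (1 / 2 : ℝ) • omega ϑ (y.1 + (1 / 2 : ℝ) • y.2) -
      (1 / 12 : ℝ) • fderiv ℝ (omega ϑ) (y.1 + (1 / 2 : ℝ) • y.2) y.2) =O[𝓝 (q₀, 0)]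
      fun y => ‖y.2‖ ^ 2 := by
  have h1 := h.isBigO_omega_avg hq₀ (w := fun t => t) (by fun_prop)
    (fun t ht => abs_le.2 ⟨by linarith [ht.1], by linarith [ht.2]⟩)
  have e1 : ∫ t in (0 : ℝ)..1, t = 1 / 2 := by norm_num
  have e2 : ∫ t in (0 : ℝ)..1, t * (t - 1 / 2) = 1 / 12 := by
    have : ∀ t : ℝ, t * (t - 1 / 2) = t ^ 2 - (1 / 2) * t := fun t => by ring
    simp only [this]
    rw [intervalIntegral.integral_sub (Continuous.intervalIntegrable (by fun_prop) _ _)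
      (Continuous.intervalIntegrable (by fun_prop) _ _), intervalIntegral.integral_const_mul]
    norm_num
  rw [e1, e2] at h1
  exact h1

end Expansion

end SymplecticLorentz

namespace SymplecticLorentz

open Filter Asymptotics

/-! ### Principal parts of the backward and forward forms. -/

section FormExpansion

set_option maxSynthPendingDepth 3
set_option linter.unusedSectionVars false

universe u

variable {E : Type u} [NormedAddCommGroup E] [NormedSpace ℝ E] [FiniteDimensional ℝ E]
  {Q : Set E} {ϑ : E → E →L[ℝ] ℝ} {J : E → E →L[ℝ] E} {H : E → ℝ}

theorem isBigO_const_smul {F ι : Type*} [NormedAddCommGroup F] [NormedSpace ℝ F] {l : Filter ι}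
    {f : ι → F} {g : ι → ℝ} (c : ℝ) (hf : f =O[l] g) : (fun b => c • f b) =O[l] g :=
  hf.const_smul_left c

theorem isBigO_one_of_contDiffAt {F G ι : Type*} [NormedAddCommGroup F] [NormedSpace ℝ F]
    [NormedAddCommGroup G] [NormedSpace ℝ G] {f : F → G} {a : F} (hf : ContDiffAt ℝ ∞ f a)
    {l : Filter ι} {x : ι → F} (hx : Tendsto x l (𝓝 a)) :
    (fun b => f (x b)) =O[l] fun _ => (1 : ℝ) :=
  (hf.continuousAt.tendsto.comp hx).isBigO_one ℝ

namespace IsAdmissible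

variable {ι : Type*} {l : Filter ι} {ħ e : ι → ℝ} {q ξ : ι → E}

/-- The three terms have orders `3`, `2 n` and `n + 1`, whence the restriction `1 ≤ n ≤ 2`. -/
theorem isBigO_sigmaRem (h : IsAdmissible Q ϑ J H) {q₀ : E} (hq₀ : q₀ ∈ Q) (κ : ℝ)
    {x δ : ι → E} (he : Tendsto e l (𝓝 0)) (hx : Tendsto x l (𝓝 q₀)) (hħ : ħ =O[l] e)
    (hξ : ξ =O[l] e) {n : ℕ} (hn1 : 1 ≤ n) (hn2 : n ≤ 2) (hδ : δ =O[l] fun b => e b ^ n) :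
    (fun b => sigmaRem ϑ J H κ (ħ b) (x b) (ξ b) (δ b)) =O[l] fun b => e b ^ (n + 1) := by
  have hA : (fun b => (fderiv ℝ (linPart ϑ J H) (x b)).flip) =O[l] fun _ => (1 : ℝ) := by
    refine IsBigO.of_norm_left ?_
    simp only [ContinuousLinearMap.opNorm_flip]
    exact (isBigO_one_of_contDiffAt ((h.contDiffAt_linPart hq₀).fderiv_right (by simp))
      hx).norm_left
  have hG : (fun b => (fderiv ℝ (metricL ϑ J) (x b)).flip) =O[l] fun _ => (1 : ℝ) := by
    refine IsBigO.of_norm_left ?_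
    simp only [ContinuousLinearMap.opNorm_flip]
    exact (isBigO_one_of_contDiffAt ((h.contDiffAt_metricL hq₀).fderiv_right (by simp))
      hx).norm_left
  have hg := isBigO_one_of_contDiffAt (h.contDiffAt_metricL hq₀) hx
  have hX : (fun b => fderiv ℝ (hamVF ϑ H) (x b)) =O[l] fun _ => (1 : ℝ) :=
    isBigO_one_of_contDiffAt ((h.contDiffAt_hamVF hq₀).fderiv_right (by simp)) hx
  have t1 : (fun b => ħ b ^ 2 • (fderiv ℝ (linPart ϑ J H) (x b)).flip (ξ b)) =O[l]
      fun b => e b ^ (n + 1) := by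
    have := (hħ.pow 2).smul (isBigO_clm_apply hA hξ)
    refine (this.congr_right fun b => ?_).trans (isBigO_pow_of_le he (show n + 1 ≤ 3 by omega))
    simp; ring
  have t2 : (fun b => ((fderiv ℝ (metricL ϑ J) (x b)).flip (δ b)).flip (δ b)) =O[l]
      fun b => e b ^ (n + 1) := by
    have h1 : (fun b => ((fderiv ℝ (metricL ϑ J) (x b)).flip (δ b)).flip) =O[l]
        fun b => e b ^ n := by
      refine IsBigO.of_norm_left ?_
      simp only [ContinuousLinearMap.opNorm_flip]
      simpa using (isBigO_clm_apply hG hδ).norm_left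
    have := isBigO_clm_apply h1 hδ
    refine (this.congr_right fun b => ?_).trans
      (isBigO_pow_of_le he (show n + 1 ≤ n + n by omega))
    rw [pow_add]
  have t3 : (fun b => (2 * ħ b) • (metricL ϑ J (x b) (δ b)).comp (fderiv ℝ (hamVF ϑ H) (x b)))
      =O[l] fun b => e b ^ (n + 1) := by
    have h1 : (fun b => metricL ϑ J (x b) (δ b)) =O[l] fun b => e b ^ n := by
      simpa using isBigO_clm_apply hg hδ
    have h2 : (fun b => (metricL ϑ J (x b) (δ b)).comp (fderiv ℝ (hamVF ϑ H) (x b))) =O[l]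
        fun b => e b ^ n := by
      refine (IsBigO.of_bound 1 (Eventually.of_forall fun b => ?_)).trans
        (((h1.norm_left).mul hX.norm_left).congr_right fun b => mul_one _)
      rw [one_mul, Real.norm_of_nonneg (by positivity)]
      exact ContinuousLinearMap.opNorm_comp_le _ _
    refine ((hħ.const_mul_left 2).smul h2).congr_right fun b => ?_
    simp; ring
  simp only [sigmaRem]
  exact t1.sub (isBigO_const_smul (κ / 4) (t2.sub t3))

theorem isBigO_metricL_sub (h : IsAdmissible Q ϑ J H) {q₀ : E} (hq₀ : q₀ ∈ Q) {x y z : ι → E}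
    (hx : Tendsto x l (𝓝 q₀)) (hy : Tendsto y l (𝓝 q₀)) (hxy : (fun b => x b - y b) =O[l] e)
    {g : ι → ℝ} (hz : z =O[l] g) :
    (fun b => metricL ϑ J (x b) (z b) - metricL ϑ J (y b) (z b)) =O[l] fun b => e b * g b :=
  isBigO_clm_apply ((isBigO_sub_of_contDiffAt ((h.contDiffAt_metricL hq₀).of_le (by simp))
    hx hy).trans hxy) hz

theorem isBigO_omega_sub (h : IsAdmissible Q ϑ J H) {q₀ : E} (hq₀ : q₀ ∈ Q) {x y z : ι → E}
    (hx : Tendsto x l (𝓝 q₀)) (hy : Tendsto y l (𝓝 q₀)) (hxy : (fun b => x b - y b) =O[l] e)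
    {g : ι → ℝ} (hz : z =O[l] g) :
    (fun b => omega ϑ (x b) (z b) - omega ϑ (y b) (z b)) =O[l] fun b => e b * g b :=
  isBigO_clm_apply ((isBigO_sub_of_contDiffAt ((h.contDiffAt_omega hq₀).of_le (by simp))
    hx hy).trans hxy) hz

/-- The quadratic terms of `omegaAvg₀` and `linPart` cancel to the order of `ξ - ħ X`. -/
theorem isBigO_fderiv_omega_sub (h : IsAdmissible Q ϑ J H) {q₀ : E} (hq₀ : q₀ ∈ Q)
    {x : ι → E} (hx : Tendsto x l (𝓝 q₀)) (hħ : ħ =O[l] e) (hξ : ξ =O[l] e) {n : ℕ}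
    (hδ : (fun b => ξ b - ħ b • hamVF ϑ H (x b)) =O[l] fun b => e b ^ n) :
    (fun b => fderiv ℝ (omega ϑ) (x b) (ξ b) (ξ b) - ħ b ^ 2 •
      fderiv ℝ (omega ϑ) (x b) (hamVF ϑ H (x b)) (hamVF ϑ H (x b))) =O[l]
      fun b => e b ^ (n + 1) := by
  have hω : (fun b => fderiv ℝ (omega ϑ) (x b)) =O[l] fun _ => (1 : ℝ) :=
    isBigO_one_of_contDiffAt ((h.contDiffAt_omega hq₀).fderiv_right (by simp)) hx
  have hX := isBigO_one_of_contDiffAt (h.contDiffAt_hamVF hq₀) hx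
  have h1 := isBigO_clm_apply (isBigO_clm_apply hω hδ) hξ
  have h2 := isBigO_clm_apply (isBigO_clm_apply hω (hħ.smul hX)) hδ
  refine ((h1.congr_right (g₂ := fun b => e b ^ (n + 1)) fun b => ?_).add
    (h2.congr_right fun b => ?_)).congr_left fun b => ?_
  · ring
  · simp; ring
  · simp only [map_sub, map_smul, sub_apply, smul_apply]
    module

theorem tendsto_midpoint {q₀ : E} (he : Tendsto e l (𝓝 0)) (hq : Tendsto q l (𝓝 q₀))
    (hξ : ξ =O[l] e) : Tendsto (fun b => q b + (1 / 2 : ℝ) • ξ b) l (𝓝 q₀) := by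
  simpa using hq.add ((hξ.trans_tendsto he).const_smul (1 / 2 : ℝ))

/-- Since `dH = ω(X, ·)`, the terms `ω(ξ, ·) / 2` and `ħ dH / 2` combine into `ω(ξ - ħ X, ·) / 2`,
and the two `1 / 12` terms cancel to the required order. A bound on `ξ - ħ X` thus gives a remainder
one order smaller. -/
theorem isBigO_backForm (h : IsAdmissible Q ϑ J H) {q₀ : E} (hq₀ : q₀ ∈ Q) (κ : ℝ)
    (he : Tendsto e l (𝓝 0)) (hq : Tendsto q l (𝓝 q₀)) (hħ : ħ =O[l] e) (hξ : ξ =O[l] e) {n : ℕ}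
    (hn1 : 1 ≤ n) (hn2 : n ≤ 2)
    (hδ : (fun b => ξ b - ħ b • hamVF ϑ H (q b + (1 / 2 : ℝ) • ξ b)) =O[l] fun b => e b ^ n) :
    (fun b => backForm ϑ J H κ (ħ b) (q b) (ξ b) + (1 / 2 : ℝ) •
      (omega ϑ (q b + (1 / 2 : ℝ) • ξ b) + κ • metricL ϑ J (q b + (1 / 2 : ℝ) • ξ b))
        (ξ b - ħ b • hamVF ϑ H (q b + (1 / 2 : ℝ) • ξ b)) -
      ħ b ^ 2 • metricL ϑ J (q b + (1 / 2 : ℝ) • ξ b) (hamVF ϑ H (q b + (1 / 2 : ℝ) • ξ b)))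
      =O[l] fun b => e b ^ (n + 1) := by
  have hx := tendsto_midpoint he hq hξ
  have h1 := h.isBigO_sigmaRem hq₀ κ he hx hħ hξ hn1 hn2 hδ
  have h2 := h.isBigO_fderiv_omega_sub hq₀ hx hħ hξ hδ
  have h3 := (h.isBigO_omegaAvg₀ hq₀).comp_tendsto (hq.prodMk_nhds (hξ.trans_tendsto he))
  have h4 := (isBigO_clm_apply (h3.trans ((hξ.norm_left).pow 2)) hξ).trans
    ((isBigO_refl _ _).congr_right (g₂ := fun b => e b ^ 3) fun b => by ring)
  have h5 := h4.trans (isBigO_pow_of_le he (show n + 1 ≤ 3 by omega))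
  have hev : ∀ᶠ b in l, q b + (1 / 2 : ℝ) • ξ b ∈ Q := hx.eventually (h.isOpen.mem_nhds hq₀)
  refine ((h5.neg_left.add (isBigO_const_smul (-(1 / 2)) h1)).add
    (isBigO_const_smul (1 / 12) h2)).congr' ?_ EventuallyEq.rfl
  filter_upwards [hev] with b hb
  have hX := h.omega_hamVF hb
  simp only [Function.comp_apply, backForm, sigmaX, sigmaXi, linPart, ← hX, sub_apply, add_apply,
    smul_apply, map_sub, map_smul]
  module

/-- The same cancellations as for `backForm`, but now `ω` and `κ g` enter with opposite signs. -/
theorem isBigO_fwdForm (h : IsAdmissible Q ϑ J H) {q₀ : E} (hq₀ : q₀ ∈ Q) (κ : ℝ)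
    (he : Tendsto e l (𝓝 0)) (hq : Tendsto q l (𝓝 q₀)) (hħ : ħ =O[l] e) (hξ : ξ =O[l] e) {n : ℕ}
    (hn1 : 1 ≤ n) (hn2 : n ≤ 2)
    (hδ : (fun b => ξ b - ħ b • hamVF ϑ H (q b + (1 / 2 : ℝ) • ξ b)) =O[l] fun b => e b ^ n) :
    (fun b => fwdForm ϑ J H κ (ħ b) (q b) (ξ b) - (1 / 2 : ℝ) •
      (omega ϑ (q b + (1 / 2 : ℝ) • ξ b) - κ • metricL ϑ J (q b + (1 / 2 : ℝ) • ξ b))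
        (ξ b - ħ b • hamVF ϑ H (q b + (1 / 2 : ℝ) • ξ b)) -
      ħ b ^ 2 • metricL ϑ J (q b + (1 / 2 : ℝ) • ξ b) (hamVF ϑ H (q b + (1 / 2 : ℝ) • ξ b)))
      =O[l] fun b => e b ^ (n + 1) := by
  have hx := tendsto_midpoint he hq hξ
  have h1 := h.isBigO_sigmaRem hq₀ κ he hx hħ hξ hn1 hn2 hδ
  have h2 := h.isBigO_fderiv_omega_sub hq₀ hx hħ hξ hδ
  have h3 := (h.isBigO_omegaAvg₁ hq₀).comp_tendsto (hq.prodMk_nhds (hξ.trans_tendsto he))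
  have h4 := (isBigO_clm_apply (h3.trans ((hξ.norm_left).pow 2)) hξ).trans
    ((isBigO_refl _ _).congr_right (g₂ := fun b => e b ^ 3) fun b => by ring)
  have h5 := h4.trans (isBigO_pow_of_le he (show n + 1 ≤ 3 by omega))
  have hev : ∀ᶠ b in l, q b + (1 / 2 : ℝ) • ξ b ∈ Q := hx.eventually (h.isOpen.mem_nhds hq₀)
  refine ((h5.add (isBigO_const_smul (1 / 2) h1)).add
    (isBigO_const_smul (1 / 12) h2)).congr' ?_ EventuallyEq.rfl
  filter_upwards [hev] with b hb
  have hX := h.omega_hamVF hb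
  simp only [Function.comp_apply, fwdForm, sigmaX, sigmaXi, linPart, ← hX, sub_apply,
    smul_apply, map_sub, map_smul]
  module

end IsAdmissible

end FormExpansion

end SymplecticLorentz

namespace SymplecticLorentz

open Filter Asymptotics

/-! ### The displacement to third order and the rotation of the relative velocity. -/

section Displacement

set_option maxSynthPendingDepth 3
set_option linter.unusedSectionVars false

universe u

variable {E : Type u} [NormedAddCommGroup E] [NormedSpace ℝ E] [FiniteDimensional ℝ E]
  {Q : Set E} {ϑ : E → E →L[ℝ] ℝ} {J : E → E →L[ℝ] E} {H : E → ℝ}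

/-- The second order displacement `(1 - rot θ J) J u`. -/
noncomputable def shift (θ : ℝ) (J : E →L[ℝ] E) (u : E) : E :=
  (1 - Real.cos θ) • J u - Real.sin θ • u

theorem one_sub_cos_ne_zero {θ : ℝ} (hθ : Irrational (θ / (2 * Real.pi))) :
    1 - Real.cos θ ≠ 0 := by
  intro h0
  obtain ⟨n, hn⟩ := (Real.cos_eq_one_iff θ).1 (by linarith)
  refine hθ ⟨n, ?_⟩
  rw [← hn]
  field_simp [Real.pi_ne_zero]
  simp

namespace IsAdmissible

/-- As `ω = g(J ·, ·)`, this is `(J + κ) shift = -2 u`, which follows from `J² = -1` and `κ sin θ =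
1 + cos θ`. So `shift` is the displacement that the backward relation assigns to a relative velocity
`u`. -/
theorem omega_add_shift (h : IsAdmissible Q ϑ J H) {θ : ℝ} (hθ : 1 - Real.cos θ ≠ 0) {q : E}
    (hq : q ∈ Q) (u : E) :
    (omega ϑ q + (Real.sin θ / (1 - Real.cos θ)) • metricL ϑ J q) (shift θ (J q) u) =
      (-2 : ℝ) • metricL ϑ J q u := by
  have hω : ∀ v, omega ϑ q v = metricL ϑ J q (J q v) := fun v => by
    ext w; rw [h.metricL_J hq]
  rw [add_apply, smul_apply, hω, ← map_smul, ← map_smul, ← map_add]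
  congr 1
  simp only [shift, map_sub, map_smul, h.compatible.sq_eq_neg q hq]
  have h1 : Real.sin θ / (1 - Real.cos θ) * (1 - Real.cos θ) = Real.sin θ := by field_simp
  have h2 : Real.sin θ / (1 - Real.cos θ) * Real.sin θ = 1 + Real.cos θ := by
    rw [div_mul_eq_mul_div, div_eq_iff hθ]
    nlinarith [Real.sin_sq_add_cos_sq θ]
  rw [smul_sub, smul_smul, smul_smul, h1, h2]
  module

/-- Here `(J - κ) shift = 2 rot θ u`: for that displacement the forward relation returns the rotated
relative velocity. This is what the coefficient `sin θ / (1 - cos θ)` of the generating function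
achieves. -/
theorem omega_sub_shift (h : IsAdmissible Q ϑ J H) {θ : ℝ} (hθ : 1 - Real.cos θ ≠ 0) {q : E}
    (hq : q ∈ Q) (u : E) :
    (omega ϑ q - (Real.sin θ / (1 - Real.cos θ)) • metricL ϑ J q) (shift θ (J q) u) =
      (2 : ℝ) • metricL ϑ J q (rot θ (J q) u) := by
  have hω : ∀ v, omega ϑ q v = metricL ϑ J q (J q v) := fun v => by
    ext w; rw [h.metricL_J hq]
  rw [sub_apply, smul_apply, hω, ← map_smul, ← map_smul, ← map_sub]
  congr 1
  simp only [shift, map_sub, map_smul, h.compatible.sq_eq_neg q hq, rot_apply]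
  have h1 : Real.sin θ / (1 - Real.cos θ) * (1 - Real.cos θ) = Real.sin θ := by field_simp
  have h2 : Real.sin θ / (1 - Real.cos θ) * Real.sin θ = 1 + Real.cos θ := by
    rw [div_mul_eq_mul_div, div_eq_iff hθ]
    nlinarith [Real.sin_sq_add_cos_sq θ]
  rw [smul_sub, smul_smul, smul_smul, h1, h2]
  module

variable {ι : Type*} {l : Filter ι} {ħ : ι → ℝ} {q ξ u : ι → E}

/-- The inverse of `ω + κ g` depends smoothly on the base point, hence is locally bounded. -/
theorem isBigO_of_omega_add (h : IsAdmissible Q ϑ J H) {q₀ : E} (hq₀ : q₀ ∈ Q) (κ : ℝ)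
    {x z : ι → E} {g : ι → ℝ} (hx : Tendsto x l (𝓝 q₀))
    (hz : (fun b => (omega ϑ (x b) + κ • metricL ϑ J (x b)) (z b)) =O[l] g) : z =O[l] g := by
  have h1 : ContDiffAt ℝ ∞ (fun y => omega ϑ y + κ • metricL ϑ J y) q₀ :=
    (h.contDiffAt_omega hq₀).add ((h.contDiffAt_metricL hq₀).const_smul κ)
  have h2 : ContDiffAt ℝ ∞ (fun y => (omega ϑ y + κ • metricL ϑ J y).inverse) q₀ :=
    ContDiffAt.comp (g := ContinuousLinearMap.inverse)
      (f := fun y => omega ϑ y + κ • metricL ϑ J y) q₀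
      (h.isInvertible_omega_add hq₀ κ).contDiffAt_map_inverse h1
  have h3 := isBigO_clm_apply (isBigO_one_of_contDiffAt h2 hx) hz
  refine h3.congr' ?_ (Eventually.of_forall fun b => one_mul _)
  filter_upwards [hx.eventually (h.isOpen.mem_nhds hq₀)] with b hb
  exact ((h.isInvertible_omega_add hb κ).inverse_apply_eq).2 rfl

/-- The displacement and the forward form to third order. -/
theorem isBigO_displacement (h : IsAdmissible Q ϑ J H) {θ : ℝ} (hθ : 1 - Real.cos θ ≠ 0)
    {q₀ : E} (hq₀ : q₀ ∈ Q) (hħ : Tendsto ħ l (𝓝 0)) (hq : Tendsto q l (𝓝 q₀)) (hξ : ξ =O[l] ħ)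
    (hu : u =O[l] fun _ => (1 : ℝ))
    (hback : ∀ᶠ b in l, ħ b ^ 2 • metricL ϑ J (q b) (hamVF ϑ H (q b) + u b) =
      backForm ϑ J H (Real.sin θ / (1 - Real.cos θ)) (ħ b) (q b) (ξ b)) :
    ((fun b => ξ b - ħ b • hamVF ϑ H (q b + (1 / 2 : ℝ) • ξ b) -
      ħ b ^ 2 • shift θ (J (q b)) (u b)) =O[l] fun b => ħ b ^ 3) ∧
    (fun b => fwdForm ϑ J H (Real.sin θ / (1 - Real.cos θ)) (ħ b) (q b) (ξ b) - ħ b ^ 2 •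
      metricL ϑ J (q b) (hamVF ϑ H (q b) + rot θ (J (q b)) (u b))) =O[l] fun b => ħ b ^ 3 := by
  set κ := Real.sin θ / (1 - Real.cos θ) with hκ
  have hħ' : ħ =O[l] ħ := isBigO_refl _ _
  have hx := tendsto_midpoint hħ hq hξ
  set x : ι → E := fun b => q b + (1 / 2 : ℝ) • ξ b with hxd
  set δ : ι → E := fun b => ξ b - ħ b • hamVF ϑ H (x b) with hδd
  have hX := isBigO_one_of_contDiffAt (h.contDiffAt_hamVF hq₀) hx
  have hXq := isBigO_one_of_contDiffAt (h.contDiffAt_hamVF hq₀) hq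
  have hgx := isBigO_one_of_contDiffAt (h.contDiffAt_metricL hq₀) hx
  have hgq := isBigO_one_of_contDiffAt (h.contDiffAt_metricL hq₀) hq
  have hδ1 : δ =O[l] fun b => ħ b ^ 1 := by
    simp only [pow_one]
    exact hξ.sub (by simpa using hħ'.smul hX)
  have hsq : ∀ {F : Type u} [NormedAddCommGroup F] [NormedSpace ℝ F] {f : ι → F} (c : ℝ),
      f =O[l] (fun _ => (1 : ℝ)) → (fun b => (c * ħ b ^ 2) • f b) =O[l] fun b => ħ b ^ 2 := by
    intro F _ _ f c hf
    simpa using ((isBigO_refl (fun b => ħ b ^ 2) l).const_mul_left c).smul hf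
  -- Bootstrap: from `δ = O(ħ)` the backward relation gives `δ = O(ħ²)`, and the sharper expansion
  -- then available determines the `ħ²` term of `δ`.
  have B1 : (fun b => backForm ϑ J H κ (ħ b) (q b) (ξ b) + (1 / 2 : ℝ) •
      (omega ϑ (x b) + κ • metricL ϑ J (x b)) (δ b) -
      ħ b ^ 2 • metricL ϑ J (x b) (hamVF ϑ H (x b))) =O[l] fun b => ħ b ^ 2 :=
    h.isBigO_backForm hq₀ κ hħ hq hħ' hξ le_rfl one_le_two hδ1
  have hδ2 : δ =O[l] fun b => ħ b ^ 2 := by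
    refine h.isBigO_of_omega_add hq₀ κ hx ?_
    have h1 := hsq 2 (by simpa using isBigO_clm_apply hgq (hXq.add hu))
    have h2 := hsq 2 (by simpa using isBigO_clm_apply hgx hX)
    refine (((isBigO_const_smul 2 B1).sub h1).add h2).congr' ?_ EventuallyEq.rfl
    filter_upwards [hback] with b hb
    rw [← hb, map_add]
    module
  have B2 : (fun b => backForm ϑ J H κ (ħ b) (q b) (ξ b) + (1 / 2 : ℝ) •
      (omega ϑ (x b) + κ • metricL ϑ J (x b)) (δ b) -
      ħ b ^ 2 • metricL ϑ J (x b) (hamVF ϑ H (x b))) =O[l] fun b => ħ b ^ 3 :=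
    h.isBigO_backForm hq₀ κ hħ hq hħ' hξ one_le_two le_rfl hδ2
  have F2 : (fun b => fwdForm ϑ J H κ (ħ b) (q b) (ξ b) - (1 / 2 : ℝ) •
      (omega ϑ (x b) - κ • metricL ϑ J (x b)) (δ b) -
      ħ b ^ 2 • metricL ϑ J (x b) (hamVF ϑ H (x b))) =O[l] fun b => ħ b ^ 3 :=
    h.isBigO_fwdForm hq₀ κ hħ hq hħ' hξ one_le_two le_rfl hδ2
  have hxq : (fun b => x b - q b) =O[l] ħ := by
    simpa [hxd] using isBigO_const_smul (1 / 2) hξ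
  have hgX : (fun b => metricL ϑ J (x b) (hamVF ϑ H (x b)) -
      metricL ϑ J (q b) (hamVF ϑ H (q b))) =O[l] ħ :=
    (isBigO_sub_of_contDiffAt (f := fun y => metricL ϑ J y (hamVF ϑ H y))
      (((h.contDiffAt_metricL hq₀).clm_apply (h.contDiffAt_hamVF hq₀)).of_le (by simp))
      hx hq).trans hxq
  have hcube : ∀ {F : Type u} [NormedAddCommGroup F] [NormedSpace ℝ F] {f : ι → F} (c : ℝ),
      f =O[l] ħ → (fun b => (c * ħ b ^ 2) • f b) =O[l] fun b => ħ b ^ 3 := by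
    intro F _ _ f c hf
    refine (((isBigO_refl (fun b => ħ b ^ 2) l).const_mul_left c).smul hf).congr_right fun b => ?_
    simp; ring
  set w : ι → E := fun b => shift θ (J (q b)) (u b) with hwd
  have hw : w =O[l] fun _ => (1 : ℝ) := by
    have hJ := isBigO_one_of_contDiffAt (h.contDiffAt_J hq₀) hq
    have h1 : (fun b => J (q b) (u b)) =O[l] fun _ => (1 : ℝ) := by
      simpa using isBigO_clm_apply hJ hu
    exact (isBigO_const_smul _ h1).sub (isBigO_const_smul _ hu)
  have hωw := h.isBigO_omega_sub hq₀ hx hq hxq hw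
  have hgw := h.isBigO_metricL_sub hq₀ hx hq hxq hw
  simp only [mul_one] at hωw hgw
  have hqQ : ∀ᶠ b in l, q b ∈ Q := hq.eventually (h.isOpen.mem_nhds hq₀)
  have hδ3 : (fun b => δ b - ħ b ^ 2 • w b) =O[l] fun b => ħ b ^ 3 := by
    refine h.isBigO_of_omega_add hq₀ κ hx ?_
    refine (((isBigO_const_smul 2 B2).add (hcube 2 hgX)).sub
      (hcube 1 (hωw.add (isBigO_const_smul κ hgw)))).congr' ?_ EventuallyEq.rfl
    filter_upwards [hback, hqQ] with b hb hbQ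
    have h1 := h.omega_add_shift hθ hbQ (u b)
    rw [← hκ] at h1
    have h2 : metricL ϑ J (q b) (u b) = (-(1 / 2) : ℝ) • (omega ϑ (q b) + κ • metricL ϑ J (q b)) (w b) := by
      rw [h1]; module
    rw [← hb, map_add, h2]
    simp only [add_apply, smul_apply, map_sub, map_smul]
    module
  refine ⟨hδ3, ?_⟩
  have h1 : (fun b => (omega ϑ (x b) - κ • metricL ϑ J (x b)) (δ b - ħ b ^ 2 • w b)) =O[l]
      fun b => ħ b ^ 3 := by
    have hω := isBigO_one_of_contDiffAt (h.contDiffAt_omega hq₀) hx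
    simpa using isBigO_clm_apply (hω.sub (isBigO_const_smul κ hgx)) hδ3
  -- The second-order form of `δ` is inserted into the forward expansion, and the base point is
  -- moved from the midpoint to `q` at the cost of `O(ħ³)`.
  refine (((F2.add (isBigO_const_smul (1 / 2) h1)).add (hcube (1 / 2)
    (hωw.sub (isBigO_const_smul κ hgw)))).add (hcube 1 hgX)).congr' ?_ EventuallyEq.rfl
  filter_upwards [hqQ] with b hbQ
  have h1 := h.omega_sub_shift hθ hbQ (u b)
  rw [← hκ] at h1
  have h2 : metricL ϑ J (q b) (rot θ (J (q b)) (u b)) =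
      (1 / 2 : ℝ) • (omega ϑ (q b) - κ • metricL ϑ J (q b)) (w b) := by
    rw [h1]; module
  rw [map_add, h2]
  simp only [sub_apply, smul_apply, map_sub, map_smul]
  module

end IsAdmissible

end Displacement

end SymplecticLorentz

namespace SymplecticLorentz

open Filter Asymptotics

/-! ### The smooth local solution of the relations. -/

section LocalBranch

set_option maxSynthPendingDepth 3
set_option linter.unusedSectionVars false

universe u

variable {E : Type u} [NormedAddCommGroup E] [NormedSpace ℝ E]
  {Q : Set E} {ϑ : E → E →L[ℝ] ℝ} {J : E → E →L[ℝ] E} {H : E → ℝ}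

theorem contDiffAt_clm_flip {F G V W : Type*} [NormedAddCommGroup F] [NormedSpace ℝ F]
    [NormedAddCommGroup G] [NormedSpace ℝ G] [NormedAddCommGroup V] [NormedSpace ℝ V]
    [NormedAddCommGroup W] [NormedSpace ℝ W] {f : W → F →L[ℝ] G →L[ℝ] V} {a : W}
    (hf : ContDiffAt ℝ ∞ f a) : ContDiffAt ℝ ∞ (fun x => (f x).flip) a :=
  ContDiff.comp_contDiffAt (g := fun B : F →L[ℝ] G →L[ℝ] V => B.flip) a
    (ContinuousLinearMap.flipₗᵢ ℝ F G V).contDiff hf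

theorem contDiffAt_fderiv {F G : Type*} [NormedAddCommGroup F] [NormedSpace ℝ F]
    [NormedAddCommGroup G] [NormedSpace ℝ G] {f : F → G} {a : F} (hf : ContDiffAt ℝ ∞ f a) :
    ContDiffAt ℝ ∞ (fderiv ℝ f) a :=
  hf.fderiv_right (by simp)

theorem contDiffAt_comp_of_eq {F G V : Type*} [NormedAddCommGroup F] [NormedSpace ℝ F]
    [NormedAddCommGroup G] [NormedSpace ℝ G] [NormedAddCommGroup V] [NormedSpace ℝ V]
    {g : F → G} {f : V → F} {a : V} {b : F} (hg : ContDiffAt ℝ ∞ g b) (hf : ContDiffAt ℝ ∞ f a)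
    (hab : f a = b) : ContDiffAt ℝ ∞ (fun x => g (f x)) a := by
  subst hab
  exact ContDiffAt.comp (g := g) a hg hf

theorem eventually_eq_zero_of_isBigO {V F : Type*} [NormedAddCommGroup V] [NormedAddCommGroup F]
    {g : ℝ × V → F} {a : V} {n : ℕ} (hn : n ≠ 0)
    (h : g =O[𝓝 ((0 : ℝ), a)] fun z => z.1 ^ n) : ∀ᶠ p in 𝓝 a, g (0, p) = 0 := by
  obtain ⟨C, hC⟩ := h.bound
  have hcur : Tendsto (fun p : V => ((0 : ℝ), p)) (𝓝 a) (𝓝 (0, a)) :=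
    (Continuous.prodMk_right (0 : ℝ)).tendsto a
  filter_upwards [hcur.eventually hC] with p hp
  simpa [hn] using hp

namespace IsAdmissible

theorem contDiffAt_omega_avg (h : IsAdmissible Q ϑ J H) {q₀ : E} (hq₀ : q₀ ∈ Q)
    {w : ℝ → ℝ} (hw : ContDiff ℝ ∞ w) :
    ContDiffAt ℝ ∞ (fun y : E × E => ∫ t in (0 : ℝ)..1, w t • omega ϑ (y.1 + t • y.2))
      (q₀, 0) := by
  refine contDiffAt_integral_Icc (f := fun z : ℝ × (E × E) => w z.1 • omega ϑ (z.2.1 + z.1 • z.2.2))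
    fun t _ => ?_
  have h1 : ContDiffAt ℝ ∞ (fun z : ℝ × (E × E) => z.2.1 + z.1 • z.2.2) (t, (q₀, 0)) := by fun_prop
  have h2 : ContDiffAt ℝ ∞ (fun z : ℝ × (E × E) => omega ϑ (z.2.1 + z.1 • z.2.2)) (t, (q₀, 0)) :=
    contDiffAt_comp_of_eq (g := omega ϑ) (h.contDiffAt_omega hq₀) h1 (by simp)
  exact (hw.contDiffAt.comp _ contDiffAt_fst).smul h2

variable [FiniteDimensional ℝ E]

theorem contDiffAt_sigmaRem (h : IsAdmissible Q ϑ J H) {q₀ : E} (hq₀ : q₀ ∈ Q) (κ : ℝ)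
    {V : Type*} [NormedAddCommGroup V] [NormedSpace ℝ V] {a : V} {ħ : V → ℝ} {x ξ δ : V → E}
    (hħ : ContDiffAt ℝ ∞ ħ a) (hx : ContDiffAt ℝ ∞ x a) (hxa : x a = q₀)
    (hξ : ContDiffAt ℝ ∞ ξ a) (hδ : ContDiffAt ℝ ∞ δ a) :
    ContDiffAt ℝ ∞ (fun b => sigmaRem ϑ J H κ (ħ b) (x b) (ξ b) (δ b)) a := by
  subst hxa
  have h1 : ContDiffAt ℝ ∞ (fun b => (fderiv ℝ (linPart ϑ J H) (x b)).flip) a :=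
    contDiffAt_clm_flip (ContDiffAt.comp (g := fderiv ℝ (linPart ϑ J H)) a
      (contDiffAt_fderiv (h.contDiffAt_linPart hq₀)) hx)
  have h2 : ContDiffAt ℝ ∞ (fun b => (fderiv ℝ (metricL ϑ J) (x b)).flip) a :=
    contDiffAt_clm_flip (ContDiffAt.comp (g := fderiv ℝ (metricL ϑ J)) a
      (contDiffAt_fderiv (h.contDiffAt_metricL hq₀)) hx)
  have h3 : ContDiffAt ℝ ∞ (fun b => metricL ϑ J (x b)) a :=
    ContDiffAt.comp (g := metricL ϑ J) a (h.contDiffAt_metricL hq₀) hx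
  have h4 : ContDiffAt ℝ ∞ (fun b => fderiv ℝ (hamVF ϑ H) (x b)) a :=
    ContDiffAt.comp (g := fderiv ℝ (hamVF ϑ H)) a (contDiffAt_fderiv (h.contDiffAt_hamVF hq₀)) hx
  have h5 : ContDiffAt ℝ ∞ (fun b => ((fderiv ℝ (metricL ϑ J) (x b)).flip (δ b)).flip (δ b)) a :=
    (contDiffAt_clm_flip (h2.clm_apply hδ)).clm_apply hδ
  exact ((hħ.pow 2).smul (h1.clm_apply hξ)).sub
    ((h5.sub ((contDiffAt_const.mul hħ).smul ((h3.clm_apply hδ).clm_comp h4))).const_smul (κ / 4))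

theorem contDiffAt_sigmaX (h : IsAdmissible Q ϑ J H) {q₀ : E} (hq₀ : q₀ ∈ Q) (κ : ℝ)
    {V : Type*} [NormedAddCommGroup V] [NormedSpace ℝ V] {a : V} {ħ : V → ℝ} {x ξ : V → E}
    (hħ : ContDiffAt ℝ ∞ ħ a) (hx : ContDiffAt ℝ ∞ x a) (hxa : x a = q₀)
    (hξ : ContDiffAt ℝ ∞ ξ a) :
    ContDiffAt ℝ ∞ (fun b => sigmaX ϑ J H κ (ħ b) (x b) (ξ b)) a := by
  have h1 : ContDiffAt ℝ ∞ (fun b => hamVF ϑ H (x b)) a :=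
    contDiffAt_comp_of_eq (g := hamVF ϑ H) (h.contDiffAt_hamVF hq₀) hx hxa
  have h2 : ContDiffAt ℝ ∞ (fun b => fderiv ℝ H (x b)) a :=
    contDiffAt_comp_of_eq (g := fderiv ℝ H) (contDiffAt_fderiv (h.contDiffAt_H hq₀)) hx hxa
  exact (hħ.smul h2).neg.add
    (h.contDiffAt_sigmaRem hq₀ κ hħ hx hxa hξ (hξ.sub (hħ.smul h1)))

theorem contDiffAt_sigmaXi (h : IsAdmissible Q ϑ J H) {q₀ : E} (hq₀ : q₀ ∈ Q) (κ : ℝ)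
    {V : Type*} [NormedAddCommGroup V] [NormedSpace ℝ V] {a : V} {ħ : V → ℝ} {x ξ : V → E}
    (hħ : ContDiffAt ℝ ∞ ħ a) (hx : ContDiffAt ℝ ∞ x a) (hxa : x a = q₀)
    (hξ : ContDiffAt ℝ ∞ ξ a) :
    ContDiffAt ℝ ∞ (fun b => sigmaXi ϑ J H κ (ħ b) (x b) (ξ b)) a := by
  have h1 : ContDiffAt ℝ ∞ (fun b => hamVF ϑ H (x b)) a :=
    contDiffAt_comp_of_eq (g := hamVF ϑ H) (h.contDiffAt_hamVF hq₀) hx hxa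
  have h2 : ContDiffAt ℝ ∞ (fun b => linPart ϑ J H (x b)) a :=
    contDiffAt_comp_of_eq (g := linPart ϑ J H) (h.contDiffAt_linPart hq₀) hx hxa
  have h3 : ContDiffAt ℝ ∞ (fun b => metricL ϑ J (x b)) a :=
    contDiffAt_comp_of_eq (g := metricL ϑ J) (h.contDiffAt_metricL hq₀) hx hxa
  exact ((hħ.pow 2).smul h2).sub ((h3.clm_apply (hξ.sub (hħ.smul h1))).const_smul (κ / 2))

theorem contDiffAt_backForm (h : IsAdmissible Q ϑ J H) {q₀ : E} (hq₀ : q₀ ∈ Q) (κ : ℝ)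
    {V : Type*} [NormedAddCommGroup V] [NormedSpace ℝ V] {a : V} {ħ : V → ℝ} {q ξ : V → E}
    (hħ : ContDiffAt ℝ ∞ ħ a) (hq : ContDiffAt ℝ ∞ q a) (hqa : q a = q₀)
    (hξ : ContDiffAt ℝ ∞ ξ a) (hξa : ξ a = 0) :
    ContDiffAt ℝ ∞ (fun b => backForm ϑ J H κ (ħ b) (q b) (ξ b)) a := by
  have hx : ContDiffAt ℝ ∞ (fun b => q b + (1 / 2 : ℝ) • ξ b) a := hq.add (hξ.const_smul _)
  have hxa : q a + (1 / 2 : ℝ) • ξ a = q₀ := by simp [hqa, hξa]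
  have h1 : ContDiffAt ℝ ∞ (fun b => omegaAvg₀ ϑ (q b) (ξ b)) a :=
    contDiffAt_comp_of_eq (g := fun y : E × E => omegaAvg₀ ϑ y.1 y.2) (f := fun b => (q b, ξ b))
      (h.contDiffAt_omega_avg hq₀ (w := fun t => 1 - t) (by fun_prop)) (hq.prodMk hξ)
      (by simp [hqa, hξa])
  exact ((h1.clm_apply hξ).neg.sub
    ((h.contDiffAt_sigmaX hq₀ κ hħ hx hxa hξ).const_smul (1 / 2 : ℝ))).add
    (h.contDiffAt_sigmaXi hq₀ κ hħ hx hxa hξ)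

theorem contDiffAt_fwdForm (h : IsAdmissible Q ϑ J H) {q₀ : E} (hq₀ : q₀ ∈ Q) (κ : ℝ)
    {V : Type*} [NormedAddCommGroup V] [NormedSpace ℝ V] {a : V} {ħ : V → ℝ} {q ξ : V → E}
    (hħ : ContDiffAt ℝ ∞ ħ a) (hq : ContDiffAt ℝ ∞ q a) (hqa : q a = q₀)
    (hξ : ContDiffAt ℝ ∞ ξ a) (hξa : ξ a = 0) :
    ContDiffAt ℝ ∞ (fun b => fwdForm ϑ J H κ (ħ b) (q b) (ξ b)) a := by
  have hx : ContDiffAt ℝ ∞ (fun b => q b + (1 / 2 : ℝ) • ξ b) a := hq.add (hξ.const_smul _)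
  have hxa : q a + (1 / 2 : ℝ) • ξ a = q₀ := by simp [hqa, hξa]
  have h1 : ContDiffAt ℝ ∞ (fun b => omegaAvg₁ ϑ (q b) (ξ b)) a :=
    contDiffAt_comp_of_eq (g := fun y : E × E => omegaAvg₁ ϑ y.1 y.2) (f := fun b => (q b, ξ b))
      (h.contDiffAt_omega_avg hq₀ (w := fun t => t) (by fun_prop)) (hq.prodMk hξ)
      (by simp [hqa, hξa])
  exact ((h1.clm_apply hξ).add
    ((h.contDiffAt_sigmaX hq₀ κ hħ hx hxa hξ).const_smul (1 / 2 : ℝ))).add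
    (h.contDiffAt_sigmaXi hq₀ κ hħ hx hxa hξ)

theorem backForm_zero (κ : ℝ) (q : E) : backForm ϑ J H κ 0 q 0 = 0 := by
  simp [backForm, sigmaX, sigmaXi, sigmaRem]

/-- The expansion `isBigO_backForm` at `ħ = 0`, with `‖ξ‖` in the role of the small parameter. -/
theorem hasFDerivAt_backForm (h : IsAdmissible Q ϑ J H) {q₀ : E} (hq₀ : q₀ ∈ Q) (κ : ℝ) :
    HasFDerivAt (fun ξ => backForm ϑ J H κ 0 q₀ ξ)
      ((-(1 / 2) : ℝ) • (omega ϑ q₀ + κ • metricL ϑ J q₀)) 0 := by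
  refine hasFDerivAt_of_isBigO_sq (backForm_zero κ q₀) ?_
  have he : Tendsto (fun ξ : E => ‖ξ‖) (𝓝 0) (𝓝 0) := by simpa using tendsto_norm_zero
  have hξ : (fun ξ : E => ξ) =O[𝓝 0] fun ξ => ‖ξ‖ := (isBigO_refl _ _).norm_right
  have hq : Tendsto (fun _ : E => q₀) (𝓝 0) (𝓝 q₀) := tendsto_const_nhds
  have hx := tendsto_midpoint he hq hξ
  have hxq : (fun ξ : E => q₀ + (1 / 2 : ℝ) • ξ - q₀) =O[𝓝 0] fun ξ => ‖ξ‖ := by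
    simpa using isBigO_const_smul (1 / 2) hξ
  have h1 := h.isBigO_backForm hq₀ κ (ħ := fun _ => 0) he hq (isBigO_zero _ _) hξ le_rfl one_le_two
    (by simpa using hξ)
  have h2 := h.isBigO_omega_sub hq₀ hx hq hxq hξ
  have h3 := h.isBigO_metricL_sub hq₀ hx hq hxq hξ
  refine (h1.sub (isBigO_const_smul (1 / 2)
    ((h2.add (isBigO_const_smul κ h3)).congr_right fun ξ => (sq _).symm))).congr_left fun ξ => ?_
  simp only [zero_smul, sub_zero, add_apply, smul_apply, ne_eq, OfNat.ofNat_ne_zero,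
    not_false_eq_true, zero_pow]
  module

/-- The smooth local solution of the implicit relations. -/
theorem exists_localBranch (h : IsAdmissible Q ϑ J H) {θ : ℝ} (hθ : 1 - Real.cos θ ≠ 0)
    {p₀ : E × E} (hp₀ : p₀.1 ∈ Q) :
    ∃ F : ℝ × (E × E) → E × E, ContDiffAt ℝ ∞ F (0, p₀) ∧
      (∀ᶠ p in 𝓝 p₀, F (0, p) = (p.1, hamVF ϑ H p.1 + rot θ (J p.1) (p.2 - hamVF ϑ H p.1))) ∧
      (∀ᶠ z in 𝓝 ((0 : ℝ), p₀), Relations Q ϑ J H θ z.1 z.2 (F z)) ∧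
      (∀ᶠ y in 𝓝 (((0 : ℝ), p₀), p₀.1), y.1.1 ^ 2 • metricL ϑ J y.1.2.1 y.1.2.2 =
        backForm ϑ J H (Real.sin θ / (1 - Real.cos θ)) y.1.1 y.1.2.1 (y.2 - y.1.2.1) →
          y.2 = (F y.1).1) ∧
      (fun z : ℝ × (E × E) => (F z).1 - z.2.1 -
        z.1 • hamVF ϑ H (z.2.1 + (1 / 2 : ℝ) • ((F z).1 - z.2.1)) -
        z.1 ^ 2 • shift θ (J z.2.1) (z.2.2 - hamVF ϑ H z.2.1)) =O[𝓝 (0, p₀)]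
        fun z => z.1 ^ 3 := by
  have : CompleteSpace E := FiniteDimensional.complete ℝ E
  set κ := Real.sin θ / (1 - Real.cos θ) with hκ
  -- The backward relation is solved for the displacement by the implicit function theorem; its
  -- derivative in the displacement is `-(ω + κ g) / 2`.
  set f : (ℝ × (E × E)) × E → E →L[ℝ] ℝ := fun y =>
    backForm ϑ J H κ y.1.1 y.1.2.1 y.2 - y.1.1 ^ 2 • metricL ϑ J y.1.2.1 y.1.2.2 with hf
  have hfs : ContDiffAt ℝ ∞ f (((0 : ℝ), p₀), 0) := by
    have h1 : ContDiffAt ℝ ∞ (fun y : (ℝ × (E × E)) × E => metricL ϑ J y.1.2.1)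
        (((0 : ℝ), p₀), 0) :=
      contDiffAt_comp_of_eq (g := metricL ϑ J) (h.contDiffAt_metricL hp₀)
        (f := fun y : (ℝ × (E × E)) × E => y.1.2.1) (by fun_prop) rfl
    have h2 : ContDiffAt ℝ ∞ (fun y : (ℝ × (E × E)) × E => y.1.2.2) (((0 : ℝ), p₀), 0) := by
      fun_prop
    have h3 : ContDiffAt ℝ ∞ (fun y : (ℝ × (E × E)) × E => y.1.1 ^ 2) (((0 : ℝ), p₀), 0) := by
      fun_prop
    exact (h.contDiffAt_backForm hp₀ κ (ħ := fun y : (ℝ × (E × E)) × E => y.1.1)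
      (q := fun y => y.1.2.1) (ξ := fun y => y.2) (by fun_prop) (by fun_prop) rfl (by fun_prop)
      rfl).sub (h3.smul (h1.clm_apply h2))
  have hf0 : f (((0 : ℝ), p₀), 0) = 0 := by simp [hf, backForm_zero]
  have hder : (fderiv ℝ f (((0 : ℝ), p₀), 0)).comp (ContinuousLinearMap.inr ℝ (ℝ × (E × E)) E) =
      (-(1 / 2) : ℝ) • (omega ϑ p₀.1 + κ • metricL ϑ J p₀.1) := by
    have h1 := HasFDerivAt.comp (g := f) (f := fun ξ : E => (((0 : ℝ), p₀), ξ)) (0 : E)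
      (hfs.differentiableAt (by simp)).hasFDerivAt (hasFDerivAt_prodMk_right ((0 : ℝ), p₀) (0 : E))
    refine h1.unique ?_
    simpa [hf, Function.comp_def] using h.hasFDerivAt_backForm hp₀ κ
  have hinv : ((fderiv ℝ f (((0 : ℝ), p₀), 0)).comp
      (ContinuousLinearMap.inr ℝ (ℝ × (E × E)) E)).IsInvertible := by
    rw [hder]
    refine isInvertible_of_injective _ fun v hv => ?_
    rw [smul_apply, smul_eq_zero_iff_right (by norm_num)] at hv
    exact (h.isInvertible_omega_add hp₀ κ).injective (hv.trans (map_zero _).symm)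
  set X : ℝ × (E × E) → E := hfs.implicitFunction (by simp) hinv with hX
  have hXs : ContDiffAt ℝ ∞ X (0, p₀) := hfs.contDiffAt_implicitFunction (by simp) hinv
  have hX0 : X (0, p₀) = 0 := hfs.implicitFunction_apply_self (by simp) hinv
  have hXeq : ∀ᶠ z in 𝓝 ((0 : ℝ), p₀), f (z, X z) = 0 := by
    have := hfs.eventually_apply_implicitFunction (by simp) hinv
    rwa [hf0] at this
  have hXu : ∀ᶠ y in 𝓝 (((0 : ℝ), p₀), (0 : E)), f y = 0 → X y.1 = y.2 := by
    have := hfs.eventually_apply_eq_iff_implicitFunction (by simp) hinv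
    rw [hf0] at this
    exact this.mono fun y hy => hy.1
  have hqc : Tendsto (fun z : ℝ × (E × E) => z.2.1) (𝓝 (0, p₀)) (𝓝 p₀.1) :=
    (continuous_fst.comp continuous_snd).tendsto (0, p₀)
  have hħ : Tendsto (fun z : ℝ × (E × E) => z.1) (𝓝 (0, p₀)) (𝓝 0) :=
    continuous_fst.tendsto (0, p₀)
  have hvc : Tendsto (fun z : ℝ × (E × E) => z.2.2) (𝓝 (0, p₀)) (𝓝 p₀.2) :=
    (continuous_snd.comp continuous_snd).tendsto (0, p₀)
  have hħs : ContDiffAt ℝ ∞ (fun z : ℝ × (E × E) => z.1) (0, p₀) := by fun_prop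
  have hqs : ContDiffAt ℝ ∞ (fun z : ℝ × (E × E) => z.2.1) (0, p₀) := by fun_prop
  have hvs : ContDiffAt ℝ ∞ (fun z : ℝ × (E × E) => z.2.2) (0, p₀) := by fun_prop
  have hX00 : ∀ᶠ p in 𝓝 p₀, X (0, p) = 0 := by
    have hcur : Tendsto (fun p : E × E => (((0 : ℝ), p), (0 : E))) (𝓝 p₀) (𝓝 ((0, p₀), 0)) := by
      have : Continuous fun p : E × E => (((0 : ℝ), p), (0 : E)) := by fun_prop
      exact this.tendsto p₀
    filter_upwards [hcur.eventually hXu] with p hp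
    exact hp (by simp [hf, backForm_zero])
  obtain ⟨X₁, hX₁s, hX₁⟩ := exists_smul_of_eq_zero hXs hX00
  have hXO : X =O[𝓝 (0, p₀)] fun z => z.1 := by
    have h1 := (isBigO_refl (fun z : ℝ × (E × E) => z.1) (𝓝 (0, p₀))).smul
      (isBigO_one_of_contDiffAt hX₁s tendsto_id)
    refine h1.congr' (hX₁.mono fun z hz => hz.symm) (Eventually.of_forall fun z => by simp)
  have hus : ContDiffAt ℝ ∞ (fun z : ℝ × (E × E) => z.2.2 - hamVF ϑ H z.2.1) (0, p₀) :=
    hvs.sub (contDiffAt_comp_of_eq (h.contDiffAt_hamVF hp₀) hqs rfl)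
  have hback : ∀ᶠ z in 𝓝 ((0 : ℝ), p₀), z.1 ^ 2 • metricL ϑ J z.2.1
      (hamVF ϑ H z.2.1 + (z.2.2 - hamVF ϑ H z.2.1)) = backForm ϑ J H κ z.1 z.2.1 (X z) := by
    filter_upwards [hXeq] with z hz
    rw [add_sub_cancel]
    exact (sub_eq_zero.1 hz).symm
  obtain ⟨hD, hW'⟩ := h.isBigO_displacement hθ hp₀ hħ hqc hXO
    (isBigO_one_of_contDiffAt hus tendsto_id) hback
  set W : ℝ × (E × E) → E →L[ℝ] ℝ := fun z => fwdForm ϑ J H κ z.1 z.2.1 (X z) with hWd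
  set G : ℝ × (E × E) → E →L[ℝ] ℝ := fun z => metricL ϑ J z.2.1
    (hamVF ϑ H z.2.1 + rot θ (J z.2.1) (z.2.2 - hamVF ϑ H z.2.1)) with hGd
  have hWs : ContDiffAt ℝ ∞ W (0, p₀) := h.contDiffAt_fwdForm hp₀ κ hħs hqs rfl hXs hX0
  have hGs : ContDiffAt ℝ ∞ G (0, p₀) := by
    have h1 : ContDiffAt ℝ ∞ (fun z : ℝ × (E × E) => J z.2.1) (0, p₀) :=
      contDiffAt_comp_of_eq (h.contDiffAt_J hp₀) hqs rfl
    have h2 : ContDiffAt ℝ ∞ (fun z : ℝ × (E × E) => rot θ (J z.2.1)) (0, p₀) :=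
      contDiffAt_const.sub (h1.const_smul (Real.sin θ))
    exact (contDiffAt_comp_of_eq (h.contDiffAt_metricL hp₀) hqs rfl).clm_apply
      ((contDiffAt_comp_of_eq (h.contDiffAt_hamVF hp₀) hqs rfl).add (h2.clm_apply hus))
  have hW : (fun z => W z - z.1 ^ 2 • G z) =O[𝓝 (0, p₀)] fun z => z.1 ^ 3 := hW'
  have hWO : W =O[𝓝 (0, p₀)] fun z => z.1 ^ 2 := by
    have h1 : (fun z : ℝ × (E × E) => z.1 ^ 2 • G z) =O[𝓝 (0, p₀)] fun z => z.1 ^ 2 := by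
      simpa using (isBigO_refl (fun z : ℝ × (E × E) => z.1 ^ 2) (𝓝 (0, p₀))).smul
        (isBigO_one_of_contDiffAt hGs tendsto_id)
    exact ((hW.trans (isBigO_pow_of_le hħ (by norm_num))).add h1).congr_left fun z => sub_add_cancel _ _
  -- The forward form vanishes to second order in `ħ`, so two divisions by `ħ` leave a smooth
  -- quotient `k`. It defines the new velocity, also at `ħ = 0`.
  obtain ⟨k₁, hk₁s, hk₁⟩ := exists_smul_of_eq_zero hWs (eventually_eq_zero_of_isBigO two_ne_zero hWO)
  have hcont : ∀ {g : ℝ × (E × E) → E →L[ℝ] ℝ}, ContDiffAt ℝ ∞ g (0, p₀) →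
      ∀ᶠ z in 𝓝 ((0 : ℝ), p₀), ContinuousAt g z := fun {g} hg =>
    ((hg.of_le (by simp) : ContDiffAt ℝ 1 g (0, p₀)).eventually (by simp)).mono
      fun z hz => hz.continuousAt
  have hk₁O := isBigO_of_smul_isBigO (n := 1) (hcont hk₁s) (hWO.congr' hk₁ EventuallyEq.rfl)
  obtain ⟨k, hks, hk⟩ := exists_smul_of_eq_zero hk₁s
    (eventually_eq_zero_of_isBigO one_ne_zero hk₁O)
  have hWk : ∀ᶠ z in 𝓝 ((0 : ℝ), p₀), W z = z.1 ^ 2 • k z := by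
    filter_upwards [hk₁, hk] with z h1 h2
    rw [h1, h2, smul_smul, sq]
  -- `ħ² (k - G) = O(ħ³)` divided twice by `ħ` gives `k = G` at `ħ = 0`: the limit map is the
  -- rotation.
  have hkG : ∀ᶠ p in 𝓝 p₀, k (0, p) - G (0, p) = 0 := by
    refine eventually_eq_zero_of_isBigO (g := fun z => k z - G z) one_ne_zero ?_
    have h1 : ContDiffAt ℝ ∞ (fun z => k z - G z) (0, p₀) := hks.sub hGs
    refine isBigO_of_smul_isBigO (hcont h1) (isBigO_of_smul_isBigO (n := 2)
      (g := fun z : ℝ × (E × E) => z.1 • (k z - G z)) (hcont (hħs.smul h1)) ?_)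
    refine hW.congr' ?_ EventuallyEq.rfl
    filter_upwards [hWk] with z hz
    change W z - z.1 ^ 2 • G z = z.1 • z.1 • (k z - G z)
    rw [hz]
    module
  have hq's : ContDiffAt ℝ ∞ (fun z : ℝ × (E × E) => z.2.1 + X z) (0, p₀) := hqs.add hXs
  have hq'0 : (((0 : ℝ), p₀) : ℝ × (E × E)).2.1 + X (0, p₀) = p₀.1 := by simp [hX0]
  have hq't : Tendsto (fun z : ℝ × (E × E) => z.2.1 + X z) (𝓝 (0, p₀)) (𝓝 p₀.1) := by
    have := hq's.continuousAt.tendsto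
    rwa [hq'0] at this
  have hq'Q : ∀ᶠ z in 𝓝 ((0 : ℝ), p₀), z.2.1 + X z ∈ Q :=
    hq't.eventually (h.isOpen.mem_nhds hp₀)
  refine ⟨fun z => (z.2.1 + X z, (metricL ϑ J (z.2.1 + X z)).inverse (k z)), ?_, ?_, ?_, ?_, ?_⟩
  · have h1 : ContDiffAt ℝ ∞ (fun z => (metricL ϑ J (z.2.1 + X z)).inverse) (0, p₀) :=
      contDiffAt_comp_of_eq (g := ContinuousLinearMap.inverse)
        (h.isInvertible_metricL hp₀).contDiffAt_map_inverse
        (contDiffAt_comp_of_eq (h.contDiffAt_metricL hp₀) hq's hq'0) (by rw [hq'0])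
    exact hq's.prodMk (h1.clm_apply hks)
  · filter_upwards [hX00, hkG, continuous_fst.continuousAt.eventually (h.isOpen.mem_nhds hp₀)]
      with p h1 h2 h3
    rw [h1, sub_eq_zero.1 h2, add_zero]
    exact Prod.ext rfl (((h.isInvertible_metricL h3).inverse_apply_eq).2 rfl)
  · obtain ⟨r, hr, hball⟩ := Metric.isOpen_iff.1 h.isOpen p₀.1 hp₀
    have hb1 : ∀ᶠ z in 𝓝 ((0 : ℝ), p₀), z.2.1 ∈ Metric.ball p₀.1 r :=
      hqc.eventually (Metric.ball_mem_nhds _ hr)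
    have hb2 : ∀ᶠ z in 𝓝 ((0 : ℝ), p₀), z.2.1 + X z ∈ Metric.ball p₀.1 r :=
      hq't.eventually (Metric.ball_mem_nhds _ hr)
    filter_upwards [hb1, hb2, hWk, hXeq, hq'Q] with z h1 h2 h3 h4 h5
    rw [h.relations_iff]
    refine ⟨((convex_ball _ _).segment_subset h1 h2).trans hball, ?_, ?_⟩
    · rw [add_sub_cancel_left]
      refine Eq.trans ?_ h3.symm
      congr 1
      exact ((h.isInvertible_metricL h5).inverse_apply_eq.1 rfl).symm
    · rw [add_sub_cancel_left]
      exact (sub_eq_zero.1 h4).symm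
  · have hcur : Tendsto (fun y : (ℝ × (E × E)) × E => (y.1, y.2 - y.1.2.1))
        (𝓝 (((0 : ℝ), p₀), p₀.1)) (𝓝 ((0, p₀), 0)) := by
      have : Continuous fun y : (ℝ × (E × E)) × E => (y.1, y.2 - y.1.2.1) := by fun_prop
      simpa using this.tendsto (((0 : ℝ), p₀), p₀.1)
    filter_upwards [hcur.eventually hXu] with y hy heq
    rw [hy (by simp only [hf, heq, sub_self])]
    abel
  · simpa using hD

end IsAdmissible

end LocalBranch

end SymplecticLorentz

namespace SymplecticLorentz

open Filter Asymptotics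

/-! ### Uniqueness of the local branch, and gluing to a global map. -/

section Existence

set_option linter.unusedSectionVars false

universe u

variable {E : Type u} [NormedAddCommGroup E] [NormedSpace ℝ E] [FiniteDimensional ℝ E]
  {Q : Set E} {ϑ : E → E →L[ℝ] ℝ} {J : E → E →L[ℝ] E} {H : E → ℝ} {θ : ℝ}

namespace IsAdmissible

/-- Two solutions of the implicit relations with the same base points coincide. -/
theorem relations_unique (h : IsAdmissible Q ϑ J H) {ħ : ℝ} (hħ : ħ ≠ 0) {p p' p'' : E × E}
    (h1 : Relations Q ϑ J H θ ħ p p') (h2 : Relations Q ϑ J H θ ħ p p'') (heq : p'.1 = p''.1) :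
    p' = p'' := by
  have hQ : p'.1 ∈ Q := h1.segment_subset (right_mem_segment ℝ _ _)
  rw [h.relations_iff] at h1 h2
  have h3 := h1.2.1.trans ((congrArg (fun y => fwdForm ϑ J H _ ħ p.1 (y - p.1)) heq).trans
    h2.2.1.symm)
  rw [← heq] at h3
  -- For `ħ ≠ 0` the forward relation determines the new velocity; at `ħ = 0` the factor `ħ ^ 2`
  -- removes it.
  have h4 := smul_right_injective _ (pow_ne_zero 2 hħ) h3
  exact Prod.ext heq ((h.isInvertible_metricL hQ).injective h4)

/-- Every symplectic Lorentz map is locally the smooth branch. -/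
theorem eventually_eq_localBranch (h : IsAdmissible Q ϑ J H) {U : Set (ℝ × (E × E))}
    {Ψ : ℝ → E × E → E × E} (hΨ : IsSymplecticLorentzMap Q ϑ J H θ U Ψ) {p₀ : E × E}
    (hp₀ : p₀.1 ∈ Q) {F : ℝ × (E × E) → E × E}
    (hF : ∀ᶠ z in 𝓝 ((0 : ℝ), p₀), Relations Q ϑ J H θ z.1 z.2 (F z))
    (hFu : ∀ᶠ y in 𝓝 (((0 : ℝ), p₀), p₀.1), y.1.1 ^ 2 • metricL ϑ J y.1.2.1 y.1.2.2 =
        backForm ϑ J H (Real.sin θ / (1 - Real.cos θ)) y.1.1 y.1.2.1 (y.2 - y.1.2.1) →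
          y.2 = (F y.1).1) :
    ∀ᶠ z in 𝓝 ((0 : ℝ), p₀), z.1 ≠ 0 → Ψ z.1 z.2 = F z := by
  have hmem : p₀ ∈ Q ×ˢ (univ : Set E) := ⟨hp₀, mem_univ _⟩
  have hU : U ∈ 𝓝 ((0 : ℝ), p₀) := hΨ.isOpen.mem_nhds (hΨ.zero_mem p₀ hmem)
  have hc : ContinuousAt (fun z : ℝ × (E × E) => Ψ z.1 z.2) (0, p₀) :=
    hΨ.continuousOn.continuousAt hU
  -- Continuity and `base_zero` keep the new base point in the region where the implicit function
  -- theorem gives uniqueness.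
  have ht : Tendsto (fun z : ℝ × (E × E) => (z, (Ψ z.1 z.2).1)) (𝓝 (0, p₀))
      (𝓝 ((0, p₀), p₀.1)) := by
    have h1 := (continuousAt_id (x := ((0 : ℝ), p₀))).prodMk hc.fst
    have h2 := h1.tendsto
    simpa [hΨ.base_zero p₀ hmem] using h2
  filter_upwards [hF, ht.eventually hFu, hU] with z h1 h2 h3 h0
  have h4 := hΨ.relations z.1 z.2 h3
  refine h.relations_unique h0 h4 h1 (h2 ?_)
  exact ((h.relations_iff _ _ _ _).1 h4).2.2

/-- `ξ` is the solution of smallest norm of the backward relation, and it is isolated. -/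
def IsBranch (ϑ : E → E →L[ℝ] ℝ) (J : E → E →L[ℝ] E) (H : E → ℝ) (κ ħ : ℝ) (p : E × E) (ξ : E) :
    Prop :=
  ħ ^ 2 • metricL ϑ J p.1 p.2 = backForm ϑ J H κ ħ p.1 ξ ∧ ∃ r, ‖ξ‖ < r ∧ ∀ ξ', ‖ξ'‖ < r →
    ħ ^ 2 • metricL ϑ J p.1 p.2 = backForm ϑ J H κ ħ p.1 ξ' → ξ' = ξ

/-- The larger of the two isolating balls contains both solutions. -/
theorem IsBranch.unique {κ ħ : ℝ} {p : E × E} {ξ ξ' : E} (h : IsBranch ϑ J H κ ħ p ξ)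
    (h' : IsBranch ϑ J H κ ħ p ξ') : ξ = ξ' := by
  obtain ⟨h1, r, h2, h3⟩ := h
  obtain ⟨h1', r', h2', h3'⟩ := h'
  rcases le_total r r' with hr | hr
  · exact h3' ξ (h2.trans_le hr) h1
  · exact (h3 ξ' (h2'.trans_le hr) h1').symm

open Classical in
/-- The global branch of solutions of the implicit relations. -/
noncomputable def branch (ϑ : E → E →L[ℝ] ℝ) (J : E → E →L[ℝ] E) (H : E → ℝ) (θ ħ : ℝ)
    (p : E × E) : E × E :=
  let κ := Real.sin θ / (1 - Real.cos θ)
  let ξ := Classical.epsilon (IsBranch ϑ J H κ ħ p)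
  if ħ = 0 then (p.1, hamVF ϑ H p.1 + rot θ (J p.1) (p.2 - hamVF ϑ H p.1))
  else (p.1 + ξ, (metricL ϑ J (p.1 + ξ)).inverse ((ħ ^ 2)⁻¹ • fwdForm ϑ J H κ ħ p.1 ξ))

/-- `IsBranch` refers to no chart, so near every point the chosen solution is the one of the
implicit function theorem, and local branches match automatically. -/
theorem eventually_branch_eq (h : IsAdmissible Q ϑ J H) {p₀ : E × E}
    {F : ℝ × (E × E) → E × E} (hFs : ContDiffAt ℝ ∞ F (0, p₀))
    (hF0 : ∀ᶠ p in 𝓝 p₀, F (0, p) =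
      (p.1, hamVF ϑ H p.1 + rot θ (J p.1) (p.2 - hamVF ϑ H p.1)))
    (hF : ∀ᶠ z in 𝓝 ((0 : ℝ), p₀), Relations Q ϑ J H θ z.1 z.2 (F z))
    (hFu : ∀ᶠ y in 𝓝 (((0 : ℝ), p₀), p₀.1), y.1.1 ^ 2 • metricL ϑ J y.1.2.1 y.1.2.2 =
        backForm ϑ J H (Real.sin θ / (1 - Real.cos θ)) y.1.1 y.1.2.1 (y.2 - y.1.2.1) →
          y.2 = (F y.1).1) :
    ∀ᶠ z in 𝓝 ((0 : ℝ), p₀), branch ϑ J H θ z.1 z.2 = F z := by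
  set κ := Real.sin θ / (1 - Real.cos θ) with hκ
  have hc : Tendsto (fun y : (ℝ × (E × E)) × E => (y.1, y.1.2.1 + y.2))
      (𝓝 (((0 : ℝ), p₀), 0)) (𝓝 ((0, p₀), p₀.1)) := by
    have : Continuous fun y : (ℝ × (E × E)) × E => (y.1, y.1.2.1 + y.2) := by fun_prop
    simpa using this.tendsto (((0 : ℝ), p₀), 0)
  have h1 := hc.eventually hFu
  -- A product neighbourhood provides an isolating radius `r` independent of `z`.
  rw [nhds_prod_eq] at h1
  obtain ⟨A, hA, B, hB, hAB⟩ := eventually_prod_iff.1 h1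
  obtain ⟨r, hr, hrB⟩ := Metric.eventually_nhds_iff.1 hB
  have h0 : (F (0, p₀)).1 - p₀.1 = 0 := by rw [hF0.self_of_nhds, sub_self]
  have hsmall : ∀ᶠ z in 𝓝 ((0 : ℝ), p₀), ‖(F z).1 - z.2.1‖ < r := by
    have h2 : ContinuousAt (fun z : ℝ × (E × E) => (F z).1 - z.2.1) (0, p₀) :=
      hFs.continuousAt.fst.sub (by fun_prop)
    have h3 : Tendsto (fun z : ℝ × (E × E) => (F z).1 - z.2.1) (𝓝 (0, p₀)) (𝓝 0) := by
      simpa only [h0] using h2.tendsto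
    have := h3.norm.eventually (gt_mem_nhds (by simpa using hr))
    exact this
  have hsnd : Tendsto (fun z : ℝ × (E × E) => z.2) (𝓝 (0, p₀)) (𝓝 p₀) :=
    continuous_snd.tendsto (0, p₀)
  filter_upwards [hA, hsmall, hF, hsnd.eventually hF0] with z hz hzr hzF hz0
  by_cases hħ : z.1 = 0
  · rw [branch, if_pos hħ, ← hz0, ← hħ]
  · have hrel := (h.relations_iff _ _ _ _).1 hzF
    have hb : IsBranch ϑ J H κ z.1 z.2 ((F z).1 - z.2.1) := by
      refine ⟨hrel.2.2, r, hzr, fun ξ' hξ' heq => ?_⟩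
      have := hAB hz (hrB (by simpa using hξ'))
      simp only [add_sub_cancel_left] at this
      rw [← this heq]
      abel
    have hξ : Classical.epsilon (IsBranch ϑ J H κ z.1 z.2) = (F z).1 - z.2.1 :=
      (Classical.epsilon_spec (p := IsBranch ϑ J H κ z.1 z.2) ⟨_, hb⟩).unique hb
    have hQ : (F z).1 ∈ Q := hzF.segment_subset (right_mem_segment ℝ _ _)
    rw [branch, if_neg hħ, ← hκ, hξ, add_sub_cancel]
    refine Prod.ext rfl (((h.isInvertible_metricL hQ).inverse_apply_eq).2 ?_)
    rw [← hrel.2.1, smul_smul, inv_mul_cancel₀ (pow_ne_zero 2 hħ), one_smul]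

/-- Existence of symplectic Lorentz maps. -/
theorem exists_symplecticLorentzMap (h : IsAdmissible Q ϑ J H) (hθ : 1 - Real.cos θ ≠ 0) :
    ∃ (U : Set (ℝ × (E × E))) (Ψ : ℝ → E × E → E × E), IsSymplecticLorentzMap Q ϑ J H θ U Ψ := by
  -- `U` consists of the points near which `branch` has its base in `Q`, solves the relations and is
  -- continuous; it is open by construction.
  refine ⟨{z | ∀ᶠ y in 𝓝 z, y.2.1 ∈ Q ∧ Relations Q ϑ J H θ y.1 y.2 (branch ϑ J H θ y.1 y.2) ∧
    ContinuousAt (fun y : ℝ × (E × E) => branch ϑ J H θ y.1 y.2) y}, branch ϑ J H θ,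
    isOpen_setOfPred_eventually_nhds, fun z hz => ⟨mem_univ _, hz.self_of_nhds.1, mem_univ _⟩, ?_,
    fun z hz => hz.self_of_nhds.2.2.continuousWithinAt, fun p _ => by simp [branch],
    fun ħ p hz => hz.self_of_nhds.2.1⟩
  intro p hp
  obtain ⟨F, h1, h2, h3, h4, -⟩ := h.exists_localBranch hθ hp.1
  have h5 := h.eventually_branch_eq h1 h2 h3 h4
  have h6 : ∀ᶠ z in 𝓝 ((0 : ℝ), p), ContinuousAt F z :=
    ((h1.of_le (by simp) : ContDiffAt ℝ 1 F (0, p)).eventually (by simp)).mono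
      fun z hz => hz.continuousAt
  have h7 : ∀ᶠ z in 𝓝 ((0 : ℝ), p), z.2.1 ∈ Q :=
    (continuous_fst.comp continuous_snd).continuousAt.eventually (h.isOpen.mem_nhds hp.1)
  filter_upwards [h5.eventually_nhds, h6, h7, h3] with z h5 h6 h7 h3
  refine ⟨h7, ?_, h6.congr (h5.mono fun y hy => hy.symm)⟩
  rw [h5.self_of_nhds]
  exact h3

end IsAdmissible

end Existence

end SymplecticLorentz

namespace SymplecticLorentz

open Filter Asymptotics

/-! ### Coordinates relative to the graph of X_H. -/

section Chart

set_option linter.unusedSectionVars false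

universe u

variable {E : Type u} [NormedAddCommGroup E] [NormedSpace ℝ E]
  {Q : Set E} {ϑ : E → E →L[ℝ] ℝ} {J : E → E →L[ℝ] E} {H : E → ℝ} {θ : ℝ}

/-- The coordinates `(q, v - X_H(q))` on the tangent bundle. -/
noncomputable def toRel (ϑ : E → E →L[ℝ] ℝ) (H : E → ℝ) (p : E × E) : E × E :=
  (p.1, p.2 - hamVF ϑ H p.1)

/-- The inverse of `toRel`. -/
noncomputable def ofRel (ϑ : E → E →L[ℝ] ℝ) (H : E → ℝ) (w : E × E) : E × E :=
  (w.1, hamVF ϑ H w.1 + w.2)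

theorem ofRel_toRel (p : E × E) : ofRel ϑ H (toRel ϑ H p) = p := by
  simp [ofRel, toRel]

/-- A map of the tangent bundle in the coordinates `toRel`. -/
noncomputable def relMap (ϑ : E → E →L[ℝ] ℝ) (H : E → ℝ) (Ψ : ℝ → E × E → E × E) (ħ : ℝ)
    (w : E × E) : E × E :=
  toRel ϑ H (Ψ ħ (ofRel ϑ H w))

theorem iterate_relMap (Ψ : ℝ → E × E → E × E) (ħ : ℝ) (k : ℕ) (p : E × E) :
    (relMap ϑ H Ψ ħ)^[k] (toRel ϑ H p) = toRel ϑ H ((Ψ ħ)^[k] p) := by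
  have h : Function.Semiconj (toRel ϑ H) (Ψ ħ) (relMap ϑ H Ψ ħ) := fun p => by
    rw [relMap, ofRel_toRel]
  exact ((h.iterate_right k).eq p).symm

/-- The one-form `ϑ + ħ² g(v, dq)` in the coordinates `toRel`. -/
noncomputable def relForm (ϑ : E → E →L[ℝ] ℝ) (J : E → E →L[ℝ] E) (H : E → ℝ)
    (z : ℝ × (E × E)) : E × E →L[ℝ] ℝ :=
  (ϑ z.2.1 + z.1 ^ 2 • metricL ϑ J z.2.1 (hamVF ϑ H z.2.1 + z.2.2)).comp
    (ContinuousLinearMap.fst ℝ E E)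

/-- A smooth local model of a symplectic Lorentz map in the coordinates `toRel`. -/
structure IsRelChart (ϑ : E → E →L[ℝ] ℝ) (J : E → E →L[ℝ] E) (H : E → ℝ) (θ : ℝ)
    (Ψ : ℝ → E × E → E × E) (q₀ : E) (f : ℝ × (E × E) → E × E) (s : ℝ → E × E → ℝ) : Prop where
  contDiffAt : ContDiffAt ℝ ∞ f (0, (q₀, 0))
  zero : ∀ᶠ w in 𝓝 ((q₀, 0) : E × E), f (0, w) = (w.1, rot θ (J w.1) w.2)
  relMap_eq : ∀ᶠ z in 𝓝 ((0 : ℝ), ((q₀, 0) : E × E)), z.1 ≠ 0 → relMap ϑ H Ψ z.1 z.2 = f z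
  exact : ∀ᶠ z in 𝓝 ((0 : ℝ), ((q₀, 0) : E × E)), z.1 ≠ 0 → HasFDerivAt (s z.1)
    ((relForm ϑ J H (z.1, f z)).comp
      ((fderiv ℝ f z).comp (ContinuousLinearMap.inr ℝ ℝ (E × E))) - relForm ϑ J H z) z.2
  displacement : (fun z : ℝ × (E × E) => (f z).1 - z.2.1 -
    z.1 • hamVF ϑ H (z.2.1 + (1 / 2 : ℝ) • ((f z).1 - z.2.1)) -
    z.1 ^ 2 • shift θ (J z.2.1) z.2.2) =O[𝓝 (0, (q₀, 0))] fun z => z.1 ^ 3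

variable [FiniteDimensional ℝ E]

/-- The primitive `s` is the generating function at the old and new base points. By the relations
its differential is the difference of the forms `ϑ + ħ² g(v, ·)` at the two ends. -/
theorem IsAdmissible.exists_isRelChart (h : IsAdmissible Q ϑ J H) (hθ : 1 - Real.cos θ ≠ 0)
    {U : Set (ℝ × (E × E))} {Ψ : ℝ → E × E → E × E} (hΨ : IsSymplecticLorentzMap Q ϑ J H θ U Ψ)
    {q₀ : E} (hq₀ : q₀ ∈ Q) : ∃ f s, IsRelChart ϑ J H θ Ψ q₀ f s := by
  have hp₀ : (ofRel ϑ H (q₀, 0)).1 ∈ Q := hq₀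
  obtain ⟨F, hFs, hF0, hF, hFu, hFd⟩ := h.exists_localBranch hθ hp₀
  have heq := h.eventually_eq_localBranch hΨ hp₀ hF hFu
  have hXq : ∀ {V : Type u} [NormedAddCommGroup V] [NormedSpace ℝ V] {g : V → E} {a : V},
      ContDiffAt ℝ ∞ g a → g a = q₀ → ContDiffAt ℝ ∞ (fun x => hamVF ϑ H (g x)) a :=
    fun hg ha => contDiffAt_comp_of_eq (h.contDiffAt_hamVF hq₀) hg ha
  have hofs : ContDiffAt ℝ ∞ (ofRel ϑ H) (q₀, 0) :=
    contDiffAt_fst.prodMk ((hXq contDiffAt_fst rfl).add contDiffAt_snd)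
  set c : ℝ × (E × E) → ℝ × (E × E) := fun z => (z.1, ofRel ϑ H z.2) with hc
  have hcs : ContDiffAt ℝ ∞ c (0, (q₀, 0)) :=
    contDiffAt_fst.prodMk (contDiffAt_comp_of_eq hofs contDiffAt_snd rfl)
  have hct : Tendsto c (𝓝 (0, (q₀, 0))) (𝓝 (0, ofRel ϑ H (q₀, 0))) := hcs.continuousAt.tendsto
  set f : ℝ × (E × E) → E × E := fun z => toRel ϑ H (F (c z)) with hf
  have hF00 : (F (0, ofRel ϑ H (q₀, 0))).1 = q₀ := by rw [hF0.self_of_nhds]; rfl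
  have hFcs : ContDiffAt ℝ ∞ (fun z => F (c z)) (0, (q₀, 0)) := contDiffAt_comp_of_eq hFs hcs rfl
  have hfs : ContDiffAt ℝ ∞ f (0, (q₀, 0)) :=
    hFcs.fst.prodMk (hFcs.snd.sub (hXq hFcs.fst hF00))
  refine ⟨f, fun ħ w => genS ϑ J H θ ħ w.1 (f (ħ, w)).1, hfs, ?_, ?_, ?_, ?_⟩
  · filter_upwards [hofs.continuousAt.eventually hF0] with w hw
    simp only [hf, hc, hw]
    simp [toRel, ofRel]
  · filter_upwards [hct.eventually heq] with z hz hz0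
    exact congrArg (toRel ϑ H) (hz hz0)
  · have h1 : ∀ᶠ z in 𝓝 ((0 : ℝ), ((q₀, 0) : E × E)), DifferentiableAt ℝ f z :=
      ((hfs.of_le (by simp) : ContDiffAt ℝ 1 f _).eventually (by simp)).mono
        fun z hz => hz.differentiableAt (by simp)
    filter_upwards [hct.eventually hF, h1] with z hz hfd _
    have hrel := (h.relations_iff _ _ _ _).1 hz
    have hG := h.hasFDerivAt_genS θ z.1 hrel.1
    rw [← hrel.2.1, ← hrel.2.2] at hG
    have h2 : HasFDerivAt (fun w : E × E => f (z.1, w))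
        ((fderiv ℝ f z).comp (ContinuousLinearMap.inr ℝ ℝ (E × E))) z.2 :=
      HasFDerivAt.comp (g := f) z.2 hfd.hasFDerivAt (hasFDerivAt_prodMk_right z.1 z.2)
    have h3 : HasFDerivAt (fun w : E × E => (w.1, (f (z.1, w)).1)) _ z.2 :=
      hasFDerivAt_fst.prodMk (hasFDerivAt_fst.comp z.2 h2)
    refine (HasFDerivAt.comp (g := fun p : E × E => genS ϑ J H θ z.1 p.1 p.2) z.2 hG h3).congr_fderiv ?_
    refine ContinuousLinearMap.ext fun d => ?_
    simp [relForm, hf, hc, toRel, ofRel]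
  · refine (hFd.comp_tendsto hct).congr_left fun z => ?_
    simp [hf, hc, toRel, ofRel]

end Chart

end SymplecticLorentz

namespace SymplecticLorentz

open Filter Asymptotics

/-! ### Orbits whose relative velocity is O(√ħ). -/

section Orbits

set_option linter.unusedSectionVars false

universe u

variable {E : Type u} [NormedAddCommGroup E] [NormedSpace ℝ E]
  {Q : Set E} {ϑ : E → E →L[ℝ] ℝ} {J : E → E →L[ℝ] E} {H : E → ℝ} {θ : ℝ}

/-- Small positive `ħ`, base points near `q₀` and relative velocities bounded by `M √ħ`. -/
def relFilter (q₀ : E) (M : ℝ) : Filter (ℝ × (E × E)) :=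
  𝓝 (0, (q₀, 0)) ⊓ 𝓟 {z | 0 < z.1 ∧ ‖z.2.2‖ ≤ M * √z.1}

/-- The orbit of a point under `relMap`. -/
noncomputable def relOrbit (ϑ : E → E →L[ℝ] ℝ) (H : E → ℝ) (Ψ : ℝ → E × E → E × E)
    (z : ℝ × (E × E)) (k : ℕ) : E × E :=
  (relMap ϑ H Ψ z.1)^[k] z.2

theorem relFilter_le (q₀ : E) (M : ℝ) : relFilter q₀ M ≤ 𝓝 (0, (q₀, 0)) := inf_le_left

theorem eventually_relFilter (q₀ : E) (M : ℝ) :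
    ∀ᶠ z in relFilter q₀ M, 0 < z.1 ∧ ‖z.2.2‖ ≤ M * √z.1 :=
  mem_inf_of_right (mem_principal_self _)

theorem tendsto_sqrt_relFilter (q₀ : E) (M : ℝ) :
    Tendsto (fun z : ℝ × (E × E) => √z.1) (relFilter q₀ M) (𝓝 0) := by
  have : Continuous fun z : ℝ × (E × E) => √z.1 := by fun_prop
  have h := this.tendsto (0, (q₀, 0))
  simp only [Real.sqrt_zero] at h
  exact h.mono_left (relFilter_le q₀ M)

theorem tendsto_fst_relFilter (q₀ : E) (M : ℝ) :
    Tendsto (fun z : ℝ × (E × E) => z.1) (relFilter q₀ M) (𝓝 0) :=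
  (continuous_fst.tendsto (0, (q₀, 0))).mono_left (relFilter_le q₀ M)

theorem tendsto_base_relFilter (q₀ : E) (M : ℝ) :
    Tendsto (fun z : ℝ × (E × E) => z.2.1) (relFilter q₀ M) (𝓝 q₀) :=
  ((continuous_fst.comp continuous_snd).tendsto ((0 : ℝ), (q₀, (0 : E)))).mono_left
    (relFilter_le q₀ M)

theorem eventually_sq_sqrt_relFilter (q₀ : E) (M : ℝ) :
    ∀ᶠ z in relFilter q₀ M, √z.1 ^ 2 = z.1 :=
  (eventually_relFilter q₀ M).mono fun _ hz => Real.sq_sqrt hz.1.le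

theorem isBigO_fst_relFilter (q₀ : E) (M : ℝ) :
    (fun z : ℝ × (E × E) => z.1) =O[relFilter q₀ M] fun z => √z.1 ^ 2 :=
  (isBigO_refl _ _).congr' ((eventually_sq_sqrt_relFilter q₀ M)) EventuallyEq.rfl

theorem isBigO_snd_relFilter (q₀ : E) (M : ℝ) :
    (fun z : ℝ × (E × E) => z.2.2) =O[relFilter q₀ M] fun z => √z.1 := by
  refine IsBigO.of_bound M ((eventually_relFilter q₀ M).mono fun z hz => ?_)
  rw [Real.norm_of_nonneg (Real.sqrt_nonneg _)]
  exact hz.2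

theorem IsAdmissible.contDiffAt_relForm [FiniteDimensional ℝ E] (h : IsAdmissible Q ϑ J H) {q₀ : E} (hq₀ : q₀ ∈ Q) :
    ContDiffAt ℝ 1 (relForm ϑ J H) (0, (q₀, 0)) := by
  have hqs : ContDiffAt ℝ ∞ (fun z : ℝ × (E × E) => z.2.1) (0, (q₀, 0)) := by fun_prop
  have hus : ContDiffAt ℝ ∞ (fun z : ℝ × (E × E) => z.2.2) (0, (q₀, 0)) := by fun_prop
  have hħs : ContDiffAt ℝ ∞ (fun z : ℝ × (E × E) => z.1 ^ 2) (0, (q₀, 0)) := by fun_prop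
  have h1 := (contDiffAt_comp_of_eq (h.contDiffAt_theta hq₀) hqs rfl).add
    (hħs.smul ((contDiffAt_comp_of_eq (h.contDiffAt_metricL hq₀) hqs rfl).clm_apply
      ((contDiffAt_comp_of_eq (h.contDiffAt_hamVF hq₀) hqs rfl).add hus)))
  exact (h1.clm_comp contDiffAt_const).of_le (by simp)

namespace IsRelChart

variable {Ψ : ℝ → E × E → E × E} {q₀ : E} {f : ℝ × (E × E) → E × E} {s : ℝ → E × E → ℝ}

theorem zero_apply (hf : IsRelChart ϑ J H θ Ψ q₀ f s) :
    ∀ᶠ q in 𝓝 q₀, f (0, (q, 0)) = (q, 0) := by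
  have : Tendsto (fun q : E => (q, (0 : E))) (𝓝 q₀) (𝓝 (q₀, 0)) :=
    (Continuous.prodMk_left (0 : E)).tendsto q₀
  filter_upwards [this.eventually hf.zero] with q hq
  rw [hq]
  simp

/-- Orbits stay within `O(√ħ)` of their first base point, and follow the local model. -/
theorem relOrbit_aux (hf : IsRelChart ϑ J H θ Ψ q₀ f s) (M : ℝ) (k : ℕ) :
    (fun z => relOrbit ϑ H Ψ z k - (z.2.1, 0)) =O[relFilter q₀ M] (fun z => √z.1) ∧
      ∀ᶠ z in relFilter q₀ M, relOrbit ϑ H Ψ z (k + 1) = f (z.1, relOrbit ϑ H Ψ z k) := by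
  have hw : Tendsto (fun z : ℝ × (E × E) => (z.2.1, (0 : E))) (relFilter q₀ M) (𝓝 (q₀, 0)) :=
    (tendsto_base_relFilter q₀ M).prodMk_nhds tendsto_const_nhds
  -- A bound on the `k`-th point puts it in the domain of the local model, which then describes the
  -- next point. The bound propagates because `f` is locally Lipschitz and fixes the zero section at
  -- `ħ = 0`.
  have key : ∀ k, (fun z => relOrbit ϑ H Ψ z k - (z.2.1, 0)) =O[relFilter q₀ M] (fun z => √z.1) →
      Tendsto (fun z => (z.1, relOrbit ϑ H Ψ z k)) (relFilter q₀ M) (𝓝 (0, (q₀, 0))) ∧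
      ∀ᶠ z in relFilter q₀ M, relOrbit ϑ H Ψ z (k + 1) = f (z.1, relOrbit ϑ H Ψ z k) := by
    intro k hk
    have h1 : Tendsto (fun z => (z.1, relOrbit ϑ H Ψ z k)) (relFilter q₀ M) (𝓝 (0, (q₀, 0))) :=
      (tendsto_fst_relFilter q₀ M).prodMk_nhds (tendsto_of_sub_isBigO
        (tendsto_sqrt_relFilter q₀ M) hw (by simpa using hk))
    refine ⟨h1, ?_⟩
    filter_upwards [h1.eventually hf.relMap_eq, eventually_relFilter q₀ M] with z h2 h3
    rw [← h2 h3.1.ne', relOrbit, Function.iterate_succ_apply']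
    rfl
  suffices h : (fun z => relOrbit ϑ H Ψ z k - (z.2.1, 0)) =O[relFilter q₀ M] (fun z => √z.1) from
    ⟨h, (key k h).2⟩
  induction k with
  | zero =>
    have : (fun z : ℝ × (E × E) => ((0 : E), z.2.2)) =O[relFilter q₀ M] fun z => √z.1 :=
      (isBigO_zero _ _).prod_left (isBigO_snd_relFilter q₀ M)
    refine this.congr_left fun z => ?_
    simp only [relOrbit, Function.iterate_zero, id]
    ext <;> simp
  | succ k ih =>
    obtain ⟨h1, h2⟩ := key k ih
    have h3 := isBigO_sub_of_contDiffAt (hf.contDiffAt.of_le (by simp)) h1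
      ((tendsto_const_nhds (x := (0 : ℝ))).prodMk_nhds hw)
    have h4 : (fun z : ℝ × (E × E) => z.1) =O[relFilter q₀ M] fun z => √z.1 := by
      have := (isBigO_fst_relFilter q₀ M).trans
        (isBigO_pow_of_le (tendsto_sqrt_relFilter q₀ M) one_le_two)
      simpa using this
    have h5 : (fun z : ℝ × (E × E) => (z.1, relOrbit ϑ H Ψ z k) - ((0 : ℝ), (z.2.1, (0 : E))))
        =O[relFilter q₀ M] fun z => √z.1 := by
      simp only [Prod.mk_sub_mk, sub_zero]
      exact h4.prod_left ih
    refine (h3.trans h5).congr' ?_ EventuallyEq.rfl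
    filter_upwards [h2, (tendsto_base_relFilter q₀ M).eventually hf.zero_apply] with z h6 h7
    rw [h6, h7]

theorem isBigO_relOrbit_sub (hf : IsRelChart ϑ J H θ Ψ q₀ f s) (M : ℝ) (k : ℕ) :
    (fun z => relOrbit ϑ H Ψ z k - (z.2.1, 0)) =O[relFilter q₀ M] (fun z => √z.1) :=
  (hf.relOrbit_aux M k).1

theorem eventually_relOrbit_succ (hf : IsRelChart ϑ J H θ Ψ q₀ f s) (M : ℝ) (k : ℕ) :
    ∀ᶠ z in relFilter q₀ M, relOrbit ϑ H Ψ z (k + 1) = f (z.1, relOrbit ϑ H Ψ z k) :=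
  (hf.relOrbit_aux M k).2

theorem tendsto_relOrbit (hf : IsRelChart ϑ J H θ Ψ q₀ f s) (M : ℝ) (k : ℕ) :
    Tendsto (fun z => relOrbit ϑ H Ψ z k) (relFilter q₀ M) (𝓝 (q₀, 0)) :=
  tendsto_of_sub_isBigO (tendsto_sqrt_relFilter q₀ M)
    ((tendsto_base_relFilter q₀ M).prodMk_nhds (tendsto_const_nhds (x := (0 : E))))
    (by simpa using hf.isBigO_relOrbit_sub M k)

theorem isBigO_relOrbit_step_fst (hf : IsRelChart ϑ J H θ Ψ q₀ f s) (M : ℝ) (k : ℕ) :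
    (fun z : ℝ × (E × E) => (relOrbit ϑ H Ψ z (k + 1)).1 - (relOrbit ϑ H Ψ z k).1 -
      z.1 • hamVF ϑ H ((relOrbit ϑ H Ψ z k).1 +
        (1 / 2 : ℝ) • ((relOrbit ϑ H Ψ z (k + 1)).1 - (relOrbit ϑ H Ψ z k).1)) -
      z.1 ^ 2 • shift θ (J (relOrbit ϑ H Ψ z k).1) (relOrbit ϑ H Ψ z k).2) =O[relFilter q₀ M]
      fun z => z.1 ^ 3 := by
  have h1 := (tendsto_fst_relFilter q₀ M).prodMk_nhds (hf.tendsto_relOrbit M k)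
  refine (hf.displacement.comp_tendsto h1).congr' ?_ EventuallyEq.rfl
  filter_upwards [hf.eventually_relOrbit_succ M k] with z hz
  simp [hz]

/-- At `ħ = 0` the local model rotates the relative velocity exactly, and `f` is locally Lipschitz
in `ħ`. -/
theorem isBigO_relOrbit_step_snd (hf : IsRelChart ϑ J H θ Ψ q₀ f s) (M : ℝ) (k : ℕ) :
    (fun z : ℝ × (E × E) => (relOrbit ϑ H Ψ z (k + 1)).2 -
      rot θ (J (relOrbit ϑ H Ψ z k).1) (relOrbit ϑ H Ψ z k).2) =O[relFilter q₀ M]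
      fun z => z.1 := by
  have h0 := hf.tendsto_relOrbit M k
  have h1 := (tendsto_fst_relFilter q₀ M).prodMk_nhds h0
  have h2 := (tendsto_const_nhds (x := (0 : ℝ))).prodMk_nhds h0
  have h3 := isBigO_sub_of_contDiffAt (hf.contDiffAt.of_le (by simp)) h1 h2
  have h4 : (fun z : ℝ × (E × E) => (z.1, relOrbit ϑ H Ψ z k) - ((0 : ℝ), relOrbit ϑ H Ψ z k))
      =O[relFilter q₀ M] fun z => z.1 := by
    simp only [Prod.mk_sub_mk, sub_zero, sub_self]
    exact (isBigO_refl _ _).prod_left (isBigO_zero _ _)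
  have h5 := (isBigO_snd_prod' (f' := fun z : ℝ × (E × E) =>
    f (z.1, relOrbit ϑ H Ψ z k) - f (0, relOrbit ϑ H Ψ z k))).trans (h3.trans h4)
  refine h5.congr' ?_ EventuallyEq.rfl
  filter_upwards [hf.eventually_relOrbit_succ M k, h0.eventually hf.zero] with z hz hz0
  rw [Prod.snd_sub, hz, hz0]

/-- The derivative of the local model at `ħ = 0` along the zero section. -/
theorem fderiv_inr (hf : IsRelChart ϑ J H θ Ψ q₀ f s) (hJ : ContDiffAt ℝ ∞ J q₀) :
    ∀ᶠ q in 𝓝 q₀, (fderiv ℝ f (0, (q, 0))).comp (ContinuousLinearMap.inr ℝ ℝ (E × E)) =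
      rotSnd θ (J q) := by
  have ht : Tendsto (fun q : E => (q, (0 : E))) (𝓝 q₀) (𝓝 (q₀, 0)) :=
    (Continuous.prodMk_left (0 : E)).tendsto q₀
  have ht' : Tendsto (fun q : E => ((0 : ℝ), (q, (0 : E)))) (𝓝 q₀) (𝓝 (0, (q₀, 0))) :=
    tendsto_const_nhds.prodMk_nhds ht
  have h1 : ∀ᶠ z in 𝓝 ((0 : ℝ), ((q₀, 0) : E × E)), DifferentiableAt ℝ f z :=
    ((hf.contDiffAt.of_le (by simp) : ContDiffAt ℝ 1 f _).eventually (by simp)).mono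
      fun z hz => hz.differentiableAt (by simp)
  have h2 : ∀ᶠ q in 𝓝 q₀, DifferentiableAt ℝ J q :=
    ((hJ.of_le (by simp) : ContDiffAt ℝ 1 J _).eventually (by simp)).mono
      fun z hz => hz.differentiableAt (by simp)
  filter_upwards [ht.eventually hf.zero.eventually_nhds, ht'.eventually h1, h2] with q h3 h4 h5
  have h6 : HasFDerivAt (fun w : E × E => f (0, w))
      ((fderiv ℝ f (0, (q, 0))).comp (ContinuousLinearMap.inr ℝ ℝ (E × E))) (q, 0) :=
    HasFDerivAt.comp (g := f) _ h4.hasFDerivAt (hasFDerivAt_prodMk_right (0 : ℝ) ((q, 0) : E × E))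
  refine h6.unique (HasFDerivAt.congr_of_eventuallyEq ?_ h3)
  have h7 : HasFDerivAt (fun w : E × E => J w.1) ((fderiv ℝ J q).comp
      (ContinuousLinearMap.fst ℝ E E)) ((q, 0) : E × E) :=
    HasFDerivAt.comp (g := J) ((q, 0) : E × E) h5.hasFDerivAt hasFDerivAt_fst
  -- The derivative of `J` contributes nothing, since it is applied to a zero velocity.
  have h8 := (hasFDerivAt_snd (𝕜 := ℝ) (p := ((q, 0) : E × E))).const_smul (Real.cos θ) |>.fun_sub
    ((h7.clm_apply (hasFDerivAt_snd (𝕜 := ℝ) (p := ((q, 0) : E × E)))).const_smul (Real.sin θ))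
  simp only [rot_apply]
  refine (hasFDerivAt_fst.prodMk h8).congr_fderiv ?_
  refine ContinuousLinearMap.ext fun d => ?_
  simp [rotSnd_apply, rot_apply]

variable [FiniteDimensional ℝ E]

/-- The loop action of an orbit is invariant to all orders. -/
theorem isBigO_loopAction_relMap (hf : IsRelChart ϑ J H θ Ψ q₀ f s) (h : IsAdmissible Q ϑ J H)
    (hq₀ : q₀ ∈ Q) (M : ℝ) (n : ℕ) :
    ∀ D₀ K a a', n * orbitDegree n ≤ D₀ → IsWeights θ D₀ K a a' →
      (fun z : ℝ × (E × E) => loopAction (relForm ϑ J H) z.1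
          (fun φ => wavg K a φ (relOrbit ϑ H Ψ (z.1, relMap ϑ H Ψ z.1 z.2)))
          (fun φ => wavg K a' φ (relOrbit ϑ H Ψ (z.1, relMap ϑ H Ψ z.1 z.2))) -
        loopAction (relForm ϑ J H) z.1 (fun φ => wavg K a φ (relOrbit ϑ H Ψ z))
          (fun φ => wavg K a' φ (relOrbit ϑ H Ψ z)))
        =O[relFilter q₀ M] fun z => √z.1 ^ n := by
  have : CompleteSpace E := FiniteDimensional.complete ℝ E
  have hq := tendsto_base_relFilter q₀ M
  have hT := h.contDiffAt_relForm hq₀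
  have hrot := isRotationFamily_rotSnd (θ := θ) (l := relFilter q₀ M)
    (J := fun z : ℝ × (E × E) => J z.2.1)
    ((h.contDiffAt_J hq₀).continuousAt.tendsto.comp hq)
    ((hq.eventually (h.isOpen.mem_nhds hq₀)).mono fun z hz => h.compatible.sq_eq_neg _ hz)
    (hq.eventually (hf.fderiv_inr (h.contDiffAt_J hq₀)))
  have hħ : (fun z : ℝ × (E × E) => z.1) =O[relFilter q₀ M] fun z => √z.1 ^ 1 :=
    (isBigO_fst_relFilter q₀ M).trans (isBigO_pow_of_le (tendsto_sqrt_relFilter q₀ M) one_le_two)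
  have hD' := isBigO_loopAction_succ_sub (tendsto_sqrt_relFilter q₀ M)
    (w := fun z : ℝ × (E × E) => (z.2.1, (0 : E))) (hq.prodMk_nhds tendsto_const_nhds) hħ
    ((eventually_relFilter q₀ M).mono fun z hz => hz.1.ne') hf.contDiffAt
    (hq.eventually hf.zero_apply) hrot hT hf.exact
    (fun k => by simpa using hf.isBigO_relOrbit_sub M k) (hf.eventually_relOrbit_succ M) n
  intro D₀ K a a' hD₀ ha
  have hs : ∀ z : ℝ × (E × E), relOrbit ϑ H Ψ (z.1, relMap ϑ H Ψ z.1 z.2) =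
      fun k => relOrbit ϑ H Ψ z (k + 1) := fun z => by
    funext k
    simp [relOrbit, Function.iterate_succ_apply]
  simp only [hs]
  exact hD' D₀ K a a' hD₀ ha

end IsRelChart

end Orbits

end SymplecticLorentz

namespace SymplecticLorentz

open Filter Asymptotics

/-! ### Second-order expansion of orbits. -/

section OrbitExpansion

set_option linter.unusedSectionVars false

universe u

variable {E : Type u} [NormedAddCommGroup E] [NormedSpace ℝ E]

/-- A telescoping form: the displacements caused by the velocities `rot (k θ) u` sum to `J u - rot
(k θ) (J u)`, which stays bounded in `k`. -/
theorem shift_rot {J : E →L[ℝ] E} (hJ : ∀ v, J (J v) = -v) (θ t : ℝ) (x : E) :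
    shift θ J (rot t J x) = rot t J (J x) - rot (t + θ) J (J x) := by
  simp only [shift, rot_apply, map_sub, map_smul, hJ, Real.cos_add, Real.sin_add]
  module

/-- The expansion of the `k`-th point of an orbit to second order. -/
noncomputable def orbitExpansion (X : E → E) (J : E →L[ℝ] E) (θ ħ : ℝ) (q u : E) (k : ℕ) : E :=
  q + (k : ℝ) ^ 1 • (ħ • X q) + (k : ℝ) ^ 2 • ((ħ ^ 2 / 2) • fderiv ℝ X q (X q)) +
    ħ ^ 2 • (J u - rot (k * θ) J (J u))

/-- The drift terms in `k` and `k ^ 2` average to zero, and a closed loop through `q` remains. -/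
theorem IsWeights.wavg_orbitExpansion {θ : ℝ} {D K : ℕ} {a a' : ℕ → ℝ → ℝ}
    (h : IsWeights θ D K a a') (hD : 2 ≤ D) (X : E → E) (J : E →L[ℝ] E) (ħ : ℝ) (q u : E) (φ : ℝ) :
    wavg K a φ (orbitExpansion X J θ ħ q u) = q + ħ ^ 2 • (J u - rot φ J (J u)) := by
  have h1 : orbitExpansion X J θ ħ q u = fun k : ℕ => q + (k : ℝ) ^ 1 • (ħ • X q) +
    (k : ℝ) ^ 2 • ((ħ ^ 2 / 2) • fderiv ℝ X q (X q)) + ħ ^ 2 • (J u - rot (k * θ) J (J u)) := rfl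
  rw [h1]
  simp only [wavg_add, wavg_smul, wavg_sub, wavg_smul_const, h.wavg_const, h.wavg_rot,
    h.map_pow φ 1 one_pos (one_le_two.trans hD), h.map_pow φ 2 two_pos hD, zero_smul, add_zero]

theorem IsWeights.wavg_deriv_orbitExpansion {θ : ℝ} {D K : ℕ} {a a' : ℕ → ℝ → ℝ}
    (h : IsWeights θ D K a a') (hD : 2 ≤ D) (X : E → E) {J : E →L[ℝ] E} (hJ : ∀ v, J (J v) = -v)
    (ħ : ℝ) (q u : E) (φ : ℝ) :
    wavg K a' φ (orbitExpansion X J θ ħ q u) = -(ħ ^ 2 • rot φ J u) := by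
  refine h.wavg_deriv_eq (g' := fun φ => -(ħ ^ 2 • rot φ J u)) (fun φ => h.wavg_orbitExpansion hD X J ħ q u φ) (fun φ => ?_) φ
  have h1 := (((hasDerivAt_rot J hJ (J u) φ).const_sub (J u)).const_smul (ħ ^ 2)).const_add q
  refine h1.congr_deriv ?_
  rw [hJ, map_neg, neg_neg, smul_neg]

variable {ι : Type*} {l : Filter ι} {ħ : ι → ℝ} {q u : ι → E} {y : ι → ℕ → E × E} {θ : ℝ}
  {X : E → E} {J : E → E →L[ℝ] E}

/-- Orbits whose steps satisfy the displacement formula to third order. -/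
structure IsApproxOrbit (l : Filter ι) (X : E → E) (J : E → E →L[ℝ] E) (θ : ℝ) (ħ : ι → ℝ)
    (q₀ : E) (y : ι → ℕ → E × E) : Prop where
  tendsto_param : Tendsto ħ l (𝓝 0)
  tendsto : ∀ k, Tendsto (fun b => y b k) l (𝓝 (q₀, 0))
  step_fst : ∀ k, (fun b => (y b (k + 1)).1 - (y b k).1 -
    ħ b • X ((y b k).1 + (1 / 2 : ℝ) • ((y b (k + 1)).1 - (y b k).1)) -
    ħ b ^ 2 • shift θ (J (y b k).1) (y b k).2) =O[l] fun b => ħ b ^ 3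
  step_snd : ∀ k, (fun b => (y b (k + 1)).2 - rot θ (J (y b k).1) (y b k).2) =O[l] ħ

namespace IsApproxOrbit

variable {q₀ : E}

theorem tendsto_fst (h : IsApproxOrbit l X J θ ħ q₀ y) (k : ℕ) :
    Tendsto (fun b => (y b k).1) l (𝓝 q₀) :=
  (continuous_fst.tendsto (q₀, (0 : E))).comp (h.tendsto k)

theorem isBigO_snd_one (h : IsApproxOrbit l X J θ ħ q₀ y) (k : ℕ) :
    (fun b => (y b k).2) =O[l] fun _ => (1 : ℝ) :=
  ((continuous_snd.tendsto (q₀, (0 : E))).comp (h.tendsto k)).isBigO_one ℝ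

theorem tendsto_mid (h : IsApproxOrbit l X J θ ħ q₀ y) (k : ℕ) :
    Tendsto (fun b => (y b k).1 + (1 / 2 : ℝ) • ((y b (k + 1)).1 - (y b k).1)) l (𝓝 q₀) := by
  simpa using (h.tendsto_fst k).add
    (((h.tendsto_fst (k + 1)).sub (h.tendsto_fst k)).const_smul (1 / 2 : ℝ))

theorem isBigO_shift (h : IsApproxOrbit l X J θ ħ q₀ y) (hJ : ContDiffAt ℝ ∞ J q₀) (k : ℕ) :
    (fun b => shift θ (J (y b k).1) (y b k).2) =O[l] fun _ => (1 : ℝ) := by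
  have h1 := isBigO_clm_apply (isBigO_one_of_contDiffAt hJ (h.tendsto_fst k)) (h.isBigO_snd_one k)
  simp only [mul_one] at h1
  exact (isBigO_const_smul _ h1).sub (isBigO_const_smul _ (h.isBigO_snd_one k))

theorem isBigO_fst_sub (h : IsApproxOrbit l X J θ ħ q₀ y) (hX : ContDiffAt ℝ ∞ X q₀)
    (hJ : ContDiffAt ℝ ∞ J q₀) (k : ℕ) : (fun b => (y b k).1 - (y b 0).1) =O[l] ħ := by
  induction k with
  | zero => simpa using isBigO_zero _ _
  | succ k ih =>
    have h1 := (h.step_fst k).trans (isBigO_pow_of_le h.tendsto_param (show 1 ≤ 3 by norm_num))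
    have h2 := ((isBigO_refl ħ l).pow 2).trans
      (isBigO_pow_of_le h.tendsto_param (show 1 ≤ 2 by norm_num))
    simp only [pow_one] at h1 h2
    have h3 := (isBigO_refl ħ l).smul (isBigO_one_of_contDiffAt hX (h.tendsto_mid k))
    have h4 := h2.smul (h.isBigO_shift hJ k)
    simp only [smul_eq_mul, mul_one] at h3 h4
    refine (((h1.add h3).add h4).add ih).congr_left fun b => ?_
    abel

/-- The base point moves by `O(ħ)`, so `J` can be frozen at the initial point and the rotations
compose. -/
theorem isBigO_snd_sub (h : IsApproxOrbit l X J θ ħ q₀ y) (hX : ContDiffAt ℝ ∞ X q₀)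
    (hJ : ContDiffAt ℝ ∞ J q₀) (hsq : ∀ᶠ b in l, ∀ v, J (y b 0).1 (J (y b 0).1 v) = -v) (k : ℕ) :
    (fun b => (y b k).2 - rot (k * θ) (J (y b 0).1) (y b 0).2) =O[l] ħ := by
  induction k with
  | zero => simpa [rot_zero] using isBigO_zero _ _
  | succ k ih =>
    have h1 := isBigO_sub_of_contDiffAt (hJ.of_le (by simp)) (h.tendsto_fst k) (h.tendsto_fst 0)
    have h2 := isBigO_clm_apply (h1.trans (h.isBigO_fst_sub hX hJ k)) (h.isBigO_snd_one k)
    have h3 := isBigO_clm_apply (isBigO_one_of_contDiffAt hJ (h.tendsto_fst 0)) ih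
    simp only [mul_one, one_mul] at h2 h3
    refine ((((h.step_snd k).sub (isBigO_const_smul (Real.sin θ) h2)).add
      (isBigO_const_smul (Real.cos θ) ih)).sub (isBigO_const_smul (Real.sin θ) h3)).congr' ?_
      EventuallyEq.rfl
    filter_upwards [hsq] with b hb
    have h4 := rot_rot hb θ (k * θ) (y b 0).2
    rw [show ((k + 1 : ℕ) : ℝ) * θ = θ + k * θ by push_cast; ring, ← h4]
    simp only [rot_apply, sub_apply, map_sub]
    module

theorem isBigO_fst_sub_sq (h : IsApproxOrbit l X J θ ħ q₀ y) (hX : ContDiffAt ℝ ∞ X q₀)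
    (hJ : ContDiffAt ℝ ∞ J q₀) (k : ℕ) :
    (fun b => (y b k).1 - (y b 0).1 - (k * ħ b) • X (y b 0).1) =O[l] fun b => ħ b ^ 2 := by
  induction k with
  | zero => simpa using isBigO_zero _ _
  | succ k ih =>
    have h1 := (h.step_fst k).trans (isBigO_pow_of_le h.tendsto_param (show 2 ≤ 3 by norm_num))
    have h2 := isBigO_sub_of_contDiffAt (hX.of_le (by simp)) (h.tendsto_mid k) (h.tendsto_fst 0)
    have h3 : (fun b => (y b k).1 + (1 / 2 : ℝ) • ((y b (k + 1)).1 - (y b k).1) - (y b 0).1)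
        =O[l] ħ := by
      refine ((isBigO_const_smul (1 / 2) (h.isBigO_fst_sub hX hJ k)).add
        (isBigO_const_smul (1 / 2) (h.isBigO_fst_sub hX hJ (k + 1)))).congr_left fun b => ?_
      module
    have h4 := ((isBigO_refl ħ l).smul (h2.trans h3)).congr_right
      (g₂ := fun b => ħ b ^ 2) fun b => by simp [sq]
    have h5 := ((isBigO_refl (fun b => ħ b ^ 2) l).smul (h.isBigO_shift hJ k))
    simp only [smul_eq_mul, mul_one] at h5
    refine (((h1.add h4).add h5).add ih).congr_left fun b => ?_
    push_cast
    module

/-- A step evaluates `X` at the midpoint, which is `q + (k + 1/2) ħ X` up to `O(ħ²)`; summing `k +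
1/2` gives the `k ^ 2 / 2` of the expansion. The rotating part comes from `shift_rot`. -/
theorem isBigO_fst_sub_orbitExpansion (h : IsApproxOrbit l X J θ ħ q₀ y) [CompleteSpace E]
    (hX : ContDiffAt ℝ ∞ X q₀) (hJ : ContDiffAt ℝ ∞ J q₀)
    (hsq : ∀ᶠ b in l, ∀ v, J (y b 0).1 (J (y b 0).1 v) = -v) (k : ℕ) :
    (fun b => (y b k).1 - orbitExpansion X (J (y b 0).1) θ (ħ b) (y b 0).1 (y b 0).2 k)
      =O[l] fun b => ħ b ^ 3 := by
  induction k with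
  | zero => simpa [orbitExpansion, rot_zero] using isBigO_zero _ _
  | succ k ih =>
    set m : ι → E := fun b => (y b k).1 + (1 / 2 : ℝ) • ((y b (k + 1)).1 - (y b k).1) with hm
    have hmid : (fun b => m b - (y b 0).1) =O[l] ħ := by
      refine ((isBigO_const_smul (1 / 2) (h.isBigO_fst_sub hX hJ k)).add
        (isBigO_const_smul (1 / 2) (h.isBigO_fst_sub hX hJ (k + 1)))).congr_left fun b => ?_
      simp only [hm]; module
    have hmid2 : (fun b => m b - (y b 0).1 - ((k + 1 / 2) * ħ b) • X (y b 0).1)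
        =O[l] fun b => ħ b ^ 2 := by
      refine ((isBigO_const_smul (1 / 2) (h.isBigO_fst_sub_sq hX hJ k)).add
        (isBigO_const_smul (1 / 2) (h.isBigO_fst_sub_sq hX hJ (k + 1)))).congr_left fun b => ?_
      simp only [hm]; push_cast; module
    have h1 := h.step_fst k
    have h2 := ((isBigO_taylor hX).comp_tendsto
      ((h.tendsto_fst 0).prodMk_nhds (h.tendsto_mid k))).trans (hmid.norm_left.pow 2)
    have hDX : (fun b => fderiv ℝ X (y b 0).1) =O[l] fun _ => (1 : ℝ) :=
      isBigO_one_of_contDiffAt (contDiffAt_fderiv hX) (h.tendsto_fst 0)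
    have h3 := isBigO_clm_apply hDX hmid2
    simp only [one_mul] at h3
    have h4 := ((isBigO_refl ħ l).smul (h2.add h3)).congr_right
      (g₂ := fun b => ħ b ^ 3) fun b => by simp; ring
    have hsn := h.isBigO_snd_sub hX hJ hsq k
    have h5 : (fun b => shift θ (J (y b k).1) (y b k).2 -
        shift θ (J (y b 0).1) (rot (k * θ) (J (y b 0).1) (y b 0).2)) =O[l] ħ := by
      have g1 := isBigO_sub_of_contDiffAt (hJ.of_le (by simp)) (h.tendsto_fst k) (h.tendsto_fst 0)
      have g2 := isBigO_clm_apply (g1.trans (h.isBigO_fst_sub hX hJ k)) (h.isBigO_snd_one k)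
      have g3 := isBigO_clm_apply (isBigO_one_of_contDiffAt hJ (h.tendsto_fst 0)) hsn
      simp only [mul_one, one_mul] at g2 g3
      refine (((isBigO_const_smul (1 - Real.cos θ) g2).add
        (isBigO_const_smul (1 - Real.cos θ) g3)).sub
        (isBigO_const_smul (Real.sin θ) hsn)).congr_left fun b => ?_
      simp only [shift, sub_apply, map_sub]
      module
    have h6 := ((isBigO_refl (fun b => ħ b ^ 2) l).smul h5).congr_right
      (g₂ := fun b => ħ b ^ 3) fun b => by simp; ring
    refine (((h1.add h4).add h6).add ih).congr' ?_ EventuallyEq.rfl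
    filter_upwards [hsq] with b hb
    rw [shift_rot hb]
    simp only [Function.comp_apply, orbitExpansion, map_sub, map_smul, hm]
    rw [show ((k + 1 : ℕ) : ℝ) * θ = k * θ + θ by push_cast; ring]
    push_cast
    module

end IsApproxOrbit

end OrbitExpansion

end SymplecticLorentz

namespace SymplecticLorentz

open Filter Asymptotics

/-! ### The loop action to leading order. -/

section LeadingOrder

set_option linter.unusedSectionVars false
set_option maxSynthPendingDepth 3

universe u

theorem integral_trig_quadratic (c₁ c₂ c₃ c₄ c₅ c₆ : ℝ) :
    ∫ φ in (0 : ℝ)..2 * Real.pi, (c₁ * Real.cos φ + c₂ * Real.sin φ + c₃ * Real.cos φ ^ 2 +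
      c₄ * (Real.sin φ * Real.cos φ) + c₅ * Real.sin φ ^ 2 + c₆) =
      Real.pi * (c₃ + c₅ + 2 * c₆) := by
  have hd : ∀ φ ∈ uIcc 0 (2 * Real.pi), HasDerivAt (fun φ : ℝ => c₁ * Real.sin φ -
      c₂ * Real.cos φ + (c₃ / 2) * (φ + Real.sin φ * Real.cos φ) + (c₄ / 2) * Real.sin φ ^ 2 +
      (c₅ / 2) * (φ - Real.sin φ * Real.cos φ) + c₆ * φ)
      (c₁ * Real.cos φ + c₂ * Real.sin φ + c₃ * Real.cos φ ^ 2 +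
      c₄ * (Real.sin φ * Real.cos φ) + c₅ * Real.sin φ ^ 2 + c₆) φ := by
    intro φ _
    have hs := Real.hasDerivAt_sin φ
    have hc := Real.hasDerivAt_cos φ
    have hi := hasDerivAt_id φ
    have hsc := hs.fun_mul hc
    have h1 := (((((hs.const_mul c₁).fun_sub (hc.const_mul c₂)).fun_add
      ((hi.fun_add hsc).const_mul (c₃ / 2))).fun_add ((hs.fun_pow 2).const_mul (c₄ / 2))).fun_add
      ((hi.fun_sub hsc).const_mul (c₅ / 2))).fun_add (hi.const_mul c₆)
    refine h1.congr_deriv ?_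
    have := Real.sin_sq_add_cos_sq φ
    norm_num
    linear_combination ((c₃ + c₅) / 2) * (-this)
  rw [intervalIntegral.integral_eq_sub_of_hasDerivAt hd
    (Continuous.intervalIntegrable (by fun_prop) _ _)]
  simp
  ring

variable {E : Type u} [NormedAddCommGroup E] [NormedSpace ℝ E] [FiniteDimensional ℝ E]
  {Q : Set E} {ϑ : E → E →L[ℝ] ℝ} {J : E → E →L[ℝ] E} {H : E → ℝ} {θ : ℝ}

theorem IsAdmissible.metricL_rot (h : IsAdmissible Q ϑ J H) {q : E} (hq : q ∈ Q) (φ : ℝ) (u : E) :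
    metricL ϑ J q (rot φ (J q) u) (rot φ (J q) u) = metricL ϑ J q u u := by
  have h1 : metricL ϑ J q (J q u) u = 0 := by rw [h.metricL_J hq, omega_self]
  have h2 : metricL ϑ J q u (J q u) = 0 := by rw [h.metricL_symm hq, h1]
  have h3 : metricL ϑ J q (J q u) (J q u) = metricL ϑ J q u u := by
    rw [h.metricL_J hq, metricL_apply, metric]
  simp only [rot_apply, map_sub, map_smul, sub_apply, smul_apply, h1, h2, h3, smul_eq_mul]
  linear_combination metricL ϑ J q u u * Real.sin_sq_add_cos_sq φ

/-- The leading part of the loop action. -/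
theorem IsAdmissible.integral_leading (h : IsAdmissible Q ϑ J H) {q : E} (hq : q ∈ Q) (u : E) :
    ∫ φ in (0 : ℝ)..2 * Real.pi, (fderiv ℝ ϑ q (J q u - rot φ (J q) (J q u)) (rot φ (J q) u) +
      metricL ϑ J q (rot φ (J q) u) (rot φ (J q) u)) = Real.pi * metric ϑ J q u u := by
  set B := fderiv ℝ ϑ q with hB
  have h1 : ∀ φ : ℝ, B (J q u - rot φ (J q) (J q u)) (rot φ (J q) u) +
      metricL ϑ J q (rot φ (J q) u) (rot φ (J q) u) =
      B (J q u) u * Real.cos φ + -B (J q u) (J q u) * Real.sin φ +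
        -B (J q u) u * Real.cos φ ^ 2 + (B (J q u) (J q u) - B u u) * (Real.sin φ * Real.cos φ) +
        B u (J q u) * Real.sin φ ^ 2 + metric ϑ J q u u := by
    intro φ
    rw [h.metricL_rot hq, metricL_apply]
    simp only [rot_apply, h.compatible.sq_eq_neg q hq, map_sub, map_smul, map_neg, sub_apply,
      smul_apply, neg_apply, smul_eq_mul]
    ring
  -- Up to the factor `π`, integration leaves `B u (J u) - B (J u) u = -g(u, u)` from `B`, against
  -- `2 g(u, u)` from the metric term.
  have h2 : metric ϑ J q u u = B (J q u) u - B u (J q u) := by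
    simp [metric, omega, hB]
  simp only [h1]
  rw [integral_trig_quadratic, h2]
  ring

variable {ι : Type*} {l : Filter ι} {ħ e : ι → ℝ} {y : ι → ℕ → E × E}

/-- The loop action of an orbit is, to leading order, the squared norm of the relative velocity. -/
theorem IsApproxOrbit.isBigO_loopAction (h : IsAdmissible Q ϑ J H) {q₀ : E} (hq₀ : q₀ ∈ Q)
    (hy : IsApproxOrbit l (hamVF ϑ H) J θ ħ q₀ y) (he : Tendsto e l (𝓝 0))
    (hħ : ħ =O[l] fun b => e b ^ 2) (hu : (fun b => (y b 0).2) =O[l] e)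
    {D K : ℕ} {a a' : ℕ → ℝ → ℝ} (ha : IsWeights θ D K a a') (hD : 2 ≤ D) :
    (fun b => loopAction (relForm ϑ J H) (ħ b) (fun φ => wavg K a φ (y b))
        (fun φ => wavg K a' φ (y b)) +
      Real.pi * ħ b ^ 4 * metric ϑ J (y b 0).1 (y b 0).2 (y b 0).2) =O[l] fun b => e b ^ 11 := by
  have : CompleteSpace E := FiniteDimensional.complete ℝ E
  obtain ⟨C, hC⟩ := ha.exists_bound
  have hC1 : ∀ k < K, ∀ φ, |a k φ| ≤ C := fun k hk φ => (hC k hk φ).1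
  have hC2 : ∀ k < K, ∀ φ, |a' k φ| ≤ C := fun k hk φ => (hC k hk φ).2
  have hXs := h.contDiffAt_hamVF hq₀
  have hJs := h.contDiffAt_J hq₀
  have hqQ : ∀ᶠ b in l, (y b 0).1 ∈ Q := (hy.tendsto_fst 0).eventually (h.isOpen.mem_nhds hq₀)
  have hsq : ∀ᶠ b in l, ∀ v, J (y b 0).1 (J (y b 0).1 v) = -v :=
    hqQ.mono fun b hb => h.compatible.sq_eq_neg _ hb
  set L : Filter (ι × ℝ) := l ×ˢ ⊤ with hL
  set eL : ι × ℝ → ℝ := fun x => e x.1 with heL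
  have hfst : Tendsto (Prod.fst : ι × ℝ → ι) L l := Filter.tendsto_fst
  have heL0 : Tendsto eL L (𝓝 0) := he.comp hfst
  set q : ι × ℝ → E := fun x => (y x.1 0).1 with hq
  set u : ι × ℝ → E := fun x => (y x.1 0).2 with hu'
  set γ : ι × ℝ → E × E := fun x => wavg K a x.2 (y x.1) with hγ
  set γ' : ι × ℝ → E × E := fun x => wavg K a' x.2 (y x.1) with hγ'
  set R : ι × ℝ → E := fun x => rot x.2 (J (q x)) (u x) with hR
  set δ₀ : ι × ℝ → E := fun x => ħ x.1 ^ 2 • (J (q x) (u x) - rot x.2 (J (q x)) (J (q x) (u x)))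
    with hδ₀
  have hqL : ∀ᶠ x in L, q x ∈ Q := hfst.eventually hqQ
  have hqt : Tendsto q L (𝓝 q₀) := (hy.tendsto_fst 0).comp hfst
  have huO : u =O[L] eL := hu.comp_tendsto hfst
  have hħO : (fun x : ι × ℝ => ħ x.1) =O[L] fun x => eL x ^ 2 := hħ.comp_tendsto hfst
  have hħ2 : (fun x : ι × ℝ => ħ x.1 ^ 2) =O[L] fun x => eL x ^ 4 :=
    (hħO.pow 2).congr_right fun x => by ring
  have hJO : (fun x => J (q x)) =O[L] fun _ => (1 : ℝ) := isBigO_one_of_contDiffAt hJs hqt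
  have hJu : (fun x => J (q x) (u x)) =O[L] eL := by simpa using isBigO_clm_apply hJO huO
  have hrot : ∀ {v : ι × ℝ → E}, v =O[L] eL → (fun x => rot x.2 (J (q x)) (v x)) =O[L] eL := by
    intro v hv
    have h1 : (fun x : ι × ℝ => Real.cos x.2) =O[L] fun _ => (1 : ℝ) :=
      IsBigO.of_bound 1 (Eventually.of_forall fun x => by simpa using Real.abs_cos_le_one x.2)
    have h2 : (fun x : ι × ℝ => Real.sin x.2) =O[L] fun _ => (1 : ℝ) :=
      IsBigO.of_bound 1 (Eventually.of_forall fun x => by simpa using Real.abs_sin_le_one x.2)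
    have h3 := h1.smul hv
    have h4 := h2.smul (isBigO_clm_apply hJO hv)
    simp only [smul_eq_mul, one_mul] at h3 h4
    exact (h3.sub h4).congr_left fun x => (rot_apply _ _ _).symm
  have hRO : R =O[L] eL := hrot huO
  have hδ₀O : δ₀ =O[L] fun x => eL x ^ 5 :=
    (hħ2.smul (hJu.sub (hrot hJu))).congr_right fun x => by simp; ring
  have hδ₀'O : (fun x => ħ x.1 ^ 2 • R x) =O[L] fun x => eL x ^ 5 :=
    (hħ2.smul hRO).congr_right fun x => by simp; ring
  have hexp : ∀ k, (fun b => (y b k).1 - orbitExpansion (hamVF ϑ H) (J (y b 0).1) θ (ħ b) (y b 0).1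
      (y b 0).2 k) =O[l] fun b => e b ^ 6 := fun k =>
    (hy.isBigO_fst_sub_orbitExpansion hXs hJs hsq k).trans
      ((hħ.pow 3).congr_right fun b => by ring)
  have hfw : ∀ (c : ℕ → ℝ → ℝ) (x : ι × ℝ), (wavg K c x.2 (y x.1)).1 =
      wavg K c x.2 fun k => (y x.1 k).1 := fun c x =>
    (wavg_clm K c x.2 (ContinuousLinearMap.fst ℝ E E) (y x.1)).symm
  have hsw : ∀ (c : ℕ → ℝ → ℝ) (x : ι × ℝ), (wavg K c x.2 (y x.1)).2 =
      wavg K c x.2 fun k => (y x.1 k).2 := fun c x =>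
    (wavg_clm K c x.2 (ContinuousLinearMap.snd ℝ E E) (y x.1)).symm
  -- With `ħ = O(e²)` and `u = O(e)`, the base component of the loop deviates from `q` by `O(e ^ 5)`
  -- and is known up to `e ^ 6`; its fibre component is known up to `e ^ 2`.
  have A1 : (fun x => (γ x).1 - q x - δ₀ x) =O[L] fun x => eL x ^ 6 := by
    refine (isBigO_wavg hC1 hexp).congr_left fun x => ?_
    rw [wavg_sub, ha.wavg_orbitExpansion hD]
    simp only [hγ, hfw, hδ₀, hq, hu']
    abel
  have A2 : (fun x => (γ' x).1 + ħ x.1 ^ 2 • R x) =O[L] fun x => eL x ^ 6 := by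
    refine (isBigO_wavg hC2 hexp).congr' ?_ EventuallyEq.rfl
    filter_upwards [hfst.eventually hsq] with x hx
    rw [wavg_sub, ha.wavg_deriv_orbitExpansion hD _ hx]
    simp only [hγ', hfw, hR, hq, hu']
    abel
  have A3 : (fun x => (γ x).2 - R x) =O[L] fun x => eL x ^ 2 := by
    have h1 : ∀ k, (fun b => (y b k).2 - rot (k * θ) (J (y b 0).1) (y b 0).2) =O[l]
        fun b => e b ^ 2 := fun k => (hy.isBigO_snd_sub hXs hJs hsq k).trans hħ
    refine (isBigO_wavg hC1 h1).congr_left fun x => ?_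
    rw [wavg_sub, ha.wavg_rot]
    simp only [hγ, hsw, hR, hq, hu']
  have A4 : (fun x => (γ x).1 - q x) =O[L] fun x => eL x ^ 5 :=
    ((A1.trans (isBigO_pow_of_le heL0 (show 5 ≤ 6 by norm_num))).add hδ₀O).congr_left
      fun x => sub_add_cancel _ _
  have A5 : (fun x => (γ' x).1) =O[L] fun x => eL x ^ 5 :=
    ((A2.trans (isBigO_pow_of_le heL0 (show 5 ≤ 6 by norm_num))).sub hδ₀'O).congr_left
      fun x => add_sub_cancel_right _ _
  have A6 : (fun x => (γ x).2) =O[L] eL := by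
    have h1 := A3.trans (isBigO_pow_of_le heL0 one_le_two)
    simp only [pow_one] at h1
    exact (h1.add hRO).congr_left fun x => sub_add_cancel _ _
  have hγt : Tendsto (fun x => (γ x).1) L (𝓝 q₀) := by
    have h1 : Tendsto (fun x => (γ x).1 - q x) L (𝓝 0) :=
      A4.trans_tendsto (by simpa using heL0.pow 5)
    simpa using h1.add hqt
  have hγt2 : Tendsto (fun x => (γ x).2) L (𝓝 0) := A6.trans_tendsto heL0
  have hB : (fun x => fderiv ℝ ϑ (q x)) =O[L] fun _ => (1 : ℝ) :=
    isBigO_one_of_contDiffAt (contDiffAt_fderiv (h.contDiffAt_theta hq₀)) hqt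
  have hg : (fun x => metricL ϑ J (q x)) =O[L] fun _ => (1 : ℝ) :=
    isBigO_one_of_contDiffAt (h.contDiffAt_metricL hq₀) hqt
  -- The seven errors come from the Taylor remainder of `ϑ`, from replacing the base loop and its
  -- velocity by their leading parts, from freezing the metric terms at `q`, and from replacing the
  -- fibre component by the rotated velocity. The lowest order is `11`, one more than the order of
  -- the main term.
  have T1 := isBigO_clm_apply (((isBigO_taylor (h.contDiffAt_theta hq₀)).comp_tendsto
    (hqt.prodMk_nhds hγt)).trans (A4.norm_left.pow 2)) A5
  have T2 := isBigO_clm_apply (isBigO_clm_apply hB A1) A5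
  have T3 := isBigO_clm_apply (isBigO_clm_apply hB hδ₀O) A2
  have T4 := hħ2.smul (isBigO_clm_apply ((isBigO_sub_of_contDiffAt
    (f := fun p => metricL ϑ J p (hamVF ϑ H p)) (((h.contDiffAt_metricL hq₀).clm_apply hXs).of_le
    (by simp)) hγt hqt).trans A4) A5)
  have T5 := hħ2.smul (isBigO_clm_apply (h.isBigO_metricL_sub hq₀ hγt hqt A4 A6) A5)
  have T6 := hħ2.smul (isBigO_clm_apply (isBigO_clm_apply hg A3) A5)
  have T7 := hħ2.smul (isBigO_clm_apply (isBigO_clm_apply hg hRO) A2)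
  have hp : ∀ {m : ℕ}, 11 ≤ m → (fun x => eL x ^ m) =O[L] fun x => eL x ^ 11 :=
    fun hm => isBigO_pow_of_le heL0 hm
  have hsum := ((((((T1.trans ((hp (show 11 ≤ 15 by norm_num)).congr_left fun x => by ring)).add
    (T2.trans ((hp le_rfl).congr_left fun x => by ring))).add
    (T3.trans ((hp le_rfl).congr_left fun x => by ring))).add
    (T4.trans ((hp (show 11 ≤ 14 by norm_num)).congr_left fun x => by simp only [smul_eq_mul]; ring))).add
    (T5.trans ((hp (show 11 ≤ 15 by norm_num)).congr_left fun x => by simp only [smul_eq_mul]; ring))).add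
    (T6.trans ((hp le_rfl).congr_left fun x => by simp only [smul_eq_mul]; ring))).add
    (T7.trans ((hp le_rfl).congr_left fun x => by simp only [smul_eq_mul]; ring))
  have hmain : (fun x : ι × ℝ => relForm ϑ J H (ħ x.1, γ x) (γ' x) -
      (ϑ (q x) + ħ x.1 ^ 2 • metricL ϑ J (q x) (hamVF ϑ H (q x))) (γ' x).1 +
      ħ x.1 ^ 4 * (fderiv ℝ ϑ (q x) (J (q x) (u x) - rot x.2 (J (q x)) (J (q x) (u x))) (R x) +
        metricL ϑ J (q x) (R x) (R x))) =O[L] fun x => eL x ^ 11 := by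
    refine hsum.congr_left fun x => ?_
    simp only [Function.comp_apply, relForm, hδ₀, ContinuousLinearMap.comp_apply,
      ContinuousLinearMap.coe_fst', add_apply, sub_apply, smul_apply, map_add, map_sub, map_smul,
      smul_eq_mul]
    ring
  have hint := isBigO_integral (e := fun b => e b ^ 11) hmain
  refine hint.congr' ?_ EventuallyEq.rfl
  have hTs : ContDiffAt ℝ 1 (relForm ϑ J H) (0, (q₀, 0)) := h.contDiffAt_relForm hq₀
  have hTc : ∀ᶠ z in 𝓝 ((0 : ℝ), ((q₀, 0) : E × E)), ContinuousAt (relForm ϑ J H) z :=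
    (hTs.eventually (by simp)).mono fun z hz => hz.continuousAt
  have hpt : Tendsto (fun x : ι × ℝ => (ħ x.1, γ x)) L (𝓝 (0, (q₀, 0))) :=
    (hy.tendsto_param.comp hfst).prodMk_nhds (hγt.prodMk_nhds hγt2)
  filter_upwards [eventually_prod_top_iff.1 (hpt.eventually hTc), hqQ] with b hb hbQ
  have hγc : Continuous fun φ => wavg K a φ (y b) := ha.continuous_wavg (y b)
  have hγc' : Continuous fun φ => wavg K a' φ (y b) := ha.continuous_wavg_deriv (y b)
  have hi1 : Continuous fun φ => relForm ϑ J H (ħ b, γ (b, φ)) (γ' (b, φ)) := by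
    have h1 : Continuous fun φ => relForm ϑ J H (ħ b, γ (b, φ)) :=
      continuous_iff_continuousAt.2 fun φ =>
        ContinuousAt.comp (g := relForm ϑ J H) (f := fun φ => (ħ b, γ (b, φ))) (hb φ)
          (continuous_const.prodMk hγc).continuousAt
    exact h1.clm_apply hγc'
  -- `α` has constant coefficients, so its integral over the closed loop vanishes; this removes
  -- terms of order `e ^ 5`, which would dominate the main term.
  set α : E →L[ℝ] ℝ := ϑ (y b 0).1 + ħ b ^ 2 • metricL ϑ J (y b 0).1 (hamVF ϑ H (y b 0).1) with hα
  have hi2 : Continuous fun φ => α (γ' (b, φ)).1 := α.continuous.comp hγc'.fst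
  have hrc : ∀ v, Continuous fun φ : ℝ => rot φ (J (y b 0).1) v := fun v => by
    simp only [rot_apply]
    fun_prop
  have hi3 : Continuous fun φ => ħ b ^ 4 * (fderiv ℝ ϑ (y b 0).1 (J (y b 0).1 (y b 0).2 -
      rot φ (J (y b 0).1) (J (y b 0).1 (y b 0).2)) (rot φ (J (y b 0).1) (y b 0).2) +
      metricL ϑ J (y b 0).1 (rot φ (J (y b 0).1) (y b 0).2)
        (rot φ (J (y b 0).1) (y b 0).2)) := by
    refine continuous_const.mul (Continuous.add ?_ ?_)
    · exact ((ContinuousLinearMap.continuous _).comp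
        (continuous_const.sub (hrc _))).clm_apply (hrc _)
    · exact ((ContinuousLinearMap.continuous _).comp (hrc _)).clm_apply (hrc _)
  have hA : ∫ φ in (0 : ℝ)..2 * Real.pi, α (γ' (b, φ)).1 = 0 := by
    have hd : ∀ φ ∈ uIcc 0 (2 * Real.pi), HasDerivAt (fun φ => α (wavg K a φ (y b)).1)
        (α (γ' (b, φ)).1) φ := fun φ _ => by
      have h1 := (α.comp (ContinuousLinearMap.fst ℝ E E)).hasFDerivAt.comp_hasDerivAt φ
        (ha.hasDerivAt_wavg φ (y b))
      exact h1
    rw [intervalIntegral.integral_eq_sub_of_hasDerivAt hd (hi2.intervalIntegrable _ _),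
      ha.wavg_periodic, sub_self]
  have hM := h.integral_leading hbQ (y b 0).2
  have hsplit := intervalIntegral.integral_add ((hi1.fun_sub hi2).intervalIntegrable 0 (2 * Real.pi))
    (hi3.intervalIntegrable 0 (2 * Real.pi)) (μ := MeasureTheory.volume)
  have hsplit2 := intervalIntegral.integral_sub (hi1.intervalIntegrable 0 (2 * Real.pi))
    (hi2.intervalIntegrable 0 (2 * Real.pi)) (μ := MeasureTheory.volume)
  rw [intervalIntegral.integral_const_mul, hM] at hsplit
  rw [hA, sub_zero] at hsplit2
  refine hsplit.trans ?_
  rw [hsplit2, loopAction]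
  ring

end LeadingOrder

end SymplecticLorentz

namespace SymplecticLorentz

open Filter Asymptotics

/-! ### Uniform estimates on compact sets and long-time stability. -/

section Stability

set_option linter.unusedSectionVars false

universe u

variable {E : Type u} [NormedAddCommGroup E] [NormedSpace ℝ E]
  {Q : Set E} {ϑ : E → E →L[ℝ] ℝ} {J : E → E →L[ℝ] E} {H : E → ℝ} {θ : ℝ}

/-- No smallness of `u` has to be imposed separately: for small `ħ` the bound `‖u‖ ≤ M √ħ` already
forces `u` into a given neighbourhood of `0`. -/
theorem exists_nhds_of_eventually_relFilter {q₀ : E} {M : ℝ} {P : ℝ × (E × E) → Prop}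
    (h : ∀ᶠ z in relFilter q₀ M, P z) : ∃ t ∈ 𝓝 q₀, ∃ ε > 0, ∀ ħ q u, 0 < ħ → ħ < ε → q ∈ t →
      ‖u‖ ≤ M * √ħ → P (ħ, (q, u)) := by
  rw [relFilter, eventually_inf_principal, nhds_prod_eq, nhds_prod_eq] at h
  obtain ⟨A, hA, B, hB, hAB⟩ := eventually_prod_iff.1 h
  obtain ⟨B₁, hB₁, B₂, hB₂, hBB⟩ := eventually_prod_iff.1 hB
  have h1 : Tendsto (fun ħ : ℝ => M * √ħ) (𝓝 0) (𝓝 0) := by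
    have : Continuous fun ħ : ℝ => M * √ħ := by fun_prop
    simpa using this.tendsto 0
  obtain ⟨r, hr, hrB⟩ := Metric.eventually_nhds_iff.1 hB₂
  obtain ⟨ε, hε, hεP⟩ := Metric.eventually_nhds_iff.1 (hA.and (h1.eventually (gt_mem_nhds hr)))
  refine ⟨{q | B₁ q}, hB₁, ε, hε, fun ħ q u h0 hlt hq hu => ?_⟩
  have h2 := hεP (y := ħ) (by simpa [abs_of_pos h0] using hlt)
  exact hAB h2.1 (hBB hq (hrB (by simpa using hu.trans_lt h2.2))) ⟨h0, hu⟩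

/-- Estimates near every point of a compact set are uniform on the compact set. -/
theorem exists_uniform_of_isCompact {K : Set E} (hK : IsCompact K) (M : ℝ)
    {P : ℝ → ℝ × (E × E) → Prop} (hP : ∀ C C' z, C ≤ C' → P C z → P C' z)
    (h : ∀ q₀ ∈ K, ∃ C, ∀ᶠ z in relFilter q₀ M, P C z) :
    ∃ C, ∃ ε > 0, ∀ ħ q u, 0 < ħ → ħ < ε → q ∈ K → ‖u‖ ≤ M * √ħ → P C (ħ, (q, u)) := by
  refine hK.induction_on (p := fun t => ∃ C, ∃ ε > 0, ∀ ħ q u, 0 < ħ → ħ < ε →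
    q ∈ t → ‖u‖ ≤ M * √ħ → P C (ħ, (q, u))) ?_ ?_ ?_ ?_
  · exact ⟨0, 1, one_pos, fun ħ q u _ _ hq => absurd hq (notMem_empty _)⟩
  · rintro s t hst ⟨C, ε, hε, hC⟩
    exact ⟨C, ε, hε, fun ħ q u h0 h1 hq => hC ħ q u h0 h1 (hst hq)⟩
  · rintro s t ⟨C₁, ε₁, hε₁, hC₁⟩ ⟨C₂, ε₂, hε₂, hC₂⟩
    refine ⟨max C₁ C₂, min ε₁ ε₂, lt_min hε₁ hε₂, fun ħ q u h0 h1 hq hu => ?_⟩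
    rcases hq with hq | hq
    · exact hP _ _ _ (le_max_left _ _) (hC₁ ħ q u h0 (h1.trans_le (min_le_left _ _)) hq hu)
    · exact hP _ _ _ (le_max_right _ _) (hC₂ ħ q u h0 (h1.trans_le (min_le_right _ _)) hq hu)
  · intro q₀ hq₀
    obtain ⟨C, hC⟩ := h q₀ hq₀
    obtain ⟨t, ht, ε, hε, hCt⟩ := exists_nhds_of_eventually_relFilter hC
    exact ⟨t, mem_nhdsWithin_of_mem_nhds ht, C, ε, hε, hCt⟩

/-- The action of the loop through the orbit of a point. -/
noncomputable def orbitAction (ϑ : E → E →L[ℝ] ℝ) (J : E → E →L[ℝ] E) (H : E → ℝ)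
    (Ψ : ℝ → E × E → E × E) (K : ℕ) (a a' : ℕ → ℝ → ℝ) (z : ℝ × (E × E)) : ℝ :=
  loopAction (relForm ϑ J H) z.1 (fun φ => wavg K a φ (relOrbit ϑ H Ψ z))
    (fun φ => wavg K a' φ (relOrbit ϑ H Ψ z))

theorem IsRelChart.isApproxOrbit {Ψ : ℝ → E × E → E × E} {q₀ : E} {f : ℝ × (E × E) → E × E}
    {s : ℝ → E × E → ℝ} (hf : IsRelChart ϑ J H θ Ψ q₀ f s) (M : ℝ) :
    IsApproxOrbit (relFilter q₀ M) (hamVF ϑ H) J θ (fun z : ℝ × (E × E) => z.1) q₀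
      (relOrbit ϑ H Ψ) :=
  ⟨tendsto_fst_relFilter q₀ M, hf.tendsto_relOrbit M, hf.isBigO_relOrbit_step_fst M,
    hf.isBigO_relOrbit_step_snd M⟩

variable [FiniteDimensional ℝ E] {U : Set (ℝ × (E × E))} {Ψ : ℝ → E × E → E × E}

namespace IsAdmissible

/-- A crude bound for one step, possibly with a constant worse than `M`. It makes the action
estimates available at the next point, before the invariant restores the constant. -/
theorem exists_norm_relMap_le (h : IsAdmissible Q ϑ J H) (hθ : 1 - Real.cos θ ≠ 0)
    (hΨ : IsSymplecticLorentzMap Q ϑ J H θ U Ψ) {K : Set E} (hK : IsCompact K) (hKQ : K ⊆ Q)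
    (M : ℝ) : ∃ C, ∃ ε > 0, ∀ ħ q u, 0 < ħ → ħ < ε → q ∈ K → ‖u‖ ≤ M * √ħ →
      ‖(relMap ϑ H Ψ ħ (q, u)).2‖ ≤ C * √ħ := by
  refine exists_uniform_of_isCompact hK M (P := fun C z => ‖(relMap ϑ H Ψ z.1 z.2).2‖ ≤ C * √z.1)
    (fun C C' z hC hz => hz.trans (by gcongr)) fun q₀ hq₀ => ?_
  obtain ⟨f, s, hf⟩ := h.exists_isRelChart hθ hΨ (hKQ hq₀)
  obtain ⟨C, hC⟩ := (hf.isBigO_relOrbit_sub M 1).bound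
  refine ⟨C, hC.mono fun z hz => ?_⟩
  rw [Real.norm_of_nonneg (Real.sqrt_nonneg _)] at hz
  refine le_trans ?_ hz
  have := norm_snd_le (relOrbit ϑ H Ψ z 1 - (z.2.1, 0))
  simpa [relOrbit] using this

/-- The weights do not depend on the base point, so a single function `orbitAction` is estimated
throughout; only the constants come from the local models. -/
theorem exists_orbitAction_estimate (h : IsAdmissible Q ϑ J H) (hθ : 1 - Real.cos θ ≠ 0)
    (hΨ : IsSymplecticLorentzMap Q ϑ J H θ U Ψ) {A : Set E} (hA : IsCompact A) (hAQ : A ⊆ Q)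
    (M : ℝ) {n D K : ℕ} {a a' : ℕ → ℝ → ℝ} (ha : IsWeights θ D K a a')
    (hn : n * orbitDegree n ≤ D) (hD : 2 ≤ D) :
    ∃ C, ∃ ε > 0, ∀ ħ q u, 0 < ħ → ħ < ε → q ∈ A → ‖u‖ ≤ M * √ħ →
      |orbitAction ϑ J H Ψ K a a' (ħ, relMap ϑ H Ψ ħ (q, u)) -
        orbitAction ϑ J H Ψ K a a' (ħ, (q, u))| ≤ C * √ħ ^ n ∧
      |orbitAction ϑ J H Ψ K a a' (ħ, (q, u)) + Real.pi * ħ ^ 4 * metric ϑ J q u u| ≤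
        C * √ħ ^ 11 := by
  refine exists_uniform_of_isCompact hA M (P := fun C z =>
    |orbitAction ϑ J H Ψ K a a' (z.1, relMap ϑ H Ψ z.1 z.2) - orbitAction ϑ J H Ψ K a a' z| ≤
      C * √z.1 ^ n ∧
    |orbitAction ϑ J H Ψ K a a' z + Real.pi * z.1 ^ 4 * metric ϑ J z.2.1 z.2.2 z.2.2| ≤
      C * √z.1 ^ 11)
    (fun C C' z hC hz => ⟨hz.1.trans (by gcongr), hz.2.trans (by gcongr)⟩) fun q₀ hq₀ => ?_
  obtain ⟨f, s, hf⟩ := h.exists_isRelChart hθ hΨ (hAQ hq₀)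
  obtain ⟨C₁, hC₁⟩ := (hf.isBigO_loopAction_relMap h (hAQ hq₀) M n D K a a' hn ha).bound
  obtain ⟨C₂, hC₂⟩ := ((hf.isApproxOrbit M).isBigO_loopAction h (hAQ hq₀)
    (tendsto_sqrt_relFilter q₀ M) (isBigO_fst_relFilter q₀ M) (isBigO_snd_relFilter q₀ M) ha
    hD).bound
  refine ⟨max C₁ C₂, ?_⟩
  filter_upwards [hC₁, hC₂] with z h1 h2
  rw [Real.norm_eq_abs, norm_pow, Real.norm_of_nonneg (Real.sqrt_nonneg _)] at h1 h2
  refine ⟨h1.trans ?_, LE.le.trans (b := C₂ * √z.1 ^ 11) h2 ?_⟩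
  · gcongr; exact le_max_left _ _
  · gcongr; exact le_max_right _ _

/-- The metric is uniformly equivalent to the norm on compact sets. -/
theorem exists_le_metric (h : IsAdmissible Q ϑ J H) {A : Set E} (hA : IsCompact A) (hAQ : A ⊆ Q) :
    ∃ c > 0, ∀ q ∈ A, ∀ u, c * ‖u‖ ^ 2 ≤ metric ϑ J q u u := by
  have : ProperSpace E := FiniteDimensional.proper ℝ E
  have hcpt : IsCompact (A ×ˢ Metric.sphere (0 : E) 1) := hA.prod (isCompact_sphere 0 1)
  have hcont : ContinuousOn (fun p : E × E => metric ϑ J p.1 p.2 p.2)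
      (A ×ˢ Metric.sphere (0 : E) 1) := by
    rintro ⟨q, u⟩ ⟨hq, -⟩
    have h1 : ContinuousAt (fun p : E × E => metricL ϑ J p.1) (q, u) :=
      ContinuousAt.comp (g := metricL ϑ J) (h.contDiffAt_metricL (hAQ hq)).continuousAt
        continuousAt_fst
    exact ((h1.clm_apply continuousAt_snd).clm_apply continuousAt_snd).continuousWithinAt
  -- The set is empty if `A` is empty or `E` is trivial.
  rcases (A ×ˢ Metric.sphere (0 : E) 1).eq_empty_or_nonempty with hemp | hne
  · refine ⟨1, one_pos, fun q hq u => ?_⟩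
    rcases eq_or_ne u 0 with rfl | hu
    · simp [metric]
    · have : (q, (‖u‖⁻¹ : ℝ) • u) ∈ A ×ˢ Metric.sphere (0 : E) 1 :=
        ⟨hq, by simp [norm_smul, norm_ne_zero_iff.2 hu]⟩
      rw [hemp] at this
      exact absurd this (notMem_empty _)
  · obtain ⟨p, hp, hmin⟩ := hcpt.exists_isMinOn hne hcont
    refine ⟨metric ϑ J p.1 p.2 p.2, h.compatible.pos _ (hAQ hp.1) _ ?_, fun q hq u => ?_⟩
    · intro h0
      have := hp.2
      rw [h0] at this
      simp at this
    · rcases eq_or_ne u 0 with rfl | hu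
      · simp [metric]
      · have hu' := norm_ne_zero_iff.2 hu
        have h1 : metric ϑ J p.1 p.2 p.2 ≤ metric ϑ J q (‖u‖⁻¹ • u) (‖u‖⁻¹ • u) :=
          isMinOn_iff.1 hmin (q, ‖u‖⁻¹ • u) ⟨hq, by simp [norm_smul, hu']⟩
        have h2 : metric ϑ J q (‖u‖⁻¹ • u) (‖u‖⁻¹ • u) * ‖u‖ ^ 2 = metric ϑ J q u u := by
          simp only [← metricL_apply, map_smul, smul_apply, smul_eq_mul]
          field_simp
        rw [← h2]
        gcongr

/-- The relative velocity is bounded on compact sets. -/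
theorem exists_velNorm_le (h : IsAdmissible Q ϑ J H) {C : Set (E × E)} (hC : IsCompact C)
    (hCQ : C ⊆ Q ×ˢ (univ : Set E)) :
    ∃ B, ∀ p ∈ C, velNorm ϑ J p.1 (p.2 - hamVF ϑ H p.1) ≤ B := by
  have hcont : ContinuousOn (fun p : E × E => velNorm ϑ J p.1 (p.2 - hamVF ϑ H p.1)) C := by
    intro p hp
    have h1 : ContinuousAt (fun p : E × E => metricL ϑ J p.1) p :=
      ContinuousAt.comp (g := metricL ϑ J) (h.contDiffAt_metricL (hCQ hp).1).continuousAt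
        continuousAt_fst
    have h2 : ContinuousAt (fun p : E × E => p.2 - hamVF ϑ H p.1) p :=
      continuousAt_snd.sub (ContinuousAt.comp (g := hamVF ϑ H)
        (h.contDiffAt_hamVF (hCQ hp).1).continuousAt continuousAt_fst)
    exact (Real.continuous_sqrt.continuousAt.comp
      ((h1.clm_apply h2).clm_apply h2)).continuousWithinAt
  obtain ⟨B, hB⟩ := hC.exists_bound_of_continuousOn hcont
  exact ⟨B, fun p hp => (le_abs_self _).trans (hB p hp)⟩

/-- The relative velocity stays of order `√ħ` over long times. -/
theorem exists_metric_le (h : IsAdmissible Q ϑ J H) (hθ : Irrational (θ / (2 * Real.pi)))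
    (hΨ : IsSymplecticLorentzMap Q ϑ J H θ U Ψ) {A : Set E} (hA : IsCompact A) (hAQ : A ⊆ Q)
    (m : ℕ) (V : ℝ) :
    ∃ ε > 0, ∀ ħ w, 0 < ħ → ħ < ε → (∀ k, ((relMap ϑ H Ψ ħ)^[k] w).1 ∈ A) →
      metric ϑ J w.1 w.2 w.2 ≤ V * ħ → ∀ k : ℕ, k * ħ ^ m ≤ 1 →
      metric ϑ J ((relMap ϑ H Ψ ħ)^[k] w).1 ((relMap ϑ H Ψ ħ)^[k] w).2
        ((relMap ϑ H Ψ ħ)^[k] w).2 ≤ (V + 1) * ħ := by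
  have hθ' := one_sub_cos_ne_zero hθ
  obtain ⟨c, hc, hcA⟩ := h.exists_le_metric hA hAQ
  -- `M` is chosen so that `g(u, u) ≤ (V + 1) ħ` implies `‖u‖ ≤ M √ħ`; the constant `M'` also covers
  -- the image of such a point.
  set M := √((V + 1) / c) with hM
  obtain ⟨C₁, ε₁, hε₁, H₁⟩ := h.exists_norm_relMap_le hθ' hΨ hA hAQ M
  set M' := max M C₁ with hM'
  -- With `e = √ħ`, a drift of order `e ^ (2 m + 11)` in each of `ħ ^ (-m)` steps accumulates to
  -- order `e ^ 11` only.
  set n := 2 * m + 11 with hn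
  obtain ⟨K, a, a', ha⟩ := exists_weights hθ
    (show 1 ≤ max (n * orbitDegree n) 2 from one_le_two.trans (le_max_right _ _))
  obtain ⟨C, ε₂, hε₂, H₂⟩ := h.exists_orbitAction_estimate hθ' hΨ hA hAQ M' ha
    (le_max_left _ _) (le_max_right _ _)
  set B := |C| + 1 with hB
  have hB0 : 0 < B := by positivity
  have hCB : C ≤ B := (le_abs_self C).trans (by linarith)
  -- The bound `ħ < 1 / B ^ 2` gives `B e ^ 11 ≤ ħ ^ 5`, so that errors of order eleven are
  -- absorbed.
  refine ⟨min (min ε₁ ε₂) ((1 / B) ^ 2), lt_min (lt_min hε₁ hε₂) (by positivity),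
    fun ħ w h0 hlt hw hw0 k hk => ?_⟩
  have hlt₁ : ħ < ε₁ := hlt.trans_le ((min_le_left _ _).trans (min_le_left _ _))
  have hlt₂ : ħ < ε₂ := hlt.trans_le ((min_le_left _ _).trans (min_le_right _ _))
  have hlt₃ : ħ < (1 / B) ^ 2 := hlt.trans_le (min_le_right _ _)
  set e := √ħ with he
  have he0 : 0 < e := Real.sqrt_pos.2 h0
  have he2 : e ^ 2 = ħ := Real.sq_sqrt h0.le
  have heB : B * e ≤ 1 := by
    have : e < 1 / B := by
      rw [he, Real.sqrt_lt' (by positivity)]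
      exact hlt₃
    rw [lt_div_iff₀ hB0] at this
    linarith
  set W : ℕ → E × E := fun k => (relMap ϑ H Ψ ħ)^[k] w with hW
  set μ : ℕ → ℝ := fun k => orbitAction ϑ J H Ψ K a a' (ħ, W k) with hμ
  have hnorm : ∀ k, metric ϑ J (W k).1 (W k).2 (W k).2 ≤ (V + 1) * ħ → ‖(W k).2‖ ≤ M * e := by
    intro k hk
    have h1 := (hcA _ (hw k) (W k).2).trans hk
    rw [hM, he, ← Real.sqrt_mul' _ h0.le]
    refine Real.le_sqrt_of_sq_le ?_
    rw [div_mul_eq_mul_div, le_div_iff₀ hc]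
    linarith
  have hlead : ∀ k, ‖(W k).2‖ ≤ M' * e →
      |μ k + Real.pi * ħ ^ 4 * metric ϑ J (W k).1 (W k).2 (W k).2| ≤ B * e ^ 11 := fun k hk =>
    (H₂ ħ (W k).1 (W k).2 h0 hlt₂ (hw k) hk).2.trans (by gcongr)
  have hstep : ∀ k, ‖(W k).2‖ ≤ M' * e → |μ (k + 1) - μ k| ≤ B * e ^ n := fun k hk => by
    have h1 := (H₂ ħ (W k).1 (W k).2 h0 hlt₂ (hw k) hk).1
    have h2 : relMap ϑ H Ψ ħ ((W k).1, (W k).2) = W (k + 1) :=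
      (Function.iterate_succ_apply' _ _ _).symm
    rw [h2] at h1
    exact h1.trans (by gcongr)
  have hMM' : M * e ≤ M' * e := by gcongr; exact le_max_left _ _
  -- Bootstrap in `k`: the bound on the relative velocity and the accumulated drift of the action
  -- are propagated together.
  have hmain : ∀ k : ℕ, k * ħ ^ m ≤ 1 → metric ϑ J (W k).1 (W k).2 (W k).2 ≤ (V + 1) * ħ ∧
      |μ k - μ 0| ≤ k * (B * e ^ n) := by
    intro k
    induction k with
    | zero =>
      intro _
      refine ⟨?_, by simp⟩
      have : metric ϑ J (W 0).1 (W 0).2 (W 0).2 ≤ V * ħ := hw0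
      linarith
    | succ k ih =>
      intro hk
      have hk' : (k : ℝ) * ħ ^ m ≤ 1 := le_trans (by push_cast; gcongr; linarith) hk
      obtain ⟨h1, h2⟩ := ih hk'
      have h3 := (hnorm k h1).trans hMM'
      -- At the next point only the weaker bound with `M'` is known so far.
      have h4 : ‖(W (k + 1)).2‖ ≤ M' * e := by
        have h5 := H₁ ħ (W k).1 (W k).2 h0 hlt₁ (hw k) (hnorm k h1)
        have h6 : relMap ϑ H Ψ ħ ((W k).1, (W k).2) = W (k + 1) :=
          (Function.iterate_succ_apply' _ _ _).symm
        rw [h6] at h5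
        exact h5.trans (by gcongr; exact le_max_right _ _)
      have h5 : |μ (k + 1) - μ 0| ≤ ((k + 1 : ℕ) : ℝ) * (B * e ^ n) := by
        calc |μ (k + 1) - μ 0| ≤ |μ (k + 1) - μ k| + |μ k - μ 0| := abs_sub_le _ _ _
          _ ≤ B * e ^ n + k * (B * e ^ n) := add_le_add (hstep k h3) h2
          _ = _ := by push_cast; ring
      refine ⟨?_, h5⟩
      have hW0 : ‖(W 0).2‖ ≤ M' * e := (hnorm 0 (by
        have : metric ϑ J (W 0).1 (W 0).2 (W 0).2 ≤ V * ħ := hw0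
        linarith)).trans hMM'
      have h6 : ((k + 1 : ℕ) : ℝ) * (B * e ^ n) ≤ B * e ^ 11 := by
        have h7 : ((k + 1 : ℕ) : ℝ) * (B * e ^ n) = (((k + 1 : ℕ) : ℝ) * ħ ^ m) * (B * e ^ 11) := by
          rw [← he2, hn]; ring
        rw [h7]
        exact mul_le_of_le_one_left (by positivity) hk
      have h8 := abs_le.1 (hlead 0 hW0)
      have h9 := abs_le.1 (hlead (k + 1) h4)
      have h10 := abs_le.1 (h5.trans h6)
      have hw0' : metric ϑ J (W 0).1 (W 0).2 (W 0).2 ≤ V * ħ := hw0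
      -- Two errors come from the leading-order formula at the endpoints, and one from the drift of
      -- the action.
      have h11 : Real.pi * ħ ^ 4 * (metric ϑ J (W (k + 1)).1 (W (k + 1)).2 (W (k + 1)).2 -
          metric ϑ J (W 0).1 (W 0).2 (W 0).2) ≤ 3 * (B * e ^ 11) := by
        rw [mul_sub]; linarith [h8.1, h8.2, h9.1, h9.2, h10.1, h10.2]
      have h12 : B * e ^ 11 ≤ ħ ^ 4 * ħ := by
        have : B * e ^ 11 = (B * e) * (e ^ 2) ^ 5 := by ring
        rw [this, he2, ← pow_succ]
        exact mul_le_of_le_one_left (by positivity) heB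
      have h13 : 0 < ħ ^ 4 := by positivity
      have h14 : Real.pi * (metric ϑ J (W (k + 1)).1 (W (k + 1)).2 (W (k + 1)).2 -
          metric ϑ J (W 0).1 (W 0).2 (W 0).2) ≤ 3 * ħ := by
        refine le_of_mul_le_mul_left ?_ h13
        calc _ = Real.pi * ħ ^ 4 * (metric ϑ J (W (k + 1)).1 (W (k + 1)).2 (W (k + 1)).2 -
              metric ϑ J (W 0).1 (W 0).2 (W 0).2) := by ring
          _ ≤ 3 * (B * e ^ 11) := h11
          _ ≤ _ := by linarith
      -- As `π > 3`, the increase `3 ħ / π` is smaller than `ħ`.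
      have hpi := Real.pi_gt_three
      by_contra hcon
      push Not at hcon
      nlinarith
  exact (hmain k hk).1

end IsAdmissible

end Stability

end SymplecticLorentz
-- Conclusion: existence and stability.
theorem mainTheorem9 {E : Type*} [NormedAddCommGroup E] [NormedSpace ℝ E]
    [FiniteDimensional ℝ E] (Q : Set E) (hQo : IsOpen Q) (hQc : IsConnected Q)
    (ϑ : E → E →L[ℝ] ℝ) (hϑ : SymplecticLorentz.IsExactSymplectic Q ϑ)
    (J : E → E →L[ℝ] E) (hJ : SymplecticLorentz.IsCompatibleComplexStructure Q ϑ J)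
    (H : E → ℝ) (hH : ContDiffOn ℝ ∞ H Q)
    (θ₀ : ℝ) (hθ₀ : Irrational (θ₀ / (2 * Real.pi))) :
    (∃ (U : Set (ℝ × (E × E))) (Ψ : ℝ → E × E → E × E),
      SymplecticLorentz.IsSymplecticLorentzMap Q ϑ J H θ₀ U Ψ) ∧
    ∀ (U : Set (ℝ × (E × E))) (Ψ : ℝ → E × E → E × E),
      SymplecticLorentz.IsSymplecticLorentzMap Q ϑ J H θ₀ U Ψ →
      ∀ C : Set (E × E), C ⊆ Q ×ˢ (univ : Set E) → IsCompact C →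
      ∀ N : ℝ, 0 < N → ∀ V₀ : ℝ, 0 < V₀ →
      ∃ V₁ : ℝ, 0 < V₁ ∧
        ∀ ħ : ℝ, 0 < ħ → ∀ p : E × E,
          SymplecticLorentz.PositivelyContained U Ψ C ħ p →
          SymplecticLorentz.velNorm ϑ J p.1 (p.2 - SymplecticLorentz.hamVF ϑ H p.1)
            < V₀ * Real.sqrt ħ →
          ∀ k : ℕ, (k : ℝ) ≤ ħ ^ (-N) →
            SymplecticLorentz.velNorm ϑ J ((Ψ ħ)^[k] p).1
                (((Ψ ħ)^[k] p).2 - SymplecticLorentz.hamVF ϑ H ((Ψ ħ)^[k] p).1)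
              ≤ V₁ * Real.sqrt ħ := by
  have h : SymplecticLorentz.IsAdmissible Q ϑ J H := ⟨hQo, hϑ, hJ, hH⟩
  refine ⟨h.exists_symplecticLorentzMap (SymplecticLorentz.one_sub_cos_ne_zero hθ₀),
    fun U Ψ hΨ C hCQ hC N hN V₀ hV₀ => ?_⟩
  -- Rounding `N` up only lengthens the time range, since `ħ ≤ 1` wherever `m` is used.
  obtain ⟨m, hm⟩ := exists_nat_ge N
  have hA : IsCompact (Prod.fst '' C) := hC.image continuous_fst
  have hAQ : Prod.fst '' C ⊆ Q := by
    rintro _ ⟨p, hp, rfl⟩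
    exact (hCQ hp).1
  obtain ⟨ε, hε, hmain⟩ := h.exists_metric_le hθ₀ hΨ hA hAQ m (V₀ ^ 2)
  obtain ⟨B, hB⟩ := h.exists_velNorm_le hC hCQ
  have hε' : 0 < min ε 1 := lt_min hε one_pos
  -- The first summand serves small `ħ`. The second serves `ħ ≥ min ε 1`, where the bound `B` for
  -- the relative velocity on `C` suffices for every `k`.
  refine ⟨√(V₀ ^ 2 + 1) + |B| / √(min ε 1), by positivity, fun ħ hħ p hp hv k hk => ?_⟩
  rcases lt_or_ge ħ (min ε 1) with hlt | hge
  · have hħ1 : ħ ≤ 1 := (hlt.trans_le (min_le_right _ _)).le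
    have hV : SymplecticLorentz.metric ϑ J p.1 (p.2 - SymplecticLorentz.hamVF ϑ H p.1)
        (p.2 - SymplecticLorentz.hamVF ϑ H p.1) ≤ V₀ ^ 2 * ħ := by
      rw [SymplecticLorentz.velNorm, Real.sqrt_lt' (by positivity), mul_pow,
        Real.sq_sqrt hħ.le] at hv
      exact hv.le
    have hk' : (k : ℝ) * ħ ^ m ≤ 1 := by
      have h1 : (k : ℝ) ≤ ħ ^ (-(m : ℝ)) :=
        hk.trans (Real.rpow_le_rpow_of_exponent_ge hħ hħ1 (neg_le_neg hm))
      rw [Real.rpow_neg hħ.le, Real.rpow_natCast] at h1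
      calc (k : ℝ) * ħ ^ m ≤ (ħ ^ m)⁻¹ * ħ ^ m := by gcongr
        _ = 1 := inv_mul_cancel₀ (by positivity)
    have h2 := hmain ħ (SymplecticLorentz.toRel ϑ H p) hħ (hlt.trans_le (min_le_left _ _))
      (fun k => by
        rw [SymplecticLorentz.iterate_relMap]
        exact ⟨_, (hp k).2, rfl⟩) hV k hk'
    rw [SymplecticLorentz.iterate_relMap] at h2
    calc _ ≤ √((V₀ ^ 2 + 1) * ħ) := Real.sqrt_le_sqrt h2
      _ = √(V₀ ^ 2 + 1) * √ħ := Real.sqrt_mul' _ hħ.le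
      _ ≤ _ := by gcongr; exact le_add_of_nonneg_right (by positivity)
  · calc _ ≤ |B| := (hB _ (hp k).2).trans (le_abs_self B)
      _ = |B| / √(min ε 1) * √(min ε 1) := (div_mul_cancel₀ _ (Real.sqrt_ne_zero'.2 hε')).symm
      _ ≤ |B| / √(min ε 1) * √ħ := by gcongr
      _ ≤ _ := by gcongr; exact le_add_of_nonneg_left (by positivity)
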